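/- Let $K$ be an algebraically closed field of characteristic $0$. There is a nonempty Zariski-open subset $U$ of the space of cubic forms in four variables over $K$ such that the following holds for every smooth cubic surface $X=\{F=0\}\subset\mathbb P^3_K$ with $F\in U$. Let $\pi\colon X\to\mathbb P^2$ be any morphism exhibiting $X$ as the blow-up of $\mathbb P^2$ at six points $P_1,\dots,P_6$ in general position (no three on a line, not all six on a conic). Let $\ell_{i,j}$ be the line through $P_i$ and $P_j$, and let $D=H_1+H_2$, where $H_1$ and $H_2$ are the hyperplane sections of $X$ given by the strict transforms $$H_1=\pi^{-1}_*(\ell_{1,2}+\ell_{3,4}+\ell_{5,6}),\qquad H_2=\pi^{-1}_*(\ell_{2,3}+\ell_{4,5}+\ell_{1,6}).$$ Let $f\colon\mathbb P^1\to X$ be a morphism with $f(\mathbb P^1)\not\subset D$ such that $f^*D$ is supported in at most two points. Then either $\pi(f(\mathbb P^1))$ is a single point, or $\pi(f(\mathbb P^1))$ is an irreducible plane curve of degree at most $2$. -/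

import Mathlib

/-!
Classical projective geometry over an algebraically closed field `K`: points of projective space,
loci of homogeneous forms, regular maps, the blow-up of the plane at six points.
-/

namespace CubicSurface

/-- Projective `n`-space over `K`, as its set of `K`-points. -/
abbrev PSpace (K : Type*) [Field K] (n : ℕ) : Type _ := Projectivization K (Fin (n + 1) → K)

/-- The polynomial `q` vanishes at the point `x`. It is only used for homogeneous `q`, for which
it does not depend on the chosen vector of homogeneous coordinates. -/
def VanishesAt {K : Type*} [Field K] {n : ℕ} (q : MvPolynomial (Fin (n + 1)) K)
    (x : PSpace K n) : Prop :=
  MvPolynomial.eval x.rep q = 0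

/-- The zero locus in projective space of a homogeneous form. -/
def zeroLocus {K : Type*} [Field K] {n : ℕ} (q : MvPolynomial (Fin (n + 1)) K) :
    Set (PSpace K n) :=
  {x | VanishesAt q x}

/-- The closure in the Zariski topology of projective space. -/
def zariskiClosure {K : Type*} [Field K] {n : ℕ} (S : Set (PSpace K n)) : Set (PSpace K n) :=
  {x | ∀ (d : ℕ) (q : MvPolynomial (Fin (n + 1)) K), q.IsHomogeneous d →
    (∀ y ∈ S, VanishesAt q y) → VanishesAt q x}

/-- `g` restricts to a regular map (morphism of varieties) from the locally closed subset `Z` of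
`ℙⁿ` to `ℙᵐ`: near each point of `Z` it is given by `m + 1` forms of the same degree without
common zero. (The open neighbourhood is the set where the forms are not all zero; multiplying
the forms by a further form shrinks it at will.) Values of `g` outside `Z` are irrelevant. -/
def IsRegularOn {K : Type*} [Field K] {n m : ℕ} (Z : Set (PSpace K n))
    (g : PSpace K n → PSpace K m) : Prop :=
  ∀ p ∈ Z, ∃ (d : ℕ) (φ : Fin (m + 1) → MvPolynomial (Fin (n + 1)) K),
    (∀ i, (φ i).IsHomogeneous d) ∧
    (fun i => MvPolynomial.eval p.rep (φ i)) ≠ 0 ∧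
    ∀ q ∈ Z, ∀ hq : (fun i => MvPolynomial.eval q.rep (φ i)) ≠ 0,
      g q = Projectivization.mk K (fun i => MvPolynomial.eval q.rep (φ i)) hq

/-- The line through two points (used for distinct points). -/
def lineThrough {K : Type*} [Field K] {n : ℕ} (p q : PSpace K n) : Set (PSpace K n) :=
  {x | x.submodule ≤ p.submodule ⊔ q.submodule}

/-- `L` is a line in projective space. -/
def IsLine {K : Type*} [Field K] {n : ℕ} (L : Set (PSpace K n)) : Prop :=
  ∃ p q : PSpace K n, p ≠ q ∧ L = lineThrough p q

/-- `C` is an irreducible plane curve of degree `d`. -/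
def IsPlaneCurveOfDegree {K : Type*} [Field K] (C : Set (PSpace K 2)) (d : ℕ) : Prop :=
  ∃ q : MvPolynomial (Fin 3) K, q.IsHomogeneous d ∧ Irreducible q ∧ C = zeroLocus q

/-- `F` is the equation of a smooth cubic surface in `ℙ³`. -/
structure IsSmoothCubic {K : Type*} [Field K] (F : MvPolynomial (Fin 4) K) : Prop where
  isHomogeneous : F.IsHomogeneous 3
  ne_zero : F ≠ 0
  smooth : ∀ x : PSpace K 3, VanishesAt F x → ∃ i, ¬ VanishesAt (MvPolynomial.pderiv i F) x

/-- Exponents of the twenty cubic monomials in four variables. -/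
abbrev CubicMonomial : Type := {m : Fin 4 →₀ ℕ // m.degree = 3}

/-- The vector of coefficients of a cubic form in four variables. -/
def cubicCoeffs {K : Type*} [Field K] (F : MvPolynomial (Fin 4) K) : CubicMonomial → K :=
  fun m => F.coeff m.1

/-- The property `Q` holds for the generic smooth cubic surface: it holds for all smooth
cubics in some nonempty (principal) Zariski-open subset of the 20-dimensional space of cubic
forms in four variables. -/
def HoldsForGenericSmoothCubic (K : Type*) [Field K]
    (Q : MvPolynomial (Fin 4) K → Prop) : Prop :=
  ∃ G : MvPolynomial CubicMonomial K, G ≠ 0 ∧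
    ∀ F : MvPolynomial (Fin 4) K, IsSmoothCubic F →
      MvPolynomial.eval (cubicCoeffs F) G ≠ 0 → Q F

/-- Six points of the plane in general position: distinct, no three on a line, and not all six
on a conic. -/
structure InGeneralPosition {K : Type*} [Field K] (P : Fin 6 → PSpace K 2) : Prop where
  injective : Function.Injective P
  no_three_collinear : ∀ i j k : Fin 6, i ≠ j → i ≠ k → j ≠ k → P k ∉ lineThrough (P i) (P j)
  not_on_conic : ∀ q : MvPolynomial (Fin 3) K, q.IsHomogeneous 2 →
    (∀ i, VanishesAt q (P i)) → q = 0

/-- `π` exhibits the smooth cubic surface `X ⊆ ℙ³` as the blow-up of the plane at the six points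
`P i`: it is a morphism `X → ℙ²`, its fibre over each `P i` is a line (the exceptional line over
`P i`), and away from these lines it is an isomorphism onto the complement of the six points.
As `X` is smooth, the morphisms with these properties are exactly the blow-ups of
the plane at the six points. -/
structure IsBlowUpAt {K : Type*} [Field K] (X : Set (PSpace K 3))
    (π : PSpace K 3 → PSpace K 2) (P : Fin 6 → PSpace K 2) : Prop where
  regular : IsRegularOn X π
  exceptional : ∀ i, IsLine {x | x ∈ X ∧ π x = P i}
  iso : ∃ s : PSpace K 2 → PSpace K 3,
    IsRegularOn (Set.range P)ᶜ s ∧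
    (∀ y ∉ Set.range P, s y ∈ X ∧ π (s y) = y) ∧
    (∀ x ∈ X, π x ∉ Set.range P → s (π x) = x)

/-- The strict transform in `X` of a plane curve `C` under the blow-up `π` at the points `P i`:
the closure of the preimage of the part of `C` away from these points. -/
def strictTransform {K : Type*} [Field K] (X : Set (PSpace K 3))
    (π : PSpace K 3 → PSpace K 2) (P : Fin 6 → PSpace K 2) (C : Set (PSpace K 2)) :
    Set (PSpace K 3) :=
  zariskiClosure {x | x ∈ X ∧ π x ∈ C \ Set.range P}

/-- The strict transform of `ℓ₁₂ + ℓ₃₄ + ℓ₅₆` (its support); the points are numbered from `0`. -/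
def H₁ {K : Type*} [Field K] (X : Set (PSpace K 3))
    (π : PSpace K 3 → PSpace K 2) (P : Fin 6 → PSpace K 2) : Set (PSpace K 3) :=
  strictTransform X π P (lineThrough (P 0) (P 1)) ∪
  strictTransform X π P (lineThrough (P 2) (P 3)) ∪
  strictTransform X π P (lineThrough (P 4) (P 5))

/-- The strict transform of `ℓ₂₃ + ℓ₄₅ + ℓ₁₆` (its support). -/
def H₂ {K : Type*} [Field K] (X : Set (PSpace K 3))
    (π : PSpace K 3 → PSpace K 2) (P : Fin 6 → PSpace K 2) : Set (PSpace K 3) :=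
  strictTransform X π P (lineThrough (P 1) (P 2)) ∪
  strictTransform X π P (lineThrough (P 3) (P 4)) ∪
  strictTransform X π P (lineThrough (P 0) (P 5))

/-- The support of the divisor `D = H₁ + H₂`. -/
def boundary {K : Type*} [Field K] (X : Set (PSpace K 3))
    (π : PSpace K 3 → PSpace K 2) (P : Fin 6 → PSpace K 2) : Set (PSpace K 3) :=
  H₁ X π P ∪ H₂ X π P

end CubicSurface

/-!
The proof describes the surface by explicit equations and compares coefficients.

The inverse of `π`, away from the points `P i`, is given by four forms `σ` of a common degree `e`
without common zero there. The minors of their Jacobian matrix are proportional to the gradient of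
`F` along `σ`, and the factor has no zero away from the finitely many points, so it is constant;
comparing degrees, `3 (e - 1) = 2 e`, so that `e = 3` (`degree_section_eq_three`). This is the fact
that the canonical class of a cubic surface is minus the hyperplane class. The cubics `σ` vanish at
all `P i`, and there are only four independent cubics which do so, hence every cubic through the six
points is a plane section of the surface (`IsInverseForms.exists_bind₁_lin_eq`). In particular this
holds for the two hexagons of lines `L 0`, `L 1`, for the three diagonals `L 2`, and for the three
triples `M i` formed by two opposite sides and a diagonal. On the plane `L 0 L 1 L 2 = M 0 M 1 M 2`,
which is therefore the equation of the surface (`IsInverseForms.exists_isCayleySalmon`), and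
the boundary contains the zeros of `L 0` and `L 1` (`IsCayleySalmon.mem_boundary`).

Four of the six linear forms, say `a` and `b` proportional to `L 0` and `L 1` and `c` and `e`
proportional to two of the `M i`, are coordinates of `ℙ³`. Scaling them puts the equation of
a generic surface in the form `a b (u a + v b + w c + z e) = c e (a + b + c + e)`. This family has
twenty parameters, as many as there are coefficients of a cubic form, hence any condition on
`u, v, w, z` of the form `h ≠ 0` holds on a Zariski-open set of cubic forms
(`exists_ne_zero_dvd_bind₁`, `IsGeneric.exists_isNormal`). The polynomial `h` is `discr`.

A curve `f` as in the theorem is parametrized by forms whose restrictions to an affine line are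
polynomials of degree at most `d`, and it meets the boundary only at `0` and `∞`. Hence `L 0` and
`L 1` become monomials. Since the surface is smooth, not both of them vanish at `0` (or `∞`) together
with two of the `M i`. Counting orders of vanishing, and comparing coefficients in the equation,
one finds that `discr` would be zero unless some `M i` is a constant times `L 0` or `L 1` along
the curve (`IsConfiguration.exists_eq_C_mul`), or some `M i` vanishes on it together with `L 2`.

A plane `M i = c L b` contains the line `L b = M i = 0`, and its residual intersection with
the surface is the transform of a plane conic. Thus the image of the curve in the plane satisfies an
equation of degree one or two (`IsCayleySalmon.exists_factor`, `IsCayleySalmon.exists_linear`), and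
if it is not a point it is the whole of a line or of an irreducible conic
(`IsGivenBy.exists_isPlaneCurve`).
-/

namespace CubicSurface

open MvPolynomial

/-! ### Homogeneous polynomials -/

section Homogeneous

variable {K : Type*} [Field K]

theorem eval_smul_of_isHomogeneous {σ : Type*} {p : MvPolynomial σ K} {n : ℕ}
    (hp : p.IsHomogeneous n) (c : K) (x : σ → K) : eval (c • x) p = c ^ n * eval x p := by
  classical
  rw [eval_eq, eval_eq, Finset.mul_sum]
  refine Finset.sum_congr rfl fun d hd => ?_
  have hdeg : ∑ i ∈ d.support, d i = n := by
    have := hp (mem_support_iff.1 hd)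
    rw [Finsupp.weight_apply] at this
    simpa [Finsupp.sum] using this
  simp only [Pi.smul_apply, smul_eq_mul, mul_pow, Finset.prod_mul_distrib, Finset.prod_pow_eq_pow_sum,
    hdeg]
  ring

/-- Evaluation at `(T x₀, T x₁, …)`, which collects the homogeneous components of a polynomial as
the coefficients of a polynomial in the extra variable `T`. -/
noncomputable def homogenizingHom (σ K : Type*) [Field K] :
    MvPolynomial σ K →ₐ[K] Polynomial (MvPolynomial σ K) :=
  aeval fun i => Polynomial.C (X i) * Polynomial.X

theorem homogenizingHom_monomial {σ : Type*} (d : σ →₀ ℕ) (a : K) :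
    homogenizingHom σ K (monomial d a) = Polynomial.monomial d.degree (monomial d a) := by
  have h : (d.prod fun i k => (Polynomial.C (X i : MvPolynomial σ K) * Polynomial.X) ^ k) =
      Polynomial.C (d.prod fun i k => (X i : MvPolynomial σ K) ^ k) *
        Polynomial.X ^ d.degree := by
    simp only [Finsupp.prod, mul_pow, Finset.prod_mul_distrib, Finset.prod_pow_eq_pow_sum, map_prod,
      map_pow, Finsupp.degree_apply]
  rw [homogenizingHom, aeval_monomial, h, ← Polynomial.C_mul_X_pow_eq_monomial, monomial_eq,
    Polynomial.C_mul, ← mul_assoc]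
  rfl

theorem coeff_homogenizingHom {σ : Type*} (p : MvPolynomial σ K) (n : ℕ) :
    (homogenizingHom σ K p).coeff n = homogeneousComponent n p := by
  classical
  induction p using MvPolynomial.induction_on' with
  | monomial d a =>
    rw [homogenizingHom_monomial, Polynomial.coeff_monomial]
    split_ifs with h
    · exact (homogeneousComponent_of_mem (isHomogeneous_monomial a h)).symm ▸ by simp
    · rw [homogeneousComponent_of_mem (n := d.degree) (isHomogeneous_monomial a rfl),
        if_neg (Ne.symm h)]
  | add p q hp hq => simp [hp, hq]

theorem eval_one_homogenizingHom {σ : Type*} (p : MvPolynomial σ K) :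
    (homogenizingHom σ K p).eval 1 = p := by
  induction p using MvPolynomial.induction_on with
  | C a => 
    simp [homogenizingHom, MvPolynomial.algebraMap_eq]
  | add p q hp hq => simp [hp, hq]
  | mul_X p i hp => simp [hp]; simp [homogenizingHom]

theorem isHomogeneous_of_mul {σ : Type*} {p q : MvPolynomial σ K} {n : ℕ}
    (h : (p * q).IsHomogeneous n) (h0 : p * q ≠ 0) : ∃ k, p.IsHomogeneous k := by
  have hp0 : p ≠ 0 := left_ne_zero_of_mul h0
  have hq0 : q ≠ 0 := right_ne_zero_of_mul h0
  have hinj : ∀ r : MvPolynomial σ K, r ≠ 0 → homogenizingHom σ K r ≠ 0 := fun r hr h => by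
    apply hr; rw [← eval_one_homogenizingHom r, h, Polynomial.eval_zero]
  have key : homogenizingHom σ K (p * q) = Polynomial.monomial n (p * q) := by
    ext1 m
    rw [coeff_homogenizingHom, Polynomial.coeff_monomial, homogeneousComponent_of_mem h]
    simp [eq_comm]
  have h1 : (homogenizingHom σ K p).natDegree + (homogenizingHom σ K q).natDegree = n := by
    rw [← Polynomial.natDegree_mul (hinj p hp0) (hinj q hq0), ← map_mul, key]
    exact Polynomial.natDegree_monomial_eq n h0
  have h2 : (homogenizingHom σ K p).natTrailingDegree +
      (homogenizingHom σ K q).natTrailingDegree = n := by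
    rw [← Polynomial.natTrailingDegree_mul (hinj p hp0) (hinj q hq0), ← map_mul, key]
    exact Polynomial.natTrailingDegree_monomial h0
  have h3 := Polynomial.natTrailingDegree_le_natDegree (homogenizingHom σ K p)
  have h4 := Polynomial.natTrailingDegree_le_natDegree (homogenizingHom σ K q)
  refine ⟨(homogenizingHom σ K p).natDegree, ?_⟩
  have hsum : (homogenizingHom σ K p) = Polynomial.monomial (homogenizingHom σ K p).natDegree
      (homogeneousComponent (homogenizingHom σ K p).natDegree p) := by
    ext1 m
    rw [Polynomial.coeff_monomial]
    split_ifs with hm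
    · rw [coeff_homogenizingHom, hm]
    · rcases lt_or_gt_of_ne hm with hm | hm
      · exact Polynomial.coeff_eq_zero_of_natDegree_lt hm
      · exact Polynomial.coeff_eq_zero_of_lt_natTrailingDegree (by omega)
  have : p = homogeneousComponent (homogenizingHom σ K p).natDegree p := by
    conv_lhs => rw [← eval_one_homogenizingHom p, hsum, Polynomial.eval_monomial, one_pow, mul_one]
  have hc := homogeneousComponent_isHomogeneous (homogenizingHom σ K p).natDegree p
  rwa [← this] at hc

theorem isHomogeneous_of_dvd {σ : Type*} {p q : MvPolynomial σ K} {n : ℕ}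
    (h : q.IsHomogeneous n) (h0 : q ≠ 0) (hpq : p ∣ q) : ∃ k, p.IsHomogeneous k := by
  obtain ⟨r, rfl⟩ := hpq
  exact isHomogeneous_of_mul h h0

theorem isUnit_of_isHomogeneous_zero {σ : Type*} {p : MvPolynomial σ K} (h : p.IsHomogeneous 0)
    (h0 : p ≠ 0) : IsUnit p := by
  have := (totalDegree_zero_iff_isHomogeneous σ).2 h
  rw [totalDegree_eq_zero_iff_eq_C] at this
  rw [this]
  refine (IsUnit.mk0 _ fun hc => h0 ?_).map C
  rw [this, hc, map_zero]

theorem dvd_of_forall_eval_eq_zero [IsAlgClosed K] {σ : Type*} [Finite σ]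
    {p q : MvPolynomial σ K} (hp : Irreducible p) (h : ∀ x, eval x p = 0 → eval x q = 0) :
    p ∣ q := by
  have hp' : Prime p := hp.prime
  have : (Ideal.span {p}).IsPrime := (Ideal.span_singleton_prime hp.ne_zero).2 hp'
  rw [← Ideal.mem_span_singleton, ← IsPrime.vanishingIdeal_zeroLocus (K := K) (Ideal.span {p}),
    mem_vanishingIdeal_iff]
  intro x hx
  simp only [mem_zeroLocus_iff] at hx
  have := hx p (Ideal.mem_span_singleton_self p)
  exact h x this

/-- The polynomial in `t` obtained from `p` along the line `x + t y`. -/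
noncomputable def restrictLine {σ : Type*} (x y : σ → K) :
    MvPolynomial σ K →ₐ[K] Polynomial K :=
  aeval fun i => Polynomial.C (x i) + Polynomial.X * Polynomial.C (y i)

theorem eval_restrictLine {σ : Type*} (x y : σ → K) (p : MvPolynomial σ K) (t : K) :
    (restrictLine x y p).eval t = eval (x + t • y) p := by
  change Polynomial.evalRingHom t (restrictLine x y p) = _
  rw [restrictLine, aeval_def, ← coe_eval₂Hom, ← RingHom.comp_apply, comp_eval₂Hom, eval]
  congr 2
  · ext; simp
  · ext i; simp [mul_comm t]

/-- A form of positive degree has a zero on every line of projective space. -/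
theorem exists_zero_on_line [IsAlgClosed K] {σ : Type*} {p : MvPolynomial σ K} {n : ℕ}
    (hp : p.IsHomogeneous n) (hn : n ≠ 0) (x y : σ → K) :
    ∃ a b : K, (a ≠ 0 ∨ b ≠ 0) ∧ eval (a • x + b • y) p = 0 := by
  set r := restrictLine x y p
  have hr : ∀ t, r.eval t = eval (x + t • y) p := eval_restrictLine x y p
  by_cases hroot : ∃ t, r.eval t = 0
  · obtain ⟨t, ht⟩ := hroot
    exact ⟨1, t, Or.inl one_ne_zero, by rw [one_smul, ← hr, ht]⟩
  · have hdeg : r.degree = 0 := by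
      by_contra hd
      exact hroot (IsAlgClosed.exists_root r hd)
    obtain ⟨c, hc⟩ : ∃ c, r = Polynomial.C c := ⟨_, Polynomial.eq_C_of_degree_eq_zero hdeg⟩
    -- `p (s x + y) = c sⁿ` for `s ≠ 0`, hence also for `s = 0`.
    refine ⟨0, 1, Or.inr one_ne_zero, ?_⟩
    set r' := restrictLine y x p
    have hr' : ∀ t, r'.eval t = eval (y + t • x) p := eval_restrictLine y x p
    have hpoly : Polynomial.X * r' = Polynomial.X * (Polynomial.C c * Polynomial.X ^ n) := by
      refine Polynomial.funext fun t => ?_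
      by_cases ht : t = 0
      · simp [ht]
      · have h1 : eval (y + t • x) p = t ^ n * eval (x + t⁻¹ • y) p := by
          rw [← eval_smul_of_isHomogeneous hp]
          congr 2
          rw [smul_add, smul_smul, mul_inv_cancel₀ ht, one_smul, add_comm]
        simp only [Polynomial.eval_mul, Polynomial.eval_X, Polynomial.eval_C, Polynomial.eval_pow]
        rw [hr', h1, ← hr, hc, Polynomial.eval_C, mul_comm c]
    have := mul_left_cancel₀ Polynomial.X_ne_zero hpoly
    have h2 := hr' 0
    rw [this] at h2
    simp [hn] at h2
    simpa using h2.symm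

/-! ### Linear forms -/

/-- The linear form with given coefficients. -/
noncomputable def lin {n : ℕ} (a : Fin n → K) : MvPolynomial (Fin n) K := ∑ i, C (a i) * X i

@[simp] theorem eval_lin {n : ℕ} (a x : Fin n → K) : eval x (lin a) = a ⬝ᵥ x := by
  simp [lin, dotProduct]

theorem isHomogeneous_lin {n : ℕ} (a : Fin n → K) : (lin a).IsHomogeneous 1 :=
  IsHomogeneous.sum _ _ _ fun _ _ => isHomogeneous_C_mul_X _ _

theorem coeff_lin {n : ℕ} (a : Fin n → K) (i : Fin n) :
    (lin a).coeff (Finsupp.single i 1) = a i := by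
  classical
  simp [lin, coeff_sum, coeff_C_mul, coeff_X, Finsupp.single_left_inj]

theorem lin_eq_zero {n : ℕ} {a : Fin n → K} : lin a = 0 ↔ a = 0 := by
  refine ⟨fun h => funext fun i => by rw [← coeff_lin a i, h]; simp, fun h => by simp [lin, h]⟩

theorem exists_eq_lin {n : ℕ} {p : MvPolynomial (Fin n) K} (hp : p.IsHomogeneous 1) :
    ∃ a, p = lin a := by
  have := (mem_homogeneousSubmodule 1 p).2 hp
  rw [homogeneousSubmodule_one_eq_span_X, Submodule.mem_span_range_iff_exists_fun] at this
  obtain ⟨a, rfl⟩ := this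
  exact ⟨a, by simp [lin, smul_eq_C_mul]⟩

theorem irreducible_of_isHomogeneous_one {σ : Type*} {p : MvPolynomial σ K}
    (hp : p.IsHomogeneous 1) (h0 : p ≠ 0) : Irreducible p := by
  refine ⟨fun hu => ?_, fun {a b} hab => ?_⟩
  · have h1 := hp.totalDegree h0
    have := (isUnit_iff_totalDegree_of_isReduced.1 hu).2
    omega
  · have hab0 : a * b ≠ 0 := hab ▸ h0
    obtain ⟨k, hk⟩ := isHomogeneous_of_mul (hab ▸ hp) hab0
    obtain ⟨l, hl⟩ := isHomogeneous_of_mul (p := b) (q := a) (by rw [mul_comm]; exact hab ▸ hp)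
      (by rwa [mul_comm])
    have : k + l = 1 := (hk.mul hl).inj_right (hab ▸ hp) hab0
    obtain rfl | rfl : k = 0 ∨ l = 0 := by omega
    · exact Or.inl (isUnit_of_isHomogeneous_zero hk (left_ne_zero_of_mul hab0))
    · exact Or.inr (isUnit_of_isHomogeneous_zero hl (right_ne_zero_of_mul hab0))

/-- A nonzero linear form vanishing at a given vector. -/
theorem exists_dotProduct_eq_zero {n : ℕ} (hn : 2 ≤ n) (v : Fin n → K) :
    ∃ a : Fin n → K, a ≠ 0 ∧ a ⬝ᵥ v = 0 := by
  obtain ⟨m, rfl⟩ : ∃ m, n = m + 2 := ⟨n - 2, by omega⟩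
  by_cases h : v 0 = 0
  · exact ⟨Pi.single 0 1, by simp, by simp [h]⟩
  · refine ⟨Pi.single 0 (v 1) + Pi.single 1 (-v 0), fun h0 => h ?_, ?_⟩
    · have := congrFun h0 1
      simpa using this
    · simp [add_dotProduct, mul_comm]

end Homogeneous

/-! ### Common factors -/

section Coprime

variable {K : Type*} [Field K] {σ ι : Type*} [Fintype ι]

/-- A family of polynomials without nonconstant common factor. -/
def IsPrimitiveFamily (φ : ι → MvPolynomial σ K) : Prop :=
  ∀ g, (∀ i, g ∣ φ i) → IsUnit g

theorem exists_isPrimitiveFamily (φ : ι → MvPolynomial σ K) (h : ∃ i, φ i ≠ 0) :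
    ∃ (g : MvPolynomial σ K) (ψ : ι → MvPolynomial σ K),
      (∀ i, φ i = g * ψ i) ∧ IsPrimitiveFamily ψ := by
  classical
  obtain ⟨i₀, hi₀⟩ := h
  let _ := Classical.choice (inferInstance : Nonempty (NormalizedGCDMonoid (MvPolynomial σ K)))
  obtain ⟨ψ, h1, h2⟩ := Finset.univ.extract_gcd φ ⟨i₀, Finset.mem_univ _⟩
  refine ⟨_, ψ, fun i => h1 i (Finset.mem_univ _), fun g hg => ?_⟩
  have := Finset.dvd_gcd (s := Finset.univ) (f := ψ) (a := g) fun i _ => hg i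
  rw [h2] at this
  exact isUnit_of_dvd_one this

/-- A vector proportional to a primitive vector of polynomials is a multiple of it. -/
theorem IsPrimitiveFamily.exists_eq_mul {φ ψ : ι → MvPolynomial σ K} (hφ : IsPrimitiveFamily φ)
    (h : ∀ i j, φ i * ψ j = φ j * ψ i) : ∃ c, ∀ i, ψ i = c * φ i := by
  classical
  have hne : ∃ i, φ i ≠ 0 := by
    by_contra! h0
    exact not_isUnit_zero (hφ 0 fun i => by rw [h0 i])
  obtain ⟨i, hi⟩ := hne
  let _ := Classical.choice (inferInstance : Nonempty (NormalizedGCDMonoid (MvPolynomial σ K)))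
  have h1 : φ i ∣ Finset.univ.gcd fun j => ψ i * φ j :=
    Finset.dvd_gcd fun j _ => ⟨ψ j, by rw [h i j]; ring⟩
  have h2 : IsUnit (Finset.univ.gcd φ) :=
    hφ _ fun j => Finset.gcd_dvd (Finset.mem_univ j)
  have h3 : φ i ∣ ψ i := by
    have := h1.trans (Finset.gcd_mul_left' Finset.univ φ (ψ i)).dvd
    exact h2.dvd_mul_right.1 this
  obtain ⟨c, hc⟩ := h3
  refine ⟨c, fun j => mul_left_cancel₀ hi ?_⟩
  rw [h i j, hc]; ring

end Coprime

/-! ### Points of projective space and forms -/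

section Points

variable {K : Type*} [Field K]

/-- The vector of values of a family of polynomials. -/
noncomputable def evalForms {σ ι : Type*} (φ : ι → MvPolynomial σ K) (v : σ → K) : ι → K :=
  fun i => eval v (φ i)

@[simp] theorem evalForms_apply {σ ι : Type*} (φ : ι → MvPolynomial σ K) (v : σ → K) (i : ι) :
    evalForms φ v i = eval v (φ i) := rfl

theorem evalForms_smul {σ ι : Type*} {φ : ι → MvPolynomial σ K} {d : ℕ}
    (h : ∀ i, (φ i).IsHomogeneous d) (c : K) (v : σ → K) :
    evalForms φ (c • v) = c ^ d • evalForms φ v :=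
  funext fun i => eval_smul_of_isHomogeneous (h i) c v

theorem mk_eq_mk_of_smul {V : Type*} [AddCommGroup V] [Module K V] {v w : V} (hv : v ≠ 0)
    (hw : w ≠ 0) (c : K) (h : v = c • w) :
    Projectivization.mk K v hv = Projectivization.mk K w hw :=
  (Projectivization.mk_eq_mk_iff' K v w hv hw).2 ⟨c, h.symm⟩

theorem exists_smul_of_mk_eq_mk {V : Type*} [AddCommGroup V] [Module K V] {v w : V} {hv : v ≠ 0}
    {hw : w ≠ 0} (h : Projectivization.mk K v hv = Projectivization.mk K w hw) :
    ∃ c : K, c ≠ 0 ∧ v = c • w := by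
  obtain ⟨c, hc⟩ := (Projectivization.mk_eq_mk_iff' K v w hv hw).1 h
  exact ⟨c, fun h0 => hv (by rw [← hc, h0, zero_smul]), hc.symm⟩

theorem exists_rep_mk_eq_smul {V : Type*} [AddCommGroup V] [Module K V] {v : V} (hv : v ≠ 0) :
    ∃ c : K, c ≠ 0 ∧ (Projectivization.mk K v hv).rep = c • v := by
  obtain ⟨a, ha⟩ := Projectivization.exists_smul_eq_mk_rep K v hv
  exact ⟨a, a.ne_zero, ha.symm⟩

theorem vanishesAt_mk {n d : ℕ} {q : MvPolynomial (Fin (n + 1)) K} (hq : q.IsHomogeneous d)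
    {v : Fin (n + 1) → K} (hv : v ≠ 0) :
    VanishesAt q (Projectivization.mk K v hv) ↔ eval v q = 0 := by
  obtain ⟨c, hc, h⟩ := exists_rep_mk_eq_smul (K := K) hv
  rw [VanishesAt, h, eval_smul_of_isHomogeneous hq, mul_eq_zero_iff_left (pow_ne_zero _ hc)]

theorem IsRegularOn.exists_local {n m : ℕ} {Z : Set (PSpace K n)} {g : PSpace K n → PSpace K m}
    (h : IsRegularOn Z g) (v : Fin (n + 1) → K) (hv : v ≠ 0)
    (hZ : Projectivization.mk K v hv ∈ Z) :
    ∃ (d : ℕ) (φ : Fin (m + 1) → MvPolynomial (Fin (n + 1)) K), (∀ i, (φ i).IsHomogeneous d) ∧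
      evalForms φ v ≠ 0 ∧ ∀ w (hw : w ≠ 0), Projectivization.mk K w hw ∈ Z →
        ∀ h0 : evalForms φ w ≠ 0,
          g (Projectivization.mk K w hw) = Projectivization.mk K (evalForms φ w) h0 := by
  obtain ⟨d, φ, h1, h2, h3⟩ := h _ hZ
  have key : ∀ w (hw : w ≠ 0), ∃ c : K, c ≠ 0 ∧
      (fun i => eval (Projectivization.mk K w hw).rep (φ i)) = c • evalForms φ w := by
    intro w hw
    obtain ⟨c, hc, hr⟩ := exists_rep_mk_eq_smul (K := K) hw
    refine ⟨c ^ d, pow_ne_zero _ hc, ?_⟩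
    rw [hr, ← evalForms_smul h1]; rfl
  refine ⟨d, φ, h1, fun h0 => ?_, fun w hw hwZ h0 => ?_⟩
  · obtain ⟨c, hc, hr⟩ := key v hv
    rw [hr, h0, smul_zero] at h2
    exact h2 rfl
  · obtain ⟨c, hc, hr⟩ := key w hw
    rw [h3 _ hwZ (by rw [hr]; exact smul_ne_zero hc h0)]
    exact mk_eq_mk_of_smul _ _ c hr

theorem eq_zero_of_eval_eq_zero_off_finite [Infinite K] {n : ℕ} (hn : 1 ≤ n)
    {S : Set (PSpace K n)} (hS : S.Finite) {q : MvPolynomial (Fin (n + 1)) K}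
    (h : ∀ v (hv : v ≠ 0), Projectivization.mk K v hv ∉ S → eval v q = 0) : q = 0 := by
  choose a ha0 ha using fun p : PSpace K n => exists_dotProduct_eq_zero (by omega) p.rep
  have key : q * (X 0 * ∏ p ∈ hS.toFinset, lin (a p)) = 0 := by
    refine MvPolynomial.funext fun v => ?_
    by_cases hv : v = 0
    · simp [hv]
    by_cases hvS : Projectivization.mk K v hv ∈ S
    · have : eval v (lin (a (Projectivization.mk K v hv))) = 0 := by
        obtain ⟨c, hc, hr⟩ := exists_rep_mk_eq_smul (K := K) hv
        have := ha (Projectivization.mk K v hv)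
        rw [hr, dotProduct_smul, smul_eq_mul, mul_eq_zero_iff_left hc] at this
        rw [eval_lin, this]
      rw [map_mul, map_mul, map_prod, Finset.prod_eq_zero (hS.mem_toFinset.2 hvS) this]
      simp
    · simp [h v hv hvS]
  refine (mul_eq_zero.1 key).resolve_right (mul_ne_zero (X_ne_zero 0) ?_)
  exact Finset.prod_ne_zero_iff.2 fun p _ => lin_eq_zero.not.2 (ha0 p)

theorem exists_pair_dotProduct_eq_zero {n : ℕ} (hn : 3 ≤ n) (a : Fin n → K) :
    ∃ x y : Fin n → K, LinearIndependent K ![x, y] ∧ a ⬝ᵥ x = 0 ∧ a ⬝ᵥ y = 0 := by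
  let f : (Fin n → K) →ₗ[K] K := dotProductBilin K K a
  have hr := LinearMap.finrank_range_add_finrank_ker f
  have h1 : Module.finrank K (LinearMap.range f) ≤ 1 := by
    simpa using Submodule.finrank_le (LinearMap.range f)
  rw [Module.finrank_fin_fun] at hr
  have h2 : 1 < Module.finrank K (LinearMap.ker f) := by omega
  have h3 : 0 < Module.finrank K (LinearMap.ker f) := by omega
  obtain ⟨x, hx⟩ := Module.finrank_pos_iff_exists_ne_zero.1 h3
  obtain ⟨y, hy⟩ := exists_linearIndependent_pair_of_one_lt_finrank h2 hx
  refine ⟨x, y, ?_, x.2, y.2⟩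
  have := hy.map' (LinearMap.ker f).subtype (Submodule.ker_subtype _)
  have h4 : (LinearMap.ker f).subtype ∘ ![x, y] = ![x.1, y.1] := by
    ext i
    fin_cases i <;> rfl
  rwa [h4] at this

theorem add_smul_ne_zero_of_pair {V : Type*} [AddCommGroup V] [Module K V] {x y : V}
    (h : LinearIndependent K ![x, y]) {a b : K} (hab : a ≠ 0 ∨ b ≠ 0) : a • x + b • y ≠ 0 := by
  intro h0
  have := LinearIndependent.pair_iff.1 h a b h0
  tauto

/-- A form of positive degree and a linear form in at least three variables have a common
nontrivial zero. -/
theorem exists_common_zero_lin [IsAlgClosed K] {n d : ℕ} (hn : 3 ≤ n)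
    {p : MvPolynomial (Fin n) K} (hp : p.IsHomogeneous d) (hd : d ≠ 0) (a : Fin n → K) :
    ∃ v, v ≠ 0 ∧ a ⬝ᵥ v = 0 ∧ eval v p = 0 := by
  obtain ⟨x, y, hxy, hx, hy⟩ := exists_pair_dotProduct_eq_zero hn a
  obtain ⟨s, t, hst, h0⟩ := exists_zero_on_line hp hd x y
  refine ⟨_, add_smul_ne_zero_of_pair hxy hst, ?_, h0⟩
  simp [dotProduct_add, dotProduct_smul, hx, hy]

/-- A plane form of positive degree has infinitely many zeros in the plane. -/
theorem exists_zero_off_finite [IsAlgClosed K] {d : ℕ} {S : Set (PSpace K 2)} (hS : S.Finite)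
    {p : MvPolynomial (Fin 3) K} (hp : p.IsHomogeneous d) (hd : d ≠ 0) :
    ∃ v, ∃ hv : v ≠ 0, Projectivization.mk K v hv ∉ S ∧ eval v p = 0 := by
  have : Infinite K := IsAlgClosed.instInfinite
  have h1 : ∏ p ∈ hS.toFinset, lin p.rep ≠ 0 :=
    Finset.prod_ne_zero_iff.2 fun p _ => lin_eq_zero.not.2 p.rep_nonzero
  -- A line which avoids the finite set.
  obtain ⟨a, ha⟩ : ∃ a, eval a (∏ p ∈ hS.toFinset, lin p.rep) ≠ 0 := by
    by_contra! h
    exact h1 (MvPolynomial.funext fun a => by rw [h a, map_zero])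
  rw [map_prod, Finset.prod_ne_zero_iff] at ha
  obtain ⟨v, hv, hav, hpv⟩ := exists_common_zero_lin le_rfl hp hd a
  refine ⟨v, hv, fun hmem => ?_, hpv⟩
  apply ha _ (hS.mem_toFinset.2 hmem)
  obtain ⟨c, hc, hr⟩ := exists_rep_mk_eq_smul (K := K) hv
  rw [eval_lin, hr, smul_dotProduct, dotProduct_comm, hav, smul_zero]

end Points

/-! ### Regular maps given by global forms -/

section Global

variable {K : Type*} [Field K]

/-- `g` is given on `Z` by the forms `φ` of degree `d`, which have no common zero on `Z`. -/
structure IsGivenBy {n m : ℕ} (Z : Set (PSpace K n)) (g : PSpace K n → PSpace K m) (d : ℕ)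
    (φ : Fin (m + 1) → MvPolynomial (Fin (n + 1)) K) : Prop where
  homog : ∀ i, (φ i).IsHomogeneous d
  ne_zero : ∀ v (hv : v ≠ 0), Projectivization.mk K v hv ∈ Z → evalForms φ v ≠ 0
  eq_mk : ∀ v (hv : v ≠ 0), Projectivization.mk K v hv ∈ Z → ∀ h : evalForms φ v ≠ 0,
    g (Projectivization.mk K v hv) = Projectivization.mk K (evalForms φ v) h

/-- Outside finitely many points of projective space, a regular map is given by global forms:
as polynomial rings are factorial, the local expressions with common factors
removed all agree. -/
theorem IsRegularOn.exists_isGivenBy [IsAlgClosed K] {n m : ℕ} (hn : 1 ≤ n)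
    {Z : Set (PSpace K n)} (hZ : Zᶜ.Finite) {g : PSpace K n → PSpace K m} (h : IsRegularOn Z g) :
    ∃ d φ, IsGivenBy Z g d φ := by
  have : Infinite K := IsAlgClosed.instInfinite
  have hne : ∃ v : Fin (n + 1) → K, ∃ hv : v ≠ 0, Projectivization.mk K v hv ∈ Z := by
    by_contra! h0
    exact one_ne_zero (α := MvPolynomial (Fin (n + 1)) K)
      (eq_zero_of_eval_eq_zero_off_finite hn hZ fun v hv hv' => absurd (not_not.1 hv') (h0 v hv))
  obtain ⟨v₀, hv₀, hv₀Z⟩ := hne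
  obtain ⟨d₀, φ₀, hφ₀, hφ₀v, hφ₀g⟩ := h.exists_local v₀ hv₀ hv₀Z
  have hφ₀ne : ∃ i, φ₀ i ≠ 0 := by
    by_contra! h0
    exact hφ₀v (funext fun i => by simp [h0 i])
  obtain ⟨q, φ, hφ, hprim⟩ := exists_isPrimitiveFamily φ₀ hφ₀ne
  obtain ⟨i₀, hi₀⟩ := hφ₀ne
  have hq0 : q ≠ 0 := fun hq => hi₀ (by rw [hφ, hq, zero_mul])
  obtain ⟨e, he⟩ := isHomogeneous_of_dvd (hφ₀ i₀) hi₀ ⟨_, hφ i₀⟩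
  -- The reduced forms have the same degree.
  have hhom : ∀ i, (φ i).IsHomogeneous (d₀ - e) := by
    intro i
    by_cases hi : φ i = 0
    · rw [hi]; exact isHomogeneous_zero _ _ _
    have hi' : φ₀ i ≠ 0 := by rw [hφ]; exact mul_ne_zero hq0 hi
    obtain ⟨k, hk⟩ := isHomogeneous_of_dvd (hφ₀ i) hi' ⟨q, by rw [hφ, mul_comm]⟩
    have : e + k = d₀ := (he.mul hk).inj_right (hφ i ▸ hφ₀ i) (hφ i ▸ hi')
    have h' : d₀ - e = k := by omega
    rwa [h']
  have key : ∀ v (hv : v ≠ 0), Projectivization.mk K v hv ∈ Z →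
      ∃ ψ : Fin (m + 1) → MvPolynomial (Fin (n + 1)) K, ∃ c : MvPolynomial (Fin (n + 1)) K,
        (∀ i, ψ i = c * φ i) ∧ evalForms ψ v ≠ 0 ∧ ∀ h0 : evalForms ψ v ≠ 0,
        g (Projectivization.mk K v hv) = Projectivization.mk K (evalForms ψ v) h0 := by
    intro v hv hvZ
    obtain ⟨d, ψ, hψ, hψv, hψg⟩ := h.exists_local v hv hvZ
    have hcross : ∀ i j, φ i * ψ j = φ j * ψ i := by
      intro i j
      rw [← sub_eq_zero]
      have h1 : q * (φ i * ψ j - φ j * ψ i) = 0 := by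
        refine eq_zero_of_eval_eq_zero_off_finite hn hZ fun w hw hwZ => ?_
        have e1 : q * (φ i * ψ j - φ j * ψ i) = φ₀ i * ψ j - φ₀ j * ψ i := by
          rw [hφ, hφ]; ring
        rw [e1]
        by_cases hw1 : evalForms φ₀ w = 0
        · have h1 : eval w (φ₀ i) = 0 := congrFun hw1 i
          have h2 : eval w (φ₀ j) = 0 := congrFun hw1 j
          rw [map_sub, map_mul, map_mul, h1, h2]
          simp
        by_cases hw2 : evalForms ψ w = 0
        · have h1 : eval w (ψ i) = 0 := congrFun hw2 i
          have h2 : eval w (ψ j) = 0 := congrFun hw2 j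
          rw [map_sub, map_mul, map_mul, h1, h2]
          simp
        have h2 := (hφ₀g w hw (not_not.1 hwZ) hw1).symm.trans (hψg w hw (not_not.1 hwZ) hw2)
        obtain ⟨c, -, hc⟩ := exists_smul_of_mk_eq_mk h2
        have hi := congrFun hc i
        have hj := congrFun hc j
        simp only [evalForms_apply, Pi.smul_apply, smul_eq_mul] at hi hj
        rw [map_sub, map_mul, map_mul, hi, hj]
        ring
      exact (mul_eq_zero.1 h1).resolve_left hq0
    obtain ⟨c, hc⟩ := hprim.exists_eq_mul hcross
    exact ⟨ψ, c, hc, hψv, fun h0 => hψg v hv hvZ h0⟩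
  refine ⟨d₀ - e, φ, hhom, fun v hv hvZ h0 => ?_, fun v hv hvZ h0 => ?_⟩
  · obtain ⟨ψ, c, hc, hψv, -⟩ := key v hv hvZ
    apply hψv
    ext i
    have := congrFun h0 i
    simp_all
  · obtain ⟨ψ, c, hc, hψv, hψ⟩ := key v hv hvZ
    rw [hψ hψv]
    refine mk_eq_mk_of_smul _ _ (eval v c) (funext fun i => ?_)
    simp [hc]

end Global

/-! ### Smooth cubic forms -/

section Smooth

variable {K : Type*} [Field K]

theorem IsSmoothCubic.exists_pderiv_ne_zero {F : MvPolynomial (Fin 4) K} (hF : IsSmoothCubic F)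
    {v : Fin 4 → K} (hv : v ≠ 0) (h : eval v F = 0) : ∃ i, eval v (pderiv i F) ≠ 0 := by
  obtain ⟨i, hi⟩ := hF.smooth (Projectivization.mk K v hv) ((vanishesAt_mk hF.isHomogeneous hv).2 h)
  exact ⟨i, fun h0 => hi ((vanishesAt_mk (hF.isHomogeneous.pderiv (i := i)) hv).2 h0)⟩

theorem mk_mem_zeroLocus {n d : ℕ} {q : MvPolynomial (Fin (n + 1)) K} (hq : q.IsHomogeneous d)
    {v : Fin (n + 1) → K} (hv : v ≠ 0) :
    Projectivization.mk K v hv ∈ zeroLocus q ↔ eval v q = 0 := vanishesAt_mk hq hv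

/-- A common zero of two factors would be a singular point. -/
theorem IsSmoothCubic.eval_ne_zero_of_eq_mul {F A B : MvPolynomial (Fin 4) K}
    (hF : IsSmoothCubic F) (h : F = A * B) {v : Fin 4 → K} (hv : v ≠ 0) (hA : eval v A = 0) :
    eval v B ≠ 0 := by
  intro hB
  obtain ⟨i, hi⟩ := hF.exists_pderiv_ne_zero hv (by rw [h, map_mul, hA, zero_mul])
  apply hi
  rw [h, pderiv_mul, map_add, map_mul, map_mul, hA, hB]
  ring

theorem IsSmoothCubic.irreducible [IsAlgClosed K] {F : MvPolynomial (Fin 4) K}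
    (hF : IsSmoothCubic F) : Irreducible F := by
  have main : ∀ A B : MvPolynomial (Fin 4) K, F = A * B → A.IsHomogeneous 1 →
      B.IsHomogeneous 2 → False := by
    intro A B h hA hB
    obtain ⟨a, rfl⟩ := exists_eq_lin hA
    obtain ⟨v, hv, hav, hBv⟩ := exists_common_zero_lin (by norm_num) hB two_ne_zero a
    exact hF.eval_ne_zero_of_eq_mul h hv (by rw [eval_lin, hav]) hBv
  refine ⟨fun hu => ?_, fun {A B} h => ?_⟩
  · have h1 := hF.isHomogeneous.totalDegree hF.ne_zero
    have := (isUnit_iff_totalDegree_of_isReduced.1 hu).2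
    omega
  · have hAB : A * B ≠ 0 := h ▸ hF.ne_zero
    obtain ⟨k, hk⟩ := isHomogeneous_of_mul (h ▸ hF.isHomogeneous) hAB
    obtain ⟨l, hl⟩ := isHomogeneous_of_mul (p := B) (q := A)
      (by rw [mul_comm]; exact h ▸ hF.isHomogeneous) (by rwa [mul_comm])
    have hkl : k + l = 3 := (hk.mul hl).inj_right (h ▸ hF.isHomogeneous) hAB
    obtain rfl | rfl | rfl | rfl : k = 0 ∨ k = 1 ∨ k = 2 ∨ k = 3 := by omega
    · exact Or.inl (isUnit_of_isHomogeneous_zero hk (left_ne_zero_of_mul hAB))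
    · obtain rfl : l = 2 := by omega
      exact (main A B h hk hl).elim
    · obtain rfl : l = 1 := by omega
      exact (main B A (by rw [h, mul_comm]) hl hk).elim
    · obtain rfl : l = 0 := by omega
      exact Or.inr (isUnit_of_isHomogeneous_zero hl (right_ne_zero_of_mul hAB))

end Smooth

/-! ### Maximal minors of a `3 × 4` matrix -/

section Minors

variable {R : Type*} [CommRing R]

/-- The signed maximal minors of a `3 × 4` matrix. -/
def minors (J : Fin 3 → Fin 4 → R) : Fin 4 → R :=
  let D : Fin 4 → Fin 4 → Fin 4 → R := fun a b c =>
    J 0 a * (J 1 b * J 2 c - J 1 c * J 2 b) - J 0 b * (J 1 a * J 2 c - J 1 c * J 2 a) +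
      J 0 c * (J 1 a * J 2 b - J 1 b * J 2 a)
  ![D 1 2 3, -D 0 2 3, D 0 1 3, -D 0 1 2]

/-- A vector in the kernel of a `3 × 4` matrix is proportional to the vector of minors. -/
theorem minors_mul_comm (J : Fin 3 → Fin 4 → R) (w : Fin 4 → R)
    (h : ∀ k, ∑ j, J k j * w j = 0) (i j : Fin 4) :
    minors J i * w j = minors J j * w i := by
  have h0 := h 0
  have h1 := h 1
  have h2 := h 2
  simp only [Fin.sum_univ_four] at h0 h1 h2
  have key : ∀ i j : Fin 4, i < j → minors J i * w j = minors J j * w i := by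
    intro i j hij
    fin_cases i <;> fin_cases j <;> first | (exact absurd hij (by decide)) | skip
    all_goals simp [minors]
    · linear_combination (J 1 2 * J 2 3 - J 1 3 * J 2 2) * h0 -
        (J 0 2 * J 2 3 - J 0 3 * J 2 2) * h1 + (J 0 2 * J 1 3 - J 0 3 * J 1 2) * h2
    · linear_combination -(J 1 1 * J 2 3 - J 1 3 * J 2 1) * h0 +
        (J 0 1 * J 2 3 - J 0 3 * J 2 1) * h1 - (J 0 1 * J 1 3 - J 0 3 * J 1 1) * h2
    · linear_combination (J 1 1 * J 2 2 - J 1 2 * J 2 1) * h0 -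
        (J 0 1 * J 2 2 - J 0 2 * J 2 1) * h1 + (J 0 1 * J 1 2 - J 0 2 * J 1 1) * h2
    · linear_combination (J 1 0 * J 2 3 - J 1 3 * J 2 0) * h0 -
        (J 0 0 * J 2 3 - J 0 3 * J 2 0) * h1 + (J 0 0 * J 1 3 - J 0 3 * J 1 0) * h2
    · linear_combination -(J 1 0 * J 2 2 - J 1 2 * J 2 0) * h0 +
        (J 0 0 * J 2 2 - J 0 2 * J 2 0) * h1 - (J 0 0 * J 1 2 - J 0 2 * J 1 0) * h2
    · linear_combination (J 1 0 * J 2 1 - J 1 1 * J 2 0) * h0 -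
        (J 0 0 * J 2 1 - J 0 1 * J 2 0) * h1 + (J 0 0 * J 1 1 - J 0 1 * J 1 0) * h2
  rcases lt_trichotomy i j with hij | rfl | hij
  · exact key i j hij
  · rfl
  · exact (key j i hij).symm

/-- The Cauchy–Binet formula for a `3 × 4` matrix times a `4 × 3` matrix. -/
theorem det_mul_eq_sum_minors (J : Fin 3 → Fin 4 → R) (Φ : Fin 4 → Fin 3 → R) :
    (Matrix.of fun k i => ∑ j, J k j * Φ j i).det = ∑ j, minors J j * minors (fun i j => Φ j i) j := by
  rw [Matrix.det_fin_three]
  simp only [Matrix.of_apply, Fin.sum_univ_four, minors, Matrix.cons_val]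
  ring

theorem minors_ne_zero {K : Type*} [Field K] (J : Fin 3 → Fin 4 → K) (Φ : Fin 4 → Fin 3 → K)
    (g x : Fin 3 → K) (r : K) (h : ∀ k i, ∑ j, J k j * Φ j i = g k * x i + if k = i then r else 0)
    (hr : r ^ 2 * (r + ∑ k, g k * x k) ≠ 0) : minors J ≠ 0 := by
  intro h0
  apply hr
  have h1 := det_mul_eq_sum_minors J Φ
  simp only [h, h0, Pi.zero_apply, zero_mul, Finset.sum_const_zero] at h1
  rw [Matrix.det_fin_three] at h1
  simp [Fin.sum_univ_three] at h1 ⊢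
  by_contra hcon
  have h2 : r ^ 2 * (r + (g 0 * x 0 + g 1 * x 1 + g 2 * x 2)) = 0 := by linear_combination h1
  rcases mul_eq_zero.1 h2 with h3 | h3
  · exact hcon (Or.inl (pow_eq_zero_iff two_ne_zero |>.1 h3))
  · exact hcon (Or.inr h3)

end Minors

/-! ### The inverse of a blow-down is given by cubic forms -/

section Inverse

variable {K : Type*} [Field K]

theorem eval_bind₁ {σ τ : Type*} (φ : τ → MvPolynomial σ K) (p : MvPolynomial τ K) (v : σ → K) :
    eval v (bind₁ φ p) = eval (evalForms φ v) p := by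
  change (eval v).comp (bind₁ φ).toRingHom p = _
  congr 1
  ext i
  · simp
  · simp

theorem isHomogeneous_bind₁ {σ τ : Type*} {φ : τ → MvPolynomial σ K} {p : MvPolynomial τ K}
    {m n : ℕ} (hφ : ∀ i, (φ i).IsHomogeneous n) (hp : p.IsHomogeneous m) :
    (bind₁ φ p).IsHomogeneous (n * m) := hp.aeval _ hφ

theorem pderiv_bind₁ {σ τ : Type*} [Fintype τ] (φ : τ → MvPolynomial σ K) (p : MvPolynomial τ K)
    (k : σ) : pderiv k (bind₁ φ p) = ∑ j, pderiv k (φ j) * bind₁ φ (pderiv j p) := by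
  classical
  induction p using MvPolynomial.induction_on with
  | C a => simp
  | add p q hp hq => simp [hp, hq, mul_add, Finset.sum_add_distrib]
  | mul_X p i hp =>
    simp only [map_mul, bind₁_X_right, pderiv_mul, hp, map_add, mul_add, Finset.sum_add_distrib,
      Finset.sum_mul, pderiv_X, Pi.single_apply]
    congr 1
    · exact Finset.sum_congr rfl fun j _ => by ring
    · simp [Finset.sum_ite_eq, apply_ite, mul_comm]

theorem isPrimitiveFamily_X {n : ℕ} : IsPrimitiveFamily (X : Fin (n + 2) → MvPolynomial _ K) := by
  intro g hg
  have hX : Irreducible (X 0 : MvPolynomial (Fin (n + 2)) K) :=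
    irreducible_of_isHomogeneous_one (isHomogeneous_X _ _) (X_ne_zero _)
  obtain ⟨r, hr⟩ := hg 0
  rcases hX.isUnit_or_isUnit hr with h | h
  · exact h
  · exfalso
    obtain ⟨q, hq⟩ : (X 0 : MvPolynomial (Fin (n + 2)) K) ∣ X 1 := by
      rw [hr]; exact h.mul_right_dvd.2 (hg 1)
    have := congrArg (eval (Pi.single 1 1)) hq
    simp at this

variable {F : MvPolynomial (Fin 4) K} {π : PSpace K 3 → PSpace K 2} {S : Set (PSpace K 2)}
  {s : PSpace K 2 → PSpace K 3} {e : ℕ} {σ : Fin 4 → MvPolynomial (Fin 3) K}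

theorem bind₁_eq_zero_of_section [IsAlgClosed K] (hF : F.IsHomogeneous 3) (hS : S.Finite)
    (hσ : IsGivenBy Sᶜ s e σ) (hs : ∀ y ∉ S, s y ∈ zeroLocus F) : bind₁ σ F = 0 := by
  have : Infinite K := IsAlgClosed.instInfinite
  refine eq_zero_of_eval_eq_zero_off_finite (by norm_num) hS fun v hv hvS => ?_
  have h0 := hσ.ne_zero v hv hvS
  have h1 := hs _ hvS
  rw [hσ.eq_mk v hv hvS h0, mk_mem_zeroLocus hF] at h1
  rw [eval_bind₁, h1]

/-- Near a point in the image of the section `s`, the map `π` inverts `s` up to a factor `ρ`. -/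
theorem exists_local_inverse [IsAlgClosed K] (hS : S.Finite)
    (hπ : IsRegularOn (zeroLocus F) π) (hσ : IsGivenBy Sᶜ s e σ)
    (hs : ∀ y ∉ S, s y ∈ zeroLocus F ∧ π (s y) = y) (v : Fin 3 → K) (hv : v ≠ 0)
    (hvS : Projectivization.mk K v hv ∉ S) :
    ∃ (k : ℕ) (φ : Fin 3 → MvPolynomial (Fin 4) K) (ρ : MvPolynomial (Fin 3) K),
      (∀ i, (φ i).IsHomogeneous k) ∧ (∀ i, bind₁ σ (φ i) = ρ * X i) ∧ eval v ρ ≠ 0 := by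
  have : Infinite K := IsAlgClosed.instInfinite
  have h0 := hσ.ne_zero v hv hvS
  have h1 := (hs _ hvS).1
  rw [hσ.eq_mk v hv hvS h0] at h1
  obtain ⟨k, φ, hφ, hφ0, hφπ⟩ := hπ.exists_local _ h0 h1
  have hcross : ∀ i j, X i * bind₁ σ (φ j) = X j * bind₁ σ (φ i) := by
    intro i j
    rw [← sub_eq_zero]
    refine eq_zero_of_eval_eq_zero_off_finite (by norm_num) hS fun w hw hwS => ?_
    have hw0 := hσ.ne_zero w hw hwS
    obtain ⟨hw1, hw2⟩ := hs _ hwS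
    rw [hσ.eq_mk w hw hwS hw0] at hw1 hw2
    rw [map_sub, map_mul, map_mul, eval_bind₁, eval_bind₁, eval_X, eval_X]
    by_cases hz : evalForms φ (evalForms σ w) = 0
    · have hi : eval (evalForms σ w) (φ i) = 0 := congrFun hz i
      have hj : eval (evalForms σ w) (φ j) = 0 := congrFun hz j
      rw [hi, hj]; ring
    · obtain ⟨c, -, hc⟩ := exists_smul_of_mk_eq_mk ((hφπ _ hw0 hw1 hz).symm.trans hw2)
      have hi : eval (evalForms σ w) (φ i) = c * w i := congrFun hc i
      have hj : eval (evalForms σ w) (φ j) = c * w j := congrFun hc j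
      rw [hi, hj]; ring
  obtain ⟨ρ, hρ⟩ := isPrimitiveFamily_X.exists_eq_mul hcross
  refine ⟨k, φ, ρ, hφ, hρ, fun h => hφ0 ?_⟩
  ext i
  rw [evalForms_apply, ← eval_bind₁, hρ, map_mul, h, zero_mul, Pi.zero_apply]

/-- The forms `σ` are an immersion, since `π` inverts them locally. -/
theorem exists_minors_ne_zero [IsAlgClosed K] [CharZero K] (hS : S.Finite)
    (hπ : IsRegularOn (zeroLocus F) π) (hσ : IsGivenBy Sᶜ s e σ)
    (hs : ∀ y ∉ S, s y ∈ zeroLocus F ∧ π (s y) = y) (v : Fin 3 → K) (hv : v ≠ 0)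
    (hvS : Projectivization.mk K v hv ∉ S) :
    e ≠ 0 ∧ ∃ j, eval v (minors (fun k j => pderiv k (σ j)) j) ≠ 0 := by
  obtain ⟨k, φ, ρ, hφ, hρ, hρv⟩ := exists_local_inverse hS hπ hσ hs v hv hvS
  have hρ0 : ρ ≠ 0 := by rintro rfl; simp at hρv
  have hhom : (ρ * X 0).IsHomogeneous (e * k) := by
    rw [← hρ]; exact isHomogeneous_bind₁ hσ.homog (hφ 0)
  obtain ⟨n, hn⟩ := isHomogeneous_of_mul hhom (mul_ne_zero hρ0 (X_ne_zero 0))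
  have hen : n + 1 = e * k :=
    (hn.mul (isHomogeneous_X K 0)).inj_right hhom (mul_ne_zero hρ0 (X_ne_zero 0))
  refine ⟨fun he => by simp [he] at hen, ?_⟩
  have hJ : minors (fun k j => eval v (pderiv k (σ j))) ≠ 0 := by
    refine minors_ne_zero _ (fun j i => eval v (bind₁ σ (pderiv j (φ i))))
      (fun k => eval v (pderiv k ρ)) v (eval v ρ) (fun k i => ?_) ?_
    · have h1 := congrArg (eval v) (pderiv_bind₁ σ (φ i) k)
      rw [hρ, pderiv_mul, pderiv_X, Pi.single_apply] at h1
      simp only [map_sum, map_mul, map_add, eval_X] at h1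
      rw [← h1]
      congr 1
      by_cases hki : k = i <;> simp [hki, eq_comm]
    · have h1 := congrArg (eval v) hn.sum_X_mul_pderiv
      simp only [map_sum, map_mul, eval_X, nsmul_eq_mul, map_natCast] at h1
      have h2 : ∑ k, eval v (pderiv k ρ) * v k = n * eval v ρ := by
        rw [← h1]; exact Finset.sum_congr rfl fun _ _ => mul_comm _ _
      rw [h2, show eval v ρ ^ 2 * (eval v ρ + n * eval v ρ) = eval v ρ ^ 3 * ((n + 1 : ℕ) : K) by
        push_cast; ring]
      exact mul_ne_zero (pow_ne_zero _ hρv) (Nat.cast_ne_zero.2 n.succ_ne_zero)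
  by_contra! hcon
  apply hJ
  ext j
  rw [Pi.zero_apply, ← hcon j]
  fin_cases j <;> simp [minors]

/-- The canonical class of a smooth cubic surface is minus the hyperplane class: the forms of a
section `s` of `π` off finitely many points are cubic. The minors of the Jacobian matrix of these
forms are a multiple `κ` of the gradient of `F` along `s`; as `s` is an immersion, `κ` vanishes
at finitely many points only and hence is constant, and one compares degrees. -/
theorem degree_section_eq_three [IsAlgClosed K] [CharZero K] (hF : IsSmoothCubic F)
    (hS : S.Finite) (hπ : IsRegularOn (zeroLocus F) π) (hσ : IsGivenBy Sᶜ s e σ)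
    (hs : ∀ y ∉ S, s y ∈ zeroLocus F ∧ π (s y) = y) : e = 3 := by
  have hF0 := bind₁_eq_zero_of_section hF.isHomogeneous hS hσ fun y hy => (hs y hy).1
  set J : Fin 3 → Fin 4 → MvPolynomial (Fin 3) K := fun k j => pderiv k (σ j) with hJ
  set w : Fin 4 → MvPolynomial (Fin 3) K := fun j => bind₁ σ (pderiv j F) with hw
  have hwhom : ∀ j, (w j).IsHomogeneous (e * 2) := fun j =>
    isHomogeneous_bind₁ hσ.homog (hF.isHomogeneous.pderiv)
  have hJw : ∀ k, ∑ j, J k j * w j = 0 := by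
    intro k
    rw [hJ, hw, ← pderiv_bind₁, hF0, map_zero]
  have hw0 : ∀ v (hv : v ≠ 0), Projectivization.mk K v hv ∉ S → ∃ j, eval v (w j) ≠ 0 := by
    intro v hv hvS
    obtain ⟨j, hj⟩ := hF.exists_pderiv_ne_zero (hσ.ne_zero v hv hvS)
      (by rw [← eval_bind₁, hF0, map_zero])
    exact ⟨j, by rwa [hw, eval_bind₁]⟩
  have hex : ∃ v : Fin 3 → K, ∃ hv : v ≠ 0, Projectivization.mk K v hv ∉ S := by
    obtain ⟨v, hv, hvS, -⟩ := exists_zero_off_finite hS (isHomogeneous_X K (0 : Fin 3)) one_ne_zero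
    exact ⟨v, hv, hvS⟩
  obtain ⟨v, hv, hvS⟩ := hex
  have hprim : IsPrimitiveFamily w := by
    intro g hg
    obtain ⟨j, hj⟩ := hw0 v hv hvS
    have hj0 : w j ≠ 0 := by intro h; rw [h, map_zero] at hj; exact hj rfl
    obtain ⟨d, hd⟩ := isHomogeneous_of_dvd (hwhom j) hj0 (hg j)
    have hg0 : g ≠ 0 := by rintro rfl; exact hj0 (zero_dvd_iff.1 (hg j))
    by_cases hd0 : d = 0
    · exact isUnit_of_isHomogeneous_zero (hd0 ▸ hd) hg0
    · obtain ⟨y, hy, hyS, hgy⟩ := exists_zero_off_finite hS hd hd0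
      obtain ⟨i, hi⟩ := hw0 y hy hyS
      obtain ⟨r, hr⟩ := hg i
      rw [hr, map_mul, hgy, zero_mul] at hi
      exact absurd rfl hi
  obtain ⟨κ, hκ⟩ := hprim.exists_eq_mul fun i j => by
    rw [mul_comm, ← minors_mul_comm J w hJw i j, mul_comm]
  have hJhom : ∀ k j, (J k j).IsHomogeneous (e - 1) := fun k j => (hσ.homog j).pderiv
  have hD : ∀ a b c : Fin 4, (J 0 a * (J 1 b * J 2 c - J 1 c * J 2 b) -
      J 0 b * (J 1 a * J 2 c - J 1 c * J 2 a) +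
      J 0 c * (J 1 a * J 2 b - J 1 b * J 2 a)).IsHomogeneous (e - 1 + (e - 1 + (e - 1))) := by
    intro a b c
    have h2 : ∀ a b : Fin 4, (J 1 a * J 2 b - J 1 b * J 2 a).IsHomogeneous (e - 1 + (e - 1)) :=
      fun a b => ((hJhom 1 a).mul (hJhom 2 b)).sub ((hJhom 1 b).mul (hJhom 2 a))
    exact (((hJhom 0 a).mul (h2 b c)).sub ((hJhom 0 b).mul (h2 a c))).add
      ((hJhom 0 c).mul (h2 a b))
  have hmhom : ∀ j, (minors J j).IsHomogeneous (e - 1 + (e - 1 + (e - 1))) := by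
    intro j
    fin_cases j
    · exact hD 1 2 3
    · exact (hD 0 2 3).neg
    · exact hD 0 1 3
    · exact (hD 0 1 2).neg
  obtain ⟨he, j, hj⟩ := exists_minors_ne_zero hS hπ hσ hs v hv hvS
  have hj0 : minors J j ≠ 0 := by intro h; rw [h, map_zero] at hj; exact hj rfl
  obtain ⟨d, hd⟩ := isHomogeneous_of_dvd (hmhom j) hj0 ⟨w j, hκ j⟩
  have hd0 : d = 0 := by
    by_contra hd0
    obtain ⟨y, hy, hyS, hκy⟩ := exists_zero_off_finite hS hd hd0
    obtain ⟨-, i, hi⟩ := exists_minors_ne_zero hS hπ hσ hs y hy hyS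
    apply hi
    rw [← hJ, hκ i, map_mul, hκy, zero_mul]
  have := (hd.mul (hwhom j)).inj_right (hκ j ▸ hmhom j) (hκ j ▸ hj0)
  omega

end Inverse

/-! ### The linear system of the blow-up -/

section LinearSystem

variable {K : Type*} [Field K] {F : MvPolynomial (Fin 4) K} {P : Fin 6 → PSpace K 2}
  {π : PSpace K 3 → PSpace K 2} {σ : Fin 4 → MvPolynomial (Fin 3) K}

/-- The cubic forms `σ` give the inverse of `π` away from the points `P i`. -/
structure IsInverseForms (F : MvPolynomial (Fin 4) K) (P : Fin 6 → PSpace K 2)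
    (π : PSpace K 3 → PSpace K 2) (σ : Fin 4 → MvPolynomial (Fin 3) K) : Prop where
  homog : ∀ j, (σ j).IsHomogeneous 3
  ne_zero : ∀ v (hv : v ≠ 0), Projectivization.mk K v hv ∉ Set.range P → evalForms σ v ≠ 0
  bind₁_eq_zero : bind₁ σ F = 0
  left_inv : ∀ x (hx : x ≠ 0), eval x F = 0 → ∀ v (hv : v ≠ 0),
    π (Projectivization.mk K x hx) = Projectivization.mk K v hv →
    Projectivization.mk K v hv ∉ Set.range P → ∃ c : K, c ≠ 0 ∧ x = c • evalForms σ v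
  right_inv : ∀ v (hv : v ≠ 0), Projectivization.mk K v hv ∉ Set.range P →
    ∀ h : evalForms σ v ≠ 0,
      π (Projectivization.mk K (evalForms σ v) h) = Projectivization.mk K v hv

theorem IsBlowUpAt.exists_isInverseForms [IsAlgClosed K] [CharZero K] (hF : IsSmoothCubic F)
    (hB : IsBlowUpAt (zeroLocus F) π P) : ∃ σ, IsInverseForms F P π σ := by
  obtain ⟨s, hs, hs1, hs2⟩ := hB.iso
  have hfin : (Set.range P).Finite := Set.finite_range P
  obtain ⟨e, σ, hσ⟩ := hs.exists_isGivenBy (by norm_num) (by rwa [compl_compl])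
  obtain rfl := degree_section_eq_three hF hfin hB.regular hσ hs1
  refine ⟨σ, hσ.homog, hσ.ne_zero, bind₁_eq_zero_of_section hF.isHomogeneous hfin hσ
    fun y hy => (hs1 y hy).1, fun x hx hFx v hv hxv hvP => ?_, fun v hv hvP h => ?_⟩
  · have h0 := hσ.ne_zero v hv hvP
    have h1 := hs2 _ ((mk_mem_zeroLocus hF.isHomogeneous hx).2 hFx) (by rwa [hxv])
    rw [hxv, hσ.eq_mk v hv hvP h0] at h1
    exact exists_smul_of_mk_eq_mk h1.symm
  · rw [← hσ.eq_mk v hv hvP h]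
    exact (hs1 _ hvP).2

theorem IsSmoothCubic.eq_zero_of_dvd (hF : IsSmoothCubic F) {q : MvPolynomial (Fin 4) K} {d : ℕ}
    (hq : q.IsHomogeneous d) (hd : d < 3) (h : F ∣ q) : q = 0 := by
  by_contra hq0
  obtain ⟨r, rfl⟩ := h
  have h1 := totalDegree_mul_of_isDomain hF.ne_zero (right_ne_zero_of_mul hq0)
  rw [hq.totalDegree hq0, hF.isHomogeneous.totalDegree hF.ne_zero] at h1
  omega

theorem dotProduct_rep_eq_zero_of_mem_lineThrough {n : ℕ} {p q x : PSpace K n}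
    {a : Fin (n + 1) → K} (hp : a ⬝ᵥ p.rep = 0) (hq : a ⬝ᵥ q.rep = 0) (hx : x ∈ lineThrough p q) :
    a ⬝ᵥ x.rep = 0 := by
  have h1 : x.rep ∈ p.submodule ⊔ q.submodule := by
    apply hx
    rw [Projectivization.submodule_eq]
    exact Submodule.mem_span_singleton_self _
  rw [Projectivization.submodule_eq, Projectivization.submodule_eq, Submodule.mem_sup] at h1
  obtain ⟨y, hy, z, hz, hyz⟩ := h1
  obtain ⟨b, rfl⟩ := Submodule.mem_span_singleton.1 hy
  obtain ⟨c, rfl⟩ := Submodule.mem_span_singleton.1 hz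
  rw [← hyz, dotProduct_add, dotProduct_smul, dotProduct_smul, hp, hq]
  simp

/-- The complement of the exceptional lines is dense in the surface. -/
theorem IsBlowUpAt.dvd_of_eval_eq_zero [IsAlgClosed K] (hF : IsSmoothCubic F)
    (hB : IsBlowUpAt (zeroLocus F) π P) {T : MvPolynomial (Fin 4) K}
    (hT : ∀ x (hx : x ≠ 0), eval x F = 0 → π (Projectivization.mk K x hx) ∉ Set.range P →
      eval x T = 0) : F ∣ T := by
  have hex : ∀ i, ∃ a : Fin 4 → K, a ≠ 0 ∧ ∀ x (hx : x ≠ 0), eval x F = 0 →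
      π (Projectivization.mk K x hx) = P i → a ⬝ᵥ x = 0 := by
    intro i
    obtain ⟨p, q, -, hE⟩ := hB.exceptional i
    obtain ⟨a, ha0, hap, haq⟩ :=
      exists_common_zero_lin (by norm_num) (isHomogeneous_lin q.rep) one_ne_zero p.rep
    refine ⟨a, ha0, fun x hx hFx hxi => ?_⟩
    have hmem : Projectivization.mk K x hx ∈ lineThrough p q := by
      rw [← hE]; exact ⟨(mk_mem_zeroLocus hF.isHomogeneous hx).2 hFx, hxi⟩
    have h1 := dotProduct_rep_eq_zero_of_mem_lineThrough (by rwa [dotProduct_comm])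
      (by rwa [eval_lin, dotProduct_comm] at haq) hmem
    obtain ⟨c, hc, hr⟩ := exists_rep_mk_eq_smul (K := K) hx
    rwa [hr, dotProduct_smul, smul_eq_mul, mul_eq_zero_iff_left hc] at h1
  choose a ha0 ha using hex
  have hprime : Prime F := hF.irreducible.prime
  have h1 : F ∣ T * ∏ i, lin (a i) := by
    refine dvd_of_forall_eval_eq_zero hF.irreducible fun x hFx => ?_
    rw [map_mul, map_prod]
    by_cases hx : x = 0
    · rw [Finset.prod_eq_zero (Finset.mem_univ 0) (by rw [eval_lin, hx, dotProduct_zero]), mul_zero]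
    by_cases hxP : π (Projectivization.mk K x hx) ∈ Set.range P
    · obtain ⟨i, hi⟩ := hxP
      rw [Finset.prod_eq_zero (Finset.mem_univ i) (by rw [eval_lin, ha i x hx hFx hi.symm]),
        mul_zero]
    · rw [hT x hx hFx hxP, zero_mul]
  refine (hprime.dvd_or_dvd h1).resolve_right fun h2 => ?_
  obtain ⟨i, -, hi⟩ := hprime.exists_mem_finset_dvd h2
  exact ha0 i (lin_eq_zero.1 (hF.eq_zero_of_dvd (isHomogeneous_lin _) (by norm_num) hi))

theorem IsInverseForms.dvd_of_bind₁_eq_zero [IsAlgClosed K] (hF : IsSmoothCubic F)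
    (hB : IsBlowUpAt (zeroLocus F) π P) (hσ : IsInverseForms F P π σ)
    {T : MvPolynomial (Fin 4) K} {d : ℕ} (hT : T.IsHomogeneous d) (h : bind₁ σ T = 0) : F ∣ T := by
  refine hB.dvd_of_eval_eq_zero hF fun x hx hFx hxP => ?_
  obtain ⟨c, -, hc⟩ := hσ.left_inv x hx hFx (π (Projectivization.mk K x hx)).rep
    (Projectivization.rep_nonzero _) (Projectivization.mk_rep _).symm
    (by rwa [Projectivization.mk_rep])
  rw [hc, eval_smul_of_isHomogeneous hT, ← eval_bind₁, h, map_zero, mul_zero]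

theorem exists_eq_smul_of_mul_comm {ι : Type*} {x z : ι → K} (hz : z ≠ 0)
    (h : ∀ j l, x j * z l = x l * z j) : ∃ c : K, x = c • z := by
  obtain ⟨j, hj⟩ := Function.ne_iff.1 hz
  have hj : z j ≠ 0 := hj
  refine ⟨x j / z j, funext fun l => ?_⟩
  rw [Pi.smul_apply, smul_eq_mul, div_mul_eq_mul_div, h j l, mul_div_assoc, div_self hj, mul_one]

/-- The cubics `σ` pass through the six points: otherwise the inverse of `π` would extend to `P i`
and the fibre over `P i` would be a single point. -/
theorem IsInverseForms.eval_eq_zero [IsAlgClosed K] (hF : IsSmoothCubic F)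
    (hB : IsBlowUpAt (zeroLocus F) π P) (hσ : IsInverseForms F P π σ) (i : Fin 6) (j : Fin 4) :
    eval (P i).rep (σ j) = 0 := by
  suffices h : evalForms σ (P i).rep = 0 from congrFun h j
  by_contra hz
  obtain ⟨t, htF, htP, htz⟩ : ∃ t, t ∈ zeroLocus F ∧ π t = P i ∧
      t ≠ Projectivization.mk K _ hz := by
    obtain ⟨p, q, hpq, hE⟩ := hB.exceptional i
    have hp : p ∈ lineThrough p q := le_sup_left (a := p.submodule)
    have hq : q ∈ lineThrough p q := le_sup_right (a := p.submodule)
    rw [← hE] at hp hq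
    by_cases h : p = Projectivization.mk K _ hz
    · exact ⟨q, hq.1, hq.2, fun h' => hpq (h.trans h'.symm)⟩
    · exact ⟨p, hp.1, hp.2, h⟩
  have hmk : Projectivization.mk K t.rep t.rep_nonzero = t := Projectivization.mk_rep t
  obtain ⟨k, φ, hφ, hφ0, hφπ⟩ := hB.regular.exists_local t.rep t.rep_nonzero (by rwa [hmk])
  have h1 := hφπ _ t.rep_nonzero (by rwa [hmk]) hφ0
  rw [hmk, htP, ← Projectivization.mk_rep (P i)] at h1
  obtain ⟨c, -, hc⟩ := exists_smul_of_mk_eq_mk h1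
  have hF0 : eval t.rep F = 0 := htF
  have hzero : evalForms σ 0 = 0 := by
    rw [← zero_smul K (0 : Fin 3 → K), evalForms_smul hσ.homog, zero_pow three_ne_zero, zero_smul]
  refine htz ?_
  suffices hcross : ∀ j l, t.rep j * evalForms σ (P i).rep l =
      t.rep l * evalForms σ (P i).rep j by
    obtain ⟨b, hb⟩ := exists_eq_smul_of_mul_comm hz hcross
    rw [← hmk]
    exact mk_eq_mk_of_smul _ _ b hb
  intro j l
  have hdvd : F ∣ X j * bind₁ φ (σ l) - X l * bind₁ φ (σ j) := by
    refine hB.dvd_of_eval_eq_zero hF fun x hx hFx hxP => ?_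
    rw [map_sub, map_mul, map_mul, eval_X, eval_X, eval_bind₁, eval_bind₁, sub_eq_zero]
    by_cases hφx : evalForms φ x = 0
    · rw [hφx]
      have hl : eval 0 (σ l) = 0 := congrFun hzero l
      have hj : eval 0 (σ j) = 0 := congrFun hzero j
      rw [hl, hj]; ring
    · have h2 := hφπ x hx ((mk_mem_zeroLocus hF.isHomogeneous hx).2 hFx) hφx
      obtain ⟨b, -, hb⟩ := hσ.left_inv x hx hFx _ hφx h2 (by rwa [← h2])
      have hj : x j = b * eval (evalForms φ x) (σ j) := congrFun hb j
      have hl : x l = b * eval (evalForms φ x) (σ l) := congrFun hb l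
      rw [hj, hl]; ring
  obtain ⟨r, hr⟩ := hdvd
  have h3 := congrArg (eval t.rep) hr
  rw [map_mul, hF0, zero_mul, map_sub, map_mul, map_mul, eval_X, eval_X, eval_bind₁,
    eval_bind₁, sub_eq_zero] at h3
  rw [hc, evalForms_smul hσ.homog, Pi.smul_apply, Pi.smul_apply, smul_eq_mul, smul_eq_mul,
    evalForms_apply, evalForms_apply]
  linear_combination c ^ 3 * h3

theorem IsInverseForms.eq_zero_of_bind₁_lin [IsAlgClosed K] (hF : IsSmoothCubic F)
    (hB : IsBlowUpAt (zeroLocus F) π P) (hσ : IsInverseForms F P π σ) {a : Fin 4 → K}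
    (h : bind₁ σ (lin a) = 0) : a = 0 :=
  lin_eq_zero.1 (hF.eq_zero_of_dvd (isHomogeneous_lin a) (by norm_num)
    (hσ.dvd_of_bind₁_eq_zero hF hB (isHomogeneous_lin a) h))

end LinearSystem

/-! ### Cubic forms through six points -/

section Cubics

variable {K : Type*} [Field K]

/-- The monomials of degree `k` in `n` variables. -/
noncomputable def degreeEquiv (n k : ℕ) :
    {d : Fin n →₀ ℕ // d.degree = k} ≃ (Finset.univ : Finset (Fin n)).finsuppAntidiag k :=
  Equiv.subtypeEquivRight fun d => by
    simp [Finset.mem_finsuppAntidiag, Finsupp.degree_eq_sum]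

instance finite_degree (n k : ℕ) : Finite {d : Fin n →₀ ℕ // d.degree = k} :=
  Finite.of_equiv _ (degreeEquiv n k).symm

theorem natCard_degree (n k : ℕ) :
    Nat.card {d : Fin n →₀ ℕ // d.degree = k} = (n + k - 1).choose k := by
  rw [Nat.card_congr (degreeEquiv n k), Nat.card_eq_fintype_card, Fintype.card_coe,
    Finset.card_finsuppAntidiag_nat_eq_choose, Finset.card_univ, Fintype.card_fin]

/-- The coefficients of a form. -/
noncomputable def formCoeffs (K : Type*) [Field K] (n k : ℕ) :
    homogeneousSubmodule (Fin n) K k →ₗ[K] ({d : Fin n →₀ ℕ // d.degree = k} → K) where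
  toFun q d := q.1.coeff d.1
  map_add' _ _ := funext fun _ => by simp
  map_smul' _ _ := funext fun _ => by simp

theorem formCoeffs_injective (n k : ℕ) : Function.Injective (formCoeffs K n k) := by
  intro p q h
  apply Subtype.ext
  ext d
  by_cases hd : d.degree = k
  · exact congrFun h ⟨d, hd⟩
  · have hp : p.1.IsHomogeneous k := p.2
    have hq : q.1.IsHomogeneous k := q.2
    rw [hp.coeff_eq_zero hd, hq.coeff_eq_zero hd]

instance finite_homogeneousSubmodule (n k : ℕ) :
    Module.Finite K (homogeneousSubmodule (Fin n) K k) :=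
  Module.Finite.of_injective (formCoeffs K n k) (formCoeffs_injective n k)

theorem finrank_homogeneousSubmodule_le (n k : ℕ) :
    Module.finrank K (homogeneousSubmodule (Fin n) K k) ≤ (n + k - 1).choose k := by
  have := Fintype.ofFinite {d : Fin n →₀ ℕ // d.degree = k}
  have h := LinearMap.finrank_le_finrank_of_injective (formCoeffs_injective (K := K) n k)
  rwa [Module.finrank_fintype_fun_eq_card, ← Nat.card_eq_fintype_card, natCard_degree] at h

/-- The equation of the line through two points of the plane. -/
noncomputable def lineForm (P : Fin 6 → PSpace K 2) (i j : Fin 6) : MvPolynomial (Fin 3) K :=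
  lin (crossProduct (P i).rep (P j).rep)

variable {P : Fin 6 → PSpace K 2}

theorem isHomogeneous_lineForm (i j : Fin 6) : (lineForm P i j).IsHomogeneous 1 :=
  isHomogeneous_lin _

theorem lineForm_comm (i j : Fin 6) : lineForm P i j = -lineForm P j i := by
  rw [lineForm, lineForm, ← cross_anticomm]
  simp [lin]

theorem eval_lineForm_left (i j : Fin 6) : eval (P i).rep (lineForm P i j) = 0 := by
  rw [lineForm, eval_lin, dotProduct_comm, dot_self_cross]

theorem eval_lineForm_right (i j : Fin 6) : eval (P j).rep (lineForm P i j) = 0 := by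
  rw [lineForm, eval_lin, dotProduct_comm, dot_cross_self]

/-- A vector orthogonal to the cross product of two vectors lies in the plane they span. -/
theorem exists_eq_add_of_cross_dotProduct {x y v : Fin 3 → K} (hxy : LinearIndependent K ![x, y])
    (h : crossProduct x y ⬝ᵥ v = 0) : ∃ a b : K, v = a • x + b • y := by
  rw [dotProduct_comm, triple_product_eq_det] at h
  obtain ⟨c, hc0, hc⟩ := Matrix.exists_vecMul_eq_zero_iff.2 h
  have hc' : c 0 • v + c 1 • x + c 2 • y = 0 := by
    rw [← hc]
    ext k
    simp [Matrix.vecMul, dotProduct, Fin.sum_univ_three]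
  have h0 : c 0 ≠ 0 := by
    intro h0
    rw [h0, zero_smul, zero_add] at hc'
    obtain ⟨h1, h2⟩ := LinearIndependent.pair_iff.1 hxy _ _ hc'
    exact hc0 (funext fun k => by fin_cases k <;> simp [h0, h1, h2])
  refine ⟨-(c 1 / c 0), -(c 2 / c 0), ?_⟩
  have h1 := congrArg (fun w => (c 0)⁻¹ • w) hc'
  simp only [smul_add, smul_smul, inv_mul_cancel₀ h0, one_smul, smul_zero] at h1
  rw [add_assoc] at h1
  rw [eq_neg_of_add_eq_zero_left h1, neg_add, neg_smul, neg_smul, div_eq_inv_mul, div_eq_inv_mul]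

theorem exists_eq_add_of_eval_lineForm (hP : Function.Injective P) {i j : Fin 6} (hij : i ≠ j)
    {v : Fin 3 → K} (h : eval v (lineForm P i j) = 0) :
    ∃ a b : K, v = a • (P i).rep + b • (P j).rep := by
  rw [lineForm, eval_lin] at h
  exact exists_eq_add_of_cross_dotProduct
    (Projectivization.linearIndependent_pair_iff_ne.2 (hP.ne hij)) h

theorem InGeneralPosition.eval_lineForm_ne_zero (hP : InGeneralPosition P) {i j k : Fin 6}
    (hij : i ≠ j) (hik : i ≠ k) (hjk : j ≠ k) : eval (P k).rep (lineForm P i j) ≠ 0 := by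
  intro h
  apply hP.no_three_collinear i j k hij hik hjk
  obtain ⟨a, b, hab⟩ := exists_eq_add_of_eval_lineForm hP.injective hij h
  change (P k).submodule ≤ _
  rw [Projectivization.submodule_eq, Projectivization.submodule_eq, Projectivization.submodule_eq,
    Submodule.span_singleton_le_iff_mem, hab]
  exact Submodule.add_mem_sup (Submodule.smul_mem _ _ (Submodule.mem_span_singleton_self _))
    (Submodule.smul_mem _ _ (Submodule.mem_span_singleton_self _))

/-- Three lines which pass through all the points but one. -/
theorem InGeneralPosition.exists_cubic (hP : InGeneralPosition P) (i : Fin 6) :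
    ∃ q : MvPolynomial (Fin 3) K, q.IsHomogeneous 3 ∧ eval (P i).rep q ≠ 0 ∧
      ∀ j, j ≠ i → eval (P j).rep q = 0 := by
  refine ⟨lineForm P (i + 1) (i + 2) * lineForm P (i + 3) (i + 4) * lineForm P (i + 5) (i + 1),
    ((isHomogeneous_lineForm _ _).mul (isHomogeneous_lineForm _ _)).mul
      (isHomogeneous_lineForm _ _), ?_, fun j hj => ?_⟩
  · rw [map_mul, map_mul]
    refine mul_ne_zero (mul_ne_zero ?_ ?_) ?_ <;>
      exact hP.eval_lineForm_ne_zero (by revert i; decide) (by revert i; decide)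
        (by revert i; decide)
  · rw [map_mul, map_mul]
    have : j = i + 1 ∨ j = i + 2 ∨ j = i + 3 ∨ j = i + 4 ∨ j = i + 5 := by
      revert i j; decide
    rcases this with rfl | rfl | rfl | rfl | rfl
    · rw [eval_lineForm_left]; ring
    · rw [eval_lineForm_right]; ring
    · rw [eval_lineForm_left]; ring
    · rw [eval_lineForm_right]; ring
    · rw [eval_lineForm_left]; ring

/-- The values of a cubic form at the six points. -/
noncomputable def evalCubics (P : Fin 6 → PSpace K 2) :
    homogeneousSubmodule (Fin 3) K 3 →ₗ[K] (Fin 6 → K) where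
  toFun q i := eval (P i).rep q.1
  map_add' _ _ := funext fun _ => by simp
  map_smul' _ _ := funext fun _ => by simp

theorem InGeneralPosition.finrank_ker_evalCubics_le (hP : InGeneralPosition P) :
    Module.finrank K (LinearMap.ker (evalCubics P)) ≤ 4 := by
  have hsurj : Function.Surjective (evalCubics P) := by
    choose q hq hqi hqj using hP.exists_cubic
    intro c
    refine ⟨∑ i, (c i / eval (P i).rep (q i)) • ⟨q i, hq i⟩, funext fun j => ?_⟩
    rw [map_sum, Finset.sum_apply, Finset.sum_eq_single j]
    · simp [evalCubics, hqi j]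
    · intro i _ hij
      simp [evalCubics, hqj i j hij.symm]
    · simp
  have h1 := LinearMap.finrank_range_add_finrank_ker (evalCubics P)
  rw [LinearMap.range_eq_top.2 hsurj, finrank_top, Module.finrank_fin_fun] at h1
  have h2 := finrank_homogeneousSubmodule_le (K := K) 3 3
  have h3 : (3 + 3 - 1).choose 3 = 10 := by decide
  omega

/-- The cubic forms which vanish at the six points. -/
noncomputable def cubicsThrough (P : Fin 6 → PSpace K 2) : Submodule K (MvPolynomial (Fin 3) K) :=
  (LinearMap.ker (evalCubics P)).map (homogeneousSubmodule (Fin 3) K 3).subtype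

theorem mem_cubicsThrough {q : MvPolynomial (Fin 3) K} :
    q ∈ cubicsThrough P ↔ q.IsHomogeneous 3 ∧ ∀ i, eval (P i).rep q = 0 := by
  constructor
  · rintro ⟨q, hq, rfl⟩
    exact ⟨q.2, fun i => congrFun (LinearMap.mem_ker.1 hq) i⟩
  · rintro ⟨h1, h2⟩
    have h3 : evalCubics P ⟨q, h1⟩ = 0 := funext h2
    exact Submodule.mem_map.2 ⟨⟨q, h1⟩, h3, rfl⟩

instance finite_cubicsThrough : Module.Finite K (cubicsThrough P) := by
  unfold cubicsThrough; infer_instance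

theorem InGeneralPosition.finrank_cubicsThrough_le (hP : InGeneralPosition P) :
    Module.finrank K (cubicsThrough P) ≤ 4 := by
  have := Submodule.finrank_map_subtype_eq (homogeneousSubmodule (Fin 3) K 3)
    (LinearMap.ker (evalCubics P))
  rw [cubicsThrough, this]
  exact hP.finrank_ker_evalCubics_le

/-- The plane sections of the surface are the cubics through the six points. -/
theorem IsInverseForms.exists_bind₁_lin_eq [IsAlgClosed K] {F : MvPolynomial (Fin 4) K}
    {π : PSpace K 3 → PSpace K 2} {σ : Fin 4 → MvPolynomial (Fin 3) K}
    (hF : IsSmoothCubic F) (hP : InGeneralPosition P)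
    (hB : IsBlowUpAt (zeroLocus F) π P) (hσ : IsInverseForms F P π σ)
    {q : MvPolynomial (Fin 3) K} (hq : q.IsHomogeneous 3) (hqP : ∀ i, eval (P i).rep q = 0) :
    ∃ a, bind₁ σ (lin a) = q := by
  let g : (Fin 4 → K) →ₗ[K] MvPolynomial (Fin 3) K := Fintype.linearCombination K σ
  have hg : ∀ a, g a = bind₁ σ (lin a) := fun a => by
    rw [Fintype.linearCombination_apply]
    simp [lin, smul_eq_C_mul]
  have hinj : Function.Injective g := (injective_iff_map_eq_zero g).2 fun a ha =>
    hσ.eq_zero_of_bind₁_lin hF hB (by rw [← hg, ha])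
  have hle : LinearMap.range g ≤ cubicsThrough P := by
    rintro _ ⟨a, rfl⟩
    rw [hg]
    refine mem_cubicsThrough.2 ⟨isHomogeneous_bind₁ hσ.homog (isHomogeneous_lin a), fun i => ?_⟩
    rw [eval_bind₁, eval_lin]
    simp [dotProduct, hσ.eval_eq_zero hF hB]
  have heq : LinearMap.range g = cubicsThrough P := by
    refine Submodule.eq_of_le_of_finrank_le hle ?_
    rw [LinearMap.finrank_range_of_inj hinj, Module.finrank_fin_fun]
    exact hP.finrank_cubicsThrough_le
  have hqW : q ∈ cubicsThrough P := mem_cubicsThrough.2 ⟨hq, hqP⟩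
  rw [← heq] at hqW
  obtain ⟨a, ha⟩ := hqW
  exact ⟨a, by rw [← hg, ha]⟩

end Cubics

/-! ### The Cayley–Salmon equation of the surface -/

section CayleySalmon

variable {K : Type*} [Field K]

theorem lin_sub {n : ℕ} (a b : Fin n → K) : lin (a - b) = lin a - lin b := by
  simp [lin, sub_mul]

theorem lin_add {n : ℕ} (a b : Fin n → K) : lin (a + b) = lin a + lin b := by
  simp [lin, add_mul, Finset.sum_add_distrib]

theorem lin_smul {n : ℕ} (c : K) (a : Fin n → K) : lin (c • a) = C c * lin a := by
  simp [lin, Finset.mul_sum, mul_assoc]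

theorem exists_eq_smul_of_lin_dvd {n : ℕ} {a b : Fin n → K} (h : lin a ∣ lin b) :
    ∃ c : K, b = c • a := by
  obtain ⟨r, hr⟩ := h
  by_cases hb : b = 0
  · exact ⟨0, by rw [hb, zero_smul]⟩
  have hb' : lin b ≠ 0 := lin_eq_zero.not.2 hb
  obtain ⟨k, hk⟩ := isHomogeneous_of_dvd (isHomogeneous_lin b) hb' ⟨lin a, by rw [hr, mul_comm]⟩
  have hk0 := ((isHomogeneous_lin a).mul hk).inj_right (hr ▸ isHomogeneous_lin b) (hr ▸ hb')
  obtain rfl : k = 0 := by omega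
  rw [totalDegree_eq_zero_iff_eq_C.1 ((totalDegree_zero_iff_isHomogeneous _).2 hk), mul_comm,
    ← lin_smul] at hr
  refine ⟨r.coeff 0, sub_eq_zero.1 (lin_eq_zero.1 ?_)⟩
  rw [lin_sub, hr, sub_self]

variable {F : MvPolynomial (Fin 4) K} {P : Fin 6 → PSpace K 2} {π : PSpace K 3 → PSpace K 2}
  {σ : Fin 4 → MvPolynomial (Fin 3) K}

theorem InGeneralPosition.lineForm_ne_zero (hP : InGeneralPosition P) {i j : Fin 6} (hij : i ≠ j) :
    lineForm P i j ≠ 0 := by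
  have hk : ∀ i j : Fin 6, i ≠ j → ∃ k, i ≠ k ∧ j ≠ k := by decide
  obtain ⟨k, hik, hjk⟩ := hk i j hij
  intro h
  exact hP.eval_lineForm_ne_zero hij hik hjk (by rw [h, map_zero])

/-- Two pairs of opposite sides of a quadrangle are different conics, as is seen at a third point of
the side through `P i` and `P j`. -/
theorem InGeneralPosition.conic_ne_zero (hP : InGeneralPosition P) {i j k l : Fin 6}
    (hij : i ≠ j) (hjk : j ≠ k) (hil : i ≠ l) (hik : i ≠ k) (hjl : j ≠ l) (c : K) :
    lineForm P j k * lineForm P i l - C c * (lineForm P i j * lineForm P k l) ≠ 0 := by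
  intro h
  have h1 := congrArg (eval ((P i).rep + (P j).rep)) h
  have hadd : ∀ a b, eval ((P i).rep + (P j).rep) (lineForm P a b) =
      eval (P i).rep (lineForm P a b) + eval (P j).rep (lineForm P a b) := by
    intro a b
    rw [lineForm, eval_lin, eval_lin, eval_lin, dotProduct_add]
  rw [map_sub, map_mul, map_mul, map_mul, hadd, hadd, hadd, eval_lineForm_left i j,
    eval_lineForm_right i j, eval_lineForm_left, eval_lineForm_left] at h1
  have h2 := hP.eval_lineForm_ne_zero hjk hij.symm hik.symm
  have h3 := hP.eval_lineForm_ne_zero hil hij hjl.symm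
  refine mul_ne_zero h2 h3 ?_
  simpa using h1

theorem InGeneralPosition.conic_ne_zero' (hP : InGeneralPosition P) {i j k l : Fin 6}
    (hij : i ≠ j) (hjk : j ≠ k) (hil : i ≠ l) (hik : i ≠ k) (hjl : j ≠ l) (c : K) :
    lineForm P j k * lineForm P l i - C c * (lineForm P i j * lineForm P k l) ≠ 0 := by
  intro h
  apply hP.conic_ne_zero hij hjk hil hik hjl (-c)
  rw [lineForm_comm i l, C_neg]
  linear_combination -h

/-- Linear forms `L i`, `M i` on `ℙ³` which cut out on the surface the two hexagons of lines
`ℓ₁₂ + ℓ₃₄ + ℓ₅₆`, `ℓ₂₃ + ℓ₄₅ + ℓ₁₆`, the diagonals `ℓ₁₄ + ℓ₂₅ + ℓ₃₆`, and the three pairs of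
opposite sides with the parallel diagonal. The surface then has the Cayley–Salmon equation
`L 0 * L 1 * L 2 = M 0 * M 1 * M 2`. -/
structure IsCayleySalmon (F : MvPolynomial (Fin 4) K) (P : Fin 6 → PSpace K 2)
    (σ : Fin 4 → MvPolynomial (Fin 3) K) (L M : Fin 3 → Fin 4 → K) (κ : K) : Prop where
  L_zero : bind₁ σ (lin (L 0)) = lineForm P 0 1 * lineForm P 2 3 * lineForm P 4 5
  L_one : bind₁ σ (lin (L 1)) = lineForm P 1 2 * lineForm P 3 4 * lineForm P 5 0
  L_two : bind₁ σ (lin (L 2)) = lineForm P 2 5 * lineForm P 4 1 * lineForm P 0 3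
  M_zero : bind₁ σ (lin (M 0)) = lineForm P 0 1 * lineForm P 3 4 * lineForm P 2 5
  M_one : bind₁ σ (lin (M 1)) = lineForm P 2 3 * lineForm P 5 0 * lineForm P 4 1
  M_two : bind₁ σ (lin (M 2)) = lineForm P 4 5 * lineForm P 1 2 * lineForm P 0 3
  ne_zero : κ ≠ 0
  eq : F = C κ * (lin (L 0) * lin (L 1) * lin (L 2) - lin (M 0) * lin (M 1) * lin (M 2))

/-- A plane through a line of the hexagons cuts out the strict transform of a conic besides. -/
theorem exists_factor (hP : InGeneralPosition P) {L M : Fin 3 → Fin 4 → K}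
    (h0 : bind₁ σ (lin (L 0)) = lineForm P 0 1 * lineForm P 2 3 * lineForm P 4 5)
    (h1 : bind₁ σ (lin (L 1)) = lineForm P 1 2 * lineForm P 3 4 * lineForm P 5 0)
    (g0 : bind₁ σ (lin (M 0)) = lineForm P 0 1 * lineForm P 3 4 * lineForm P 2 5)
    (g1 : bind₁ σ (lin (M 1)) = lineForm P 2 3 * lineForm P 5 0 * lineForm P 4 1)
    (g2 : bind₁ σ (lin (M 2)) = lineForm P 4 5 * lineForm P 1 2 * lineForm P 0 3)
    (a : Fin 3) (b : Fin 3) (hb : b ≠ 2) (c : K) :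
    ∃ q₁ q₂ : MvPolynomial (Fin 3) K, q₁.IsHomogeneous 1 ∧ q₁ ≠ 0 ∧ q₂.IsHomogeneous 2 ∧ q₂ ≠ 0 ∧
      bind₁ σ (lin (M a - c • L b)) = q₁ * q₂ := by
  have hom : ∀ i j k l m n o p : Fin 6, (lineForm P i j * lineForm P k l -
      C c * (lineForm P m n * lineForm P o p)).IsHomogeneous 2 := fun i j k l m n o p =>
    ((isHomogeneous_lineForm i j).mul (isHomogeneous_lineForm k l)).sub
      (((isHomogeneous_lineForm m n).mul (isHomogeneous_lineForm o p)).C_mul c)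
  have hl : ∀ i j : Fin 6, i ≠ j → (lineForm P i j).IsHomogeneous 1 ∧ lineForm P i j ≠ 0 :=
    fun i j hij => ⟨isHomogeneous_lineForm i j, hP.lineForm_ne_zero hij⟩
  rw [lin_sub, lin_smul, map_sub, map_mul, bind₁_C_right]
  fin_cases b
  · simp only [Fin.zero_eta, Fin.isValue, h0]
    fin_cases a
    · refine ⟨lineForm P 0 1, _, (hl 0 1 (by decide)).1, (hl 0 1 (by decide)).2, hom _ _ _ _ _ _ _ _,
        hP.conic_ne_zero (i := 2) (j := 3) (k := 4) (l := 5) (by decide) (by decide) (by decide)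
          (by decide) (by decide) c, ?_⟩
      simp only [Fin.zero_eta, Fin.isValue, g0]
      ring
    · refine ⟨lineForm P 2 3, _, (hl 2 3 (by decide)).1, (hl 2 3 (by decide)).2, hom _ _ _ _ _ _ _ _,
        hP.conic_ne_zero (i := 4) (j := 5) (k := 0) (l := 1) (by decide) (by decide) (by decide)
          (by decide) (by decide) c, ?_⟩
      simp only [Fin.mk_one, Fin.isValue, g1]
      ring
    · refine ⟨lineForm P 4 5, _, (hl 4 5 (by decide)).1, (hl 4 5 (by decide)).2, hom _ _ _ _ _ _ _ _,
        hP.conic_ne_zero (i := 0) (j := 1) (k := 2) (l := 3) (by decide) (by decide) (by decide)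
          (by decide) (by decide) c, ?_⟩
      simp only [Fin.reduceFinMk, Fin.isValue, g2]
      ring
  · simp only [Fin.mk_one, Fin.isValue, h1]
    fin_cases a
    · refine ⟨lineForm P 3 4, _, (hl 3 4 (by decide)).1, (hl 3 4 (by decide)).2, hom _ _ _ _ _ _ _ _,
        hP.conic_ne_zero' (i := 5) (j := 0) (k := 1) (l := 2) (by decide) (by decide) (by decide)
          (by decide) (by decide) c, ?_⟩
      simp only [Fin.zero_eta, Fin.isValue, g0]
      ring
    · refine ⟨lineForm P 5 0, _, (hl 5 0 (by decide)).1, (hl 5 0 (by decide)).2, hom _ _ _ _ _ _ _ _,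
        hP.conic_ne_zero' (i := 1) (j := 2) (k := 3) (l := 4) (by decide) (by decide) (by decide)
          (by decide) (by decide) c, ?_⟩
      simp only [Fin.mk_one, Fin.isValue, g1]
      ring
    · refine ⟨lineForm P 1 2, _, (hl 1 2 (by decide)).1, (hl 1 2 (by decide)).2, hom _ _ _ _ _ _ _ _,
        hP.conic_ne_zero' (i := 3) (j := 4) (k := 5) (l := 0) (by decide) (by decide) (by decide)
          (by decide) (by decide) c, ?_⟩
      simp only [Fin.reduceFinMk, Fin.isValue, g2]
      ring
  · exact absurd rfl hb

theorem IsCayleySalmon.exists_factor {L M : Fin 3 → Fin 4 → K} {κ : K} (hP : InGeneralPosition P)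
    (h : IsCayleySalmon F P σ L M κ) (a : Fin 3) (b : Fin 3) (hb : b ≠ 2) (c : K) :
    ∃ q₁ q₂ : MvPolynomial (Fin 3) K, q₁.IsHomogeneous 1 ∧ q₁ ≠ 0 ∧ q₂.IsHomogeneous 2 ∧ q₂ ≠ 0 ∧
      bind₁ σ (lin (M a - c • L b)) = q₁ * q₂ :=
  CubicSurface.exists_factor hP h.L_zero h.L_one h.M_zero h.M_one h.M_two a b hb c

/-- Each of the six triples of lines passes once through each of the points, hence is a plane
section; the equation holds as both sides have the same pullback to the plane. -/
theorem IsInverseForms.exists_isCayleySalmon [IsAlgClosed K] (hF : IsSmoothCubic F)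
    (hP : InGeneralPosition P) (hB : IsBlowUpAt (zeroLocus F) π P)
    (hσ : IsInverseForms F P π σ) : ∃ L M κ, IsCayleySalmon F P σ L M κ := by
  have hex : ∀ i j k l m n : Fin 6, (∀ a, a = i ∨ a = j ∨ a = k ∨ a = l ∨ a = m ∨ a = n) →
      ∃ a, bind₁ σ (lin a) = lineForm P i j * lineForm P k l * lineForm P m n := by
    intro i j k l m n h
    refine hσ.exists_bind₁_lin_eq hF hP hB (((isHomogeneous_lineForm _ _).mul
      (isHomogeneous_lineForm _ _)).mul (isHomogeneous_lineForm _ _)) fun a => ?_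
    rw [map_mul, map_mul]
    rcases h a with rfl | rfl | rfl | rfl | rfl | rfl
    · rw [eval_lineForm_left]; ring
    · rw [eval_lineForm_right]; ring
    · rw [eval_lineForm_left]; ring
    · rw [eval_lineForm_right]; ring
    · rw [eval_lineForm_left]; ring
    · rw [eval_lineForm_right]; ring
  obtain ⟨l0, h0⟩ := hex 0 1 2 3 4 5 (by decide)
  obtain ⟨l1, h1⟩ := hex 1 2 3 4 5 0 (by decide)
  obtain ⟨l2, h2⟩ := hex 2 5 4 1 0 3 (by decide)
  obtain ⟨m0, g0⟩ := hex 0 1 3 4 2 5 (by decide)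
  obtain ⟨m1, g1⟩ := hex 2 3 5 0 4 1 (by decide)
  obtain ⟨m2, g2⟩ := hex 4 5 1 2 0 3 (by decide)
  set T := lin l0 * lin l1 * lin l2 - lin m0 * lin m1 * lin m2 with hT
  have hThom : T.IsHomogeneous 3 :=
    (((isHomogeneous_lin _).mul (isHomogeneous_lin _)).mul (isHomogeneous_lin _)).sub
      (((isHomogeneous_lin _).mul (isHomogeneous_lin _)).mul (isHomogeneous_lin _))
  have hdvd : F ∣ T := by
    refine hσ.dvd_of_bind₁_eq_zero hF hB hThom ?_
    rw [hT]
    simp only [map_sub, map_mul, h0, h1, h2, g0, g1, g2]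
    ring
  have hfac := CubicSurface.exists_factor (L := ![l0, l1, l2]) (M := ![m0, m1, m2])
    hP h0 h1 g0 g1 g2
  have hl0 : l0 ≠ 0 := by
    rintro rfl
    rw [lin_eq_zero.2 rfl, map_zero] at h0
    exact mul_ne_zero (mul_ne_zero (hP.lineForm_ne_zero (by decide))
      (hP.lineForm_ne_zero (by decide))) (hP.lineForm_ne_zero (by decide)) h0.symm
  have hT0 : T ≠ 0 := by
    intro h
    have hirr := irreducible_of_isHomogeneous_one (isHomogeneous_lin l0) (lin_eq_zero.not.2 hl0)
    have hd : lin l0 ∣ lin m0 * lin m1 * lin m2 := ⟨lin l1 * lin l2, by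
      linear_combination -h⟩
    have : ∃ a : Fin 3, lin l0 ∣ lin (![m0, m1, m2] a) := by
      rcases hirr.prime.dvd_or_dvd hd with hd | hd
      · rcases hirr.prime.dvd_or_dvd hd with hd | hd
        · exact ⟨0, hd⟩
        · exact ⟨1, hd⟩
      · exact ⟨2, hd⟩
    obtain ⟨a, ha⟩ := this
    obtain ⟨c, hc⟩ := exists_eq_smul_of_lin_dvd ha
    obtain ⟨q₁, q₂, -, h3, -, h4, h5⟩ := hfac a 0 (by decide) c
    rw [hc, show (![l0, l1, l2] : Fin 3 → Fin 4 → K) 0 = l0 from rfl, sub_self,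
      lin_eq_zero.2 rfl, map_zero] at h5
    exact mul_ne_zero h3 h4 h5.symm
  obtain ⟨r, hr⟩ := hdvd
  have hr0 : r ≠ 0 := by rintro rfl; exact hT0 (by rw [hr, mul_zero])
  obtain ⟨k, hk⟩ := isHomogeneous_of_dvd hThom hT0 ⟨F, by rw [hr, mul_comm]⟩
  have hk0 := (hF.isHomogeneous.mul hk).inj_right (hr ▸ hThom) (hr ▸ hT0)
  obtain rfl : k = 0 := by omega
  have hrC := totalDegree_eq_zero_iff_eq_C.1 ((totalDegree_zero_iff_isHomogeneous _).2 hk)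
  have hc : r.coeff 0 ≠ 0 := fun h => hr0 (by rw [hrC, h, map_zero])
  refine ⟨![l0, l1, l2], ![m0, m1, m2], (r.coeff 0)⁻¹, h0, h1, h2, g0, g1, g2, inv_ne_zero hc, ?_⟩
  change F = C (r.coeff 0)⁻¹ * T
  rw [hr, mul_comm F, ← mul_assoc]
  conv_rhs => rw [hrC]
  rw [← C_mul, coeff_C, if_pos rfl, inv_mul_cancel₀ hc, C_1, one_mul]

end CayleySalmon

/-! ### The boundary of the surface -/

section Boundary

variable {K : Type*} [Field K] {F : MvPolynomial (Fin 4) K} {P : Fin 6 → PSpace K 2}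
  {π : PSpace K 3 → PSpace K 2} {σ : Fin 4 → MvPolynomial (Fin 3) K}

/-- Two independent linear forms in four variables cut out a line. -/
theorem exists_eq_add_of_dotProduct_eq_zero {a b u w x : Fin 4 → K}
    (hab : LinearIndependent K ![a, b]) (huw : LinearIndependent K ![u, w])
    (hau : a ⬝ᵥ u = 0) (hbu : b ⬝ᵥ u = 0) (haw : a ⬝ᵥ w = 0) (hbw : b ⬝ᵥ w = 0)
    (hax : a ⬝ᵥ x = 0) (hbx : b ⬝ᵥ x = 0) : ∃ s t : K, x = s • u + t • w := by
  let A : Matrix (Fin 2) (Fin 4) K := Matrix.of ![a, b]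
  have hmem : ∀ y, y ∈ LinearMap.ker A.mulVecLin ↔ a ⬝ᵥ y = 0 ∧ b ⬝ᵥ y = 0 := by
    intro y
    rw [LinearMap.mem_ker, Matrix.mulVecLin_apply, funext_iff, Fin.forall_fin_two]
    rfl
  have hrank : A.rank = 2 := by
    have : LinearIndependent K A.row := hab
    simpa using this.rank_matrix
  have hker : Module.finrank K (LinearMap.ker A.mulVecLin) = 2 := by
    have h1 := LinearMap.finrank_range_add_finrank_ker A.mulVecLin
    rw [Module.finrank_fin_fun] at h1
    change A.rank + _ = 4 at h1
    omega
  have hle : Submodule.span K (Set.range ![u, w]) ≤ LinearMap.ker A.mulVecLin := by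
    rw [Submodule.span_le]
    rintro _ ⟨i, rfl⟩
    fin_cases i
    · exact (hmem u).2 ⟨hau, hbu⟩
    · exact (hmem w).2 ⟨haw, hbw⟩
  have heq := Submodule.eq_of_le_of_finrank_eq hle (by
    rw [finrank_span_eq_card huw, hker, Fintype.card_fin])
  have hx : x ∈ Submodule.span K (Set.range ![u, w]) := by
    rw [heq]; exact (hmem x).2 ⟨hax, hbx⟩
  rw [Matrix.range_cons, Matrix.range_cons, Matrix.range_empty, Set.union_empty,
    Set.singleton_union, Submodule.mem_span_pair] at hx
  obtain ⟨s, t, h⟩ := hx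
  exact ⟨s, t, h.symm⟩

theorem InGeneralPosition.add_smul_notMem_range (hP : InGeneralPosition P) {i j : Fin 6}
    (hij : i ≠ j) {t : K} (ht : t ≠ 0) (h0 : (P i).rep + t • (P j).rep ≠ 0) :
    Projectivization.mk K _ h0 ∉ Set.range P := by
  rintro ⟨k, hk⟩
  have hind := Projectivization.linearIndependent_pair_iff_ne.2 (hP.injective.ne hij)
  have h1 : eval (P k).rep (lineForm P i j) = 0 := by
    obtain ⟨c, -, hc⟩ := exists_rep_mk_eq_smul (K := K) h0
    rw [hk, hc, eval_smul_of_isHomogeneous (isHomogeneous_lineForm i j)]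
    have h2 := eval_lineForm_left (P := P) i j
    have h3 := eval_lineForm_right (P := P) i j
    rw [lineForm, eval_lin] at h2 h3 ⊢
    rw [dotProduct_add, dotProduct_smul, h2, h3]
    simp
  by_cases hik : i = k
  · subst hik
    replace hk := (Projectivization.mk_rep (P i)).trans hk
    obtain ⟨c, -, hc⟩ := exists_smul_of_mk_eq_mk hk
    have h2 : (c - 1) • (P i).rep + (c * t) • (P j).rep = 0 := by
      rw [← sub_eq_zero.2 hc.symm]
      module
    obtain ⟨h3, h4⟩ := LinearIndependent.pair_iff.1 hind _ _ h2
    rw [mul_eq_zero_iff_right ht] at h4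
    rw [h4] at h3
    simp at h3
  by_cases hjk : j = k
  · subst hjk
    replace hk := (Projectivization.mk_rep (P j)).trans hk
    obtain ⟨c, hc0, hc⟩ := exists_smul_of_mk_eq_mk hk
    have h2 : c • (P i).rep + (c * t - 1) • (P j).rep = 0 := by
      rw [← sub_eq_zero.2 hc.symm]
      module
    exact hc0 (LinearIndependent.pair_iff.1 hind _ _ h2).1
  · exact hP.eval_lineForm_ne_zero hij hik hjk h1

/-- If two planes both contain the strict transform of the line through `P i` and `P j`, then so
is their line of intersection. -/
theorem mem_strictTransform [CharZero K] (hF : IsSmoothCubic F) (hP : InGeneralPosition P)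
    (hσ : IsInverseForms F P π σ) {i j : Fin 6} (hij : i ≠ j) {a b : Fin 4 → K}
    (hab : LinearIndependent K ![a, b]) (ha : lineForm P i j ∣ bind₁ σ (lin a))
    (hb : lineForm P i j ∣ bind₁ σ (lin b)) {x : Fin 4 → K} (hx : x ≠ 0) (hax : a ⬝ᵥ x = 0)
    (hbx : b ⬝ᵥ x = 0) :
    Projectivization.mk K x hx ∈ strictTransform (zeroLocus F) π P (lineThrough (P i) (P j)) := by
  have hind := Projectivization.linearIndependent_pair_iff_ne.2 (hP.injective.ne hij)
  have hy0 : ∀ t : K, (P i).rep + t • (P j).rep ≠ 0 := fun t => by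
    simpa using add_smul_ne_zero_of_pair hind (a := 1) (b := t) (Or.inl one_ne_zero)
  have hyP : ∀ t : K, t ≠ 0 → Projectivization.mk K _ (hy0 t) ∉ Set.range P :=
    fun t ht => hP.add_smul_notMem_range hij ht (hy0 t)
  have hyl : ∀ t : K, eval ((P i).rep + t • (P j).rep) (lineForm P i j) = 0 := by
    intro t
    have h2 := eval_lineForm_left (P := P) i j
    have h3 := eval_lineForm_right (P := P) i j
    rw [lineForm, eval_lin] at h2 h3 ⊢
    rw [dotProduct_add, dotProduct_smul, h2, h3]
    simp
  let z : K → Fin 4 → K := fun t => evalForms σ ((P i).rep + t • (P j).rep)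
  have hz0 : ∀ t, t ≠ 0 → z t ≠ 0 := fun t ht => hσ.ne_zero _ (hy0 t) (hyP t ht)
  have hza : ∀ t, a ⬝ᵥ z t = 0 := by
    intro t
    obtain ⟨r, hr⟩ := ha
    rw [← eval_lin, ← eval_bind₁, hr, map_mul, hyl, zero_mul]
  have hzb : ∀ t, b ⬝ᵥ z t = 0 := by
    intro t
    obtain ⟨r, hr⟩ := hb
    rw [← eval_lin, ← eval_bind₁, hr, map_mul, hyl, zero_mul]
  have hzF : ∀ t, eval (z t) F = 0 := fun t => by
    rw [← eval_bind₁, hσ.bind₁_eq_zero, map_zero]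
  -- The points `z t` of the surface are distinct, as `π` separates them.
  have hzinj : ∀ t t', t ≠ 0 → t' ≠ 0 → ∀ c : K, z t = c • z t' → t = t' := by
    intro t t' ht ht' c hc
    have h1 := hσ.right_inv _ (hy0 t) (hyP t ht) (hz0 t ht)
    have h2 := hσ.right_inv _ (hy0 t') (hyP t' ht') (hz0 t' ht')
    rw [mk_eq_mk_of_smul (K := K) (hz0 t ht) (hz0 t' ht') c hc] at h1
    obtain ⟨d, -, hd⟩ := exists_smul_of_mk_eq_mk (h1.symm.trans h2)
    have h3 : (1 - d) • (P i).rep + (t - d * t') • (P j).rep = 0 := by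
      rw [← sub_eq_zero] at hd
      rw [← hd]; module
    obtain ⟨h4, h5⟩ := LinearIndependent.pair_iff.1 hind _ _ h3
    linear_combination h5 - t' * h4
  have h12 : LinearIndependent K ![z 2, z 1] := by
    rw [LinearIndependent.pair_symm_iff, LinearIndependent.pair_iff' (hz0 1 one_ne_zero)]
    intro c hc
    exact absurd (hzinj 2 1 two_ne_zero one_ne_zero c hc.symm) (by norm_num)
  intro d q hq hqS
  rw [vanishesAt_mk hq hx]
  have hqz : ∀ t, t ≠ 0 → eval (z t) q = 0 := by
    intro t ht
    refine (vanishesAt_mk hq (hz0 t ht)).1 (hqS _ ⟨?_, ?_⟩)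
    · exact (mk_mem_zeroLocus hF.isHomogeneous _).2 (hzF t)
    · rw [hσ.right_inv _ (hy0 t) (hyP t ht) (hz0 t ht)]
      refine ⟨?_, hyP t ht⟩
      change (Projectivization.mk K _ (hy0 t)).submodule ≤ _
      rw [Projectivization.submodule_mk, Projectivization.submodule_eq, Projectivization.submodule_eq,
        Submodule.span_singleton_le_iff_mem]
      exact Submodule.add_mem_sup (Submodule.mem_span_singleton_self _)
        (Submodule.smul_mem _ _ (Submodule.mem_span_singleton_self _))
  have hcoord : ∀ t, ∃ c : K × K, z t = c.1 • z 2 + c.2 • z 1 := by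
    intro t
    obtain ⟨s, s', h⟩ := exists_eq_add_of_dotProduct_eq_zero hab h12 (hza 2) (hzb 2) (hza 1) (hzb 1)
      (hza t) (hzb t)
    exact ⟨(s, s'), h⟩
  choose c hc using hcoord
  have hc1 : ∀ t, t ≠ 0 → t ≠ 1 → (c t).1 ≠ 0 := by
    intro t ht ht1 h
    refine ht1 (hzinj t 1 ht one_ne_zero (c t).2 ?_)
    rw [hc t, h, zero_smul, zero_add]
  -- The form vanishes at infinitely many points of the line.
  have hr : restrictLine (z 2) (z 1) q = 0 := by
    refine Polynomial.eq_zero_of_infinite_isRoot _ ?_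
    have hinf : ({0, 1}ᶜ : Set K).Infinite := (Set.toFinite {0, 1}).infinite_compl
    refine (hinf.image (f := fun t => (c t).2 / (c t).1) ?_).mono ?_
    · intro t ht t' ht' h
      simp only [Set.mem_compl_iff, Set.mem_insert_iff, Set.mem_singleton_iff, not_or] at ht ht'
      have h1 := hc1 t ht.1 ht.2
      have h2 := hc1 t' ht'.1 ht'.2
      refine hzinj t t' ht.1 ht'.1 ((c t).1 / (c t').1) ?_
      have h3 : (c t).2 = (c t).1 / (c t').1 * (c t').2 := by
        have h : (c t).2 / (c t).1 = (c t').2 / (c t').1 := h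
        field_simp at h ⊢
        linear_combination h
      rw [hc t, hc t', smul_add, smul_smul, smul_smul, ← h3, div_mul_cancel₀ _ h2]
    · rintro _ ⟨t, ht, rfl⟩
      simp only [Set.mem_compl_iff, Set.mem_insert_iff, Set.mem_singleton_iff, not_or] at ht
      have h1 := hc1 t ht.1 ht.2
      change Polynomial.eval _ _ = 0
      rw [eval_restrictLine]
      have h2 := hqz t ht.1
      have h3 : z t = (c t).1 • (z 2 + ((c t).2 / (c t).1) • z 1) := by
        rw [smul_add, smul_smul, mul_div_cancel₀ _ h1, ← hc t]
      rw [h3, eval_smul_of_isHomogeneous hq] at h2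
      exact (mul_eq_zero.1 h2).resolve_left (pow_ne_zero _ h1)
  obtain ⟨s, t, hst⟩ := exists_eq_add_of_dotProduct_eq_zero hab h12 (hza 2) (hzb 2) (hza 1) (hzb 1)
    hax hbx
  by_cases hs : s = 0
  · rw [hst, hs, zero_smul, zero_add, eval_smul_of_isHomogeneous hq, hqz 1 one_ne_zero, mul_zero]
  · have h3 : x = s • (z 2 + (t / s) • z 1) := by
      rw [smul_add, smul_smul, mul_div_cancel₀ _ hs, ← hst]
    rw [h3, eval_smul_of_isHomogeneous hq, ← eval_restrictLine, hr, Polynomial.eval_zero, mul_zero]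

theorem lineThrough_comm {n : ℕ} (p q : PSpace K n) : lineThrough p q = lineThrough q p := by
  rw [lineThrough, lineThrough, sup_comm]

variable {L M : Fin 3 → Fin 4 → K} {κ : K}

theorem IsCayleySalmon.linearIndependent_pair (hP : InGeneralPosition P)
    (h : IsCayleySalmon F P σ L M κ) (a b : Fin 3) (hb : b ≠ 2) :
    LinearIndependent K ![L b, M a] := by
  have hL : L b ≠ 0 := by
    intro h0
    have h1 : bind₁ σ (lin (L b)) = 0 := by rw [lin_eq_zero.2 h0, map_zero]
    have hl : ∀ i j k l m n : Fin 6, i ≠ j → k ≠ l → m ≠ n →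
        lineForm P i j * lineForm P k l * lineForm P m n ≠ 0 := fun i j k l m n h1 h2 h3 =>
      mul_ne_zero (mul_ne_zero (hP.lineForm_ne_zero h1) (hP.lineForm_ne_zero h2))
        (hP.lineForm_ne_zero h3)
    fin_cases b
    · exact hl 0 1 2 3 4 5 (by decide) (by decide) (by decide) (h.L_zero.symm.trans h1)
    · exact hl 1 2 3 4 5 0 (by decide) (by decide) (by decide) (h.L_one.symm.trans h1)
    · exact hb rfl
  rw [LinearIndependent.pair_iff' hL]
  intro c hc
  obtain ⟨q₁, q₂, -, h1, -, h2, h3⟩ := h.exists_factor hP a b hb c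
  rw [hc, sub_self, lin_eq_zero.2 rfl, map_zero] at h3
  exact mul_ne_zero h1 h2 h3.symm

/-- The planes `L 0 = 0` and `L 1 = 0` meet the surface in the two hyperplane sections of which the
boundary consists: by the Cayley–Salmon equation, the sections are the triangles of lines
`L b = M a = 0`. -/
theorem IsCayleySalmon.mem_boundary [CharZero K] (hF : IsSmoothCubic F) (hP : InGeneralPosition P)
    (hσ : IsInverseForms F P π σ) (h : IsCayleySalmon F P σ L M κ) {x : Fin 4 → K} (hx : x ≠ 0)
    (hFx : eval x F = 0) {b : Fin 3} (hb : b ≠ 2) (hL : L b ⬝ᵥ x = 0) :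
    Projectivization.mk K x hx ∈ boundary (zeroLocus F) π P := by
  have hM : ∃ a, M a ⬝ᵥ x = 0 := by
    rw [h.eq] at hFx
    simp only [map_mul, map_sub, eval_C, eval_lin] at hFx
    have h1 : L 0 ⬝ᵥ x * L 1 ⬝ᵥ x * L 2 ⬝ᵥ x = 0 := by
      fin_cases b
      · simp only [Fin.zero_eta, Fin.isValue] at hL
        rw [hL]; ring
      · simp only [Fin.mk_one, Fin.isValue] at hL
        rw [hL]; ring
      · exact absurd rfl hb
    rw [h1, zero_sub] at hFx
    have h2 := neg_eq_zero.1 ((mul_eq_zero.1 hFx).resolve_left h.ne_zero)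
    rcases mul_eq_zero.1 h2 with h2 | h2
    · rcases mul_eq_zero.1 h2 with h2 | h2
      · exact ⟨0, h2⟩
      · exact ⟨1, h2⟩
    · exact ⟨2, h2⟩
  obtain ⟨a, ha⟩ := hM
  have hind := h.linearIndependent_pair hP a b hb
  have key : ∀ i j : Fin 6, i ≠ j → lineForm P i j ∣ bind₁ σ (lin (L b)) →
      lineForm P i j ∣ bind₁ σ (lin (M a)) →
      Projectivization.mk K x hx ∈ strictTransform (zeroLocus F) π P (lineThrough (P i) (P j)) :=
    fun i j hij h1 h2 => mem_strictTransform hF hP hσ hij hind h1 h2 hx hL ha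
  unfold boundary H₁ H₂
  fin_cases b
  · left
    simp only [Fin.zero_eta, Fin.isValue, h.L_zero] at key
    fin_cases a
    · simp only [Fin.zero_eta, Fin.isValue, h.M_zero] at key
      exact Or.inl (Or.inl (key 0 1 (by decide) ⟨_, mul_assoc _ _ _⟩ ⟨_, mul_assoc _ _ _⟩))
    · simp only [Fin.mk_one, Fin.isValue, h.M_one] at key
      exact Or.inl (Or.inr (key 2 3 (by decide) ⟨lineForm P 0 1 * lineForm P 4 5, by ring⟩
        ⟨_, mul_assoc _ _ _⟩))
    · simp only [Fin.reduceFinMk, Fin.isValue, h.M_two] at key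
      exact Or.inr (key 4 5 (by decide) ⟨lineForm P 0 1 * lineForm P 2 3, by ring⟩
        ⟨_, mul_assoc _ _ _⟩)
  · right
    simp only [Fin.mk_one, Fin.isValue, h.L_one] at key
    fin_cases a
    · simp only [Fin.zero_eta, Fin.isValue, h.M_zero] at key
      exact Or.inl (Or.inr (key 3 4 (by decide) ⟨lineForm P 1 2 * lineForm P 5 0, by ring⟩
        ⟨lineForm P 0 1 * lineForm P 2 5, by ring⟩))
    · simp only [Fin.mk_one, Fin.isValue, h.M_one] at key
      rw [lineThrough_comm (P 0)]
      exact Or.inr (key 5 0 (by decide) ⟨lineForm P 1 2 * lineForm P 3 4, by ring⟩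
        ⟨lineForm P 2 3 * lineForm P 4 1, by ring⟩)
    · simp only [Fin.reduceFinMk, Fin.isValue, h.M_two] at key
      exact Or.inl (Or.inl (key 1 2 (by decide) ⟨lineForm P 3 4 * lineForm P 5 0, by ring⟩
        ⟨lineForm P 4 5 * lineForm P 0 3, by ring⟩))
  · exact absurd rfl hb

end Boundary

/-! ### Generic cubic forms -/

section Generic

variable {K : Type*} [Field K]

open Cardinal in
/-- The image of a hypersurface `h = 0` of an affine space under a polynomial map to an affine
space of at least the same dimension lies in a hypersurface. -/
theorem exists_ne_zero_dvd_bind₁ {ι τ : Type} [Finite ι] [Finite τ] (hcard : Nat.card τ ≤ Nat.card ι)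
    (c : ι → MvPolynomial τ K) {h : MvPolynomial τ K} (hh : h ≠ 0) :
    ∃ G : MvPolynomial ι K, G ≠ 0 ∧ h ∣ bind₁ c G := by
  let y : Option ι → MvPolynomial τ K := fun o => o.elim h c
  have hdep : ¬ AlgebraicIndependent K y := by
    intro hind
    have h1 := hind.lift_cardinalMk_le_trdeg
    rw [MvPolynomial.trdeg_of_isDomain] at h1
    have := Fintype.ofFinite ι
    have := Fintype.ofFinite τ
    rw [Nat.card_eq_fintype_card, Nat.card_eq_fintype_card] at hcard
    simp only [Cardinal.mk_fintype, Fintype.card_option, Cardinal.lift_natCast, Nat.cast_le] at h1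
    omega
  rw [algebraicIndependent_iff] at hdep
  push Not at hdep
  obtain ⟨H, hH, hH0⟩ := hdep
  let Ψ : Polynomial (MvPolynomial ι K) →+* MvPolynomial τ K :=
    Polynomial.eval₂RingHom (bind₁ c).toRingHom h
  have hΨ : ∀ H, Ψ (optionEquivLeft K ι H) = aeval y H := by
    intro H
    induction H using MvPolynomial.induction_on with
    | C a => simp [Ψ, algebraMap_eq]
    | add p q hp hq => simp only [map_add, hp, hq]
    | mul_X p o hp =>
      rw [map_mul, map_mul, hp, map_mul, aeval_X]
      congr 1
      cases o <;> simp [Ψ, y]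
  have hp0 : optionEquivLeft K ι H ≠ 0 := by simpa using hH0
  obtain ⟨q, hq, hqd⟩ := Polynomial.exists_eq_pow_rootMultiplicity_mul_and_not_dvd _ hp0 0
  have hΨX : Ψ (Polynomial.X - Polynomial.C 0) = h := by simp [Ψ]
  have h1 : Ψ q = 0 := by
    have h2 : Ψ (optionEquivLeft K ι H) = 0 := by rw [hΨ, hH]
    rw [hq, map_mul, map_pow, hΨX] at h2
    exact (mul_eq_zero.1 h2).resolve_left (pow_ne_zero _ hh)
  rw [Polynomial.C_0, sub_zero, Polynomial.X_dvd_iff] at hqd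
  refine ⟨q.coeff 0, hqd, ?_⟩
  rw [← Polynomial.divX_mul_X_add q, map_add, map_mul] at h1
  have h3 : Ψ Polynomial.X = h := by simp [Ψ]
  have h4 : Ψ (Polynomial.C (q.coeff 0)) = bind₁ c (q.coeff 0) := by simp [Ψ]
  rw [h3, h4] at h1
  exact ⟨-Ψ q.divX, by linear_combination h1⟩

/-- The cubic form `a b (u a + v b + w c + z d) - c d (α a + β b + c + d)`, where the rows of `x`
are the coefficients of the linear forms `a`, `b`, `c`, `d` and the vector `(u, v, w, z)`. -/
noncomputable def normalForm {R : Type*} [CommRing R] (α β : R) (x : Fin 5 × Fin 4 → R) :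
    MvPolynomial (Fin 4) R :=
  let l : Fin 5 → MvPolynomial (Fin 4) R := fun i => ∑ k, C (x (i, k)) * X k
  l 0 * l 1 * (C (x (4, 0)) * l 0 + C (x (4, 1)) * l 1 + C (x (4, 2)) * l 2 + C (x (4, 3)) * l 3) -
    l 2 * l 3 * (C α * l 0 + C β * l 1 + l 2 + l 3)

theorem map_normalForm {R S : Type*} [CommRing R] [CommRing S] (f : R →+* S) (α β : R)
    (x : Fin 5 × Fin 4 → R) : map f (normalForm α β x) = normalForm (f α) (f β) (f ∘ x) := by
  simp [normalForm]

/-- The normal forms depend on twenty parameters, the dimension of the space of cubic forms. -/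
theorem exists_ne_zero_normalForm (α β : K) {h : MvPolynomial (Fin 5 × Fin 4) K} (hh : h ≠ 0) :
    ∃ G : MvPolynomial CubicMonomial K, G ≠ 0 ∧
      ∀ x, eval (cubicCoeffs (normalForm α β x)) G ≠ 0 → eval x h ≠ 0 := by
  have hcard : Nat.card (Fin 5 × Fin 4) ≤ Nat.card CubicMonomial := by
    rw [show Nat.card CubicMonomial = _ from natCard_degree 4 3]
    simp
    decide
  have : Finite CubicMonomial := finite_degree 4 3
  let c : CubicMonomial → MvPolynomial (Fin 5 × Fin 4) K := fun m =>
    (normalForm (C α) (C β) X).coeff m.1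
  obtain ⟨G, hG, r, hr⟩ := exists_ne_zero_dvd_bind₁ hcard c hh
  refine ⟨G, hG, fun x hx h0 => hx ?_⟩
  have h1 : evalForms c x = cubicCoeffs (normalForm α β x) := by
    ext m
    rw [evalForms_apply, cubicCoeffs, ← coeff_map, map_normalForm]
    congr 2
    · simp
    · simp
    · ext i; simp
  rw [← h1, ← eval_bind₁, hr, map_mul, h0, zero_mul]

/-- The excluded values of the moduli `u`, `v`, `w`, `z` in the normal form. -/
def discr {R : Type*} [CommRing R] (u v w z : R) : R :=
  u * v * (u - v) * (w - z) * (w - u - (z - v)) * (w - u + (z - v)) *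
    (w + z - u - v - w * z + u * v)

/-- Whenever the cubic form `F` is in normal form, it avoids some exceptional families. -/
structure IsGeneric (F : MvPolynomial (Fin 4) K) : Prop where
  one_one : ∀ x, F = normalForm 1 1 x → discr (x (4, 0)) (x (4, 1)) (x (4, 2)) (x (4, 3)) ≠ 0
  zero_zero : ∀ x, F = normalForm 0 0 x → x (4, 1) ≠ 1
  zero_one : ∀ x, F = normalForm 0 1 x → x (4, 1) ≠ 1
  one_zero : ∀ x, F = normalForm 1 0 x → x (4, 0) ≠ 1

theorem exists_isGeneric (K : Type*) [Field K] [CharZero K] :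
    ∃ G : MvPolynomial CubicMonomial K, G ≠ 0 ∧
      ∀ F : MvPolynomial (Fin 4) K, eval (cubicCoeffs F) G ≠ 0 → IsGeneric F := by
  let D : MvPolynomial (Fin 5 × Fin 4) K := discr (X (4, 0)) (X (4, 1)) (X (4, 2)) (X (4, 3))
  have hD : ∀ x, eval x D = discr (x (4, 0)) (x (4, 1)) (x (4, 2)) (x (4, 3)) := fun x => by
    simp [D, discr]
  have hD0 : D ≠ 0 := by
    intro h
    have h1 := hD fun p => ![1, 2, 4, 2] p.2
    rw [h, map_zero] at h1
    simp [discr] at h1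
    norm_num at h1
  have hX : ∀ i, (X i - 1 : MvPolynomial (Fin 5 × Fin 4) K) ≠ 0 := by
    intro i h
    have h1 := congrArg (eval 0) h
    simp at h1
  obtain ⟨G₁, h₁, k₁⟩ := exists_ne_zero_normalForm (1 : K) 1 hD0
  obtain ⟨G₂, h₂, k₂⟩ := exists_ne_zero_normalForm (0 : K) 0 (hX (4, 1))
  obtain ⟨G₃, h₃, k₃⟩ := exists_ne_zero_normalForm (0 : K) 1 (hX (4, 1))
  obtain ⟨G₄, h₄, k₄⟩ := exists_ne_zero_normalForm (1 : K) 0 (hX (4, 0))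
  refine ⟨G₁ * G₂ * (G₃ * G₄), mul_ne_zero (mul_ne_zero h₁ h₂) (mul_ne_zero h₃ h₄),
    fun F hF => ?_⟩
  rw [map_mul, map_mul, map_mul] at hF
  have e₁ := left_ne_zero_of_mul (left_ne_zero_of_mul hF)
  have e₂ := right_ne_zero_of_mul (left_ne_zero_of_mul hF)
  have e₃ := left_ne_zero_of_mul (right_ne_zero_of_mul hF)
  have e₄ := right_ne_zero_of_mul (right_ne_zero_of_mul hF)
  refine ⟨?_, ?_, ?_, ?_⟩
  · rintro x rfl
    rw [← hD]; exact k₁ x e₁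
  · rintro x rfl hx
    exact k₂ x e₂ (by simp [hx])
  · rintro x rfl hx
    exact k₃ x e₃ (by simp [hx])
  · rintro x rfl hx
    exact k₄ x e₄ (by simp [hx])

/-! ### The normal form of a generic surface -/

/-- Six vectors are, up to scalars, in the position `a`, `b`, `u a + v b + w c + z d`, `c`,
`a + b + c + d`, `d` with generic moduli. -/
structure IsNormal {V : Type*} [AddCommGroup V] [Module K V] (l₁ l₂ l₃ m₁ m₂ m₃ : V)
    (r₁ r₂ r₃ p₁ p₂ p₃ u v w z : K) : Prop where
  r₁_ne_zero : r₁ ≠ 0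
  r₂_ne_zero : r₂ ≠ 0
  r₃_ne_zero : r₃ ≠ 0
  p₁_ne_zero : p₁ ≠ 0
  p₂_ne_zero : p₂ ≠ 0
  p₃_ne_zero : p₃ ≠ 0
  prod_eq : r₁ * r₂ * r₃ = p₁ * p₂ * p₃
  m₂_eq : p₂ • m₂ = r₁ • l₁ + r₂ • l₂ + p₁ • m₁ + p₃ • m₃
  l₃_eq : r₃ • l₃ = u • r₁ • l₁ + v • r₂ • l₂ + w • p₁ • m₁ + z • p₃ • m₃
  discr_ne_zero : discr u v w z ≠ 0

theorem IsNormal.map {V W : Type*} [AddCommGroup V] [Module K V] [AddCommGroup W] [Module K W]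
    {l₁ l₂ l₃ m₁ m₂ m₃ : V} {r₁ r₂ r₃ p₁ p₂ p₃ u v w z : K}
    (h : IsNormal l₁ l₂ l₃ m₁ m₂ m₃ r₁ r₂ r₃ p₁ p₂ p₃ u v w z) (f : V →ₗ[K] W) :
    IsNormal (f l₁) (f l₂) (f l₃) (f m₁) (f m₂) (f m₃) r₁ r₂ r₃ p₁ p₂ p₃ u v w z :=
  { h with
    m₂_eq := by simpa using congrArg f h.m₂_eq
    l₃_eq := by simpa using congrArg f h.l₃_eq }

/-- Two lines of one triangle and two of the other are never concurrent on a smooth surface with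
equation `a b c = d e f`. -/
theorem IsSmoothCubic.false_of_common_zero {F a b c d e f : MvPolynomial (Fin 4) K} {κ : K}
    (hF : IsSmoothCubic F) (h : F = C κ * (a * b * c - d * e * f)) {x : Fin 4 → K} (hx : x ≠ 0)
    (ha : eval x a = 0) (hb : eval x b = 0) (hd : eval x d = 0) (he : eval x e = 0) : False := by
  obtain ⟨i, hi⟩ := hF.exists_pderiv_ne_zero hx (by rw [h]; simp [ha, hd])
  apply hi
  rw [h]
  simp [ha, hb, hd, he]

theorem exists_common_zero_three (a b c : Fin 4 → K) :
    ∃ x, x ≠ 0 ∧ a ⬝ᵥ x = 0 ∧ b ⬝ᵥ x = 0 ∧ c ⬝ᵥ x = 0 := by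
  have hdet : (Matrix.of ![a, b, c, 0]).det = 0 := Matrix.det_eq_zero_of_row_eq_zero 3 (by simp)
  obtain ⟨x, hx, h⟩ := Matrix.exists_mulVec_eq_zero_iff.2 hdet
  exact ⟨x, hx, congrFun h 0, congrFun h 1, congrFun h 2⟩

/-- Four linear forms without common zero span all linear forms. -/
theorem exists_eq_sum_of_no_common_zero {a b c d : Fin 4 → K}
    (h : ∀ x, x ≠ 0 → a ⬝ᵥ x = 0 → b ⬝ᵥ x = 0 → c ⬝ᵥ x = 0 → d ⬝ᵥ x = 0 → False) (e : Fin 4 → K) :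
    ∃ α β γ δ : K, e = α • a + β • b + γ • c + δ • d := by
  have hdet : (Matrix.of ![a, b, c, d]).det ≠ 0 := by
    intro h0
    obtain ⟨x, hx, h1⟩ := Matrix.exists_mulVec_eq_zero_iff.2 h0
    exact h x hx (congrFun h1 0) (congrFun h1 1) (congrFun h1 2) (congrFun h1 3)
  have hu : IsUnit (Matrix.of ![a, b, c, d]).det := hdet.isUnit
  let y := Matrix.vecMul e (Matrix.of ![a, b, c, d])⁻¹
  have hy : Matrix.vecMul y (Matrix.of ![a, b, c, d]) = e := by
    rw [Matrix.vecMul_vecMul, Matrix.nonsing_inv_mul _ hu, Matrix.vecMul_one]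
  refine ⟨y 0, y 1, y 2, y 3, ?_⟩
  rw [← hy]
  ext k
  simp [Matrix.vecMul, dotProduct, Fin.sum_univ_four]

theorem eq_normalForm {F : MvPolynomial (Fin 4) K} {l₁ l₂ l₃ m₁ m₂ m₃ : Fin 4 → K}
    {κ r₁ r₂ r₃ p₁ p₂ p₃ α β u v w z : K}
    (h : F = C κ * (lin l₁ * lin l₂ * lin l₃ - lin m₁ * lin m₂ * lin m₃))
    (hr : r₁ * r₂ * r₃ = κ) (hp : p₁ * p₂ * p₃ = κ)
    (hm : p₂ • m₂ = α • r₁ • l₁ + β • r₂ • l₂ + p₁ • m₁ + p₃ • m₃)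
    (hl : r₃ • l₃ = u • r₁ • l₁ + v • r₂ • l₂ + w • p₁ • m₁ + z • p₃ • m₃) :
    F = normalForm α β
      fun q => ![r₁ • l₁, r₂ • l₂, p₁ • m₁, p₃ • m₃, ![u, v, w, z]] q.1 q.2 := by
  change F = lin (r₁ • l₁) * lin (r₂ • l₂) * (C u * lin (r₁ • l₁) + C v * lin (r₂ • l₂) +
    C w * lin (p₁ • m₁) + C z * lin (p₃ • m₃)) - lin (p₁ • m₁) * lin (p₃ • m₃) *
    (C α * lin (r₁ • l₁) + C β * lin (r₂ • l₂) + lin (p₁ • m₁) + lin (p₃ • m₃))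
  have hm' := congrArg lin hm
  have hl' := congrArg lin hl
  have hr' : C r₁ * C r₂ * C r₃ = (C κ : MvPolynomial (Fin 4) K) := by rw [← hr]; simp
  have hp' : C p₁ * C p₂ * C p₃ = (C κ : MvPolynomial (Fin 4) K) := by rw [← hp]; simp
  simp only [lin_add, lin_smul] at hm' hl' ⊢
  rw [h]
  linear_combination (-(lin l₁ * lin l₂ * lin l₃)) * hr' + (lin m₁ * lin m₂ * lin m₃) * hp' +
    C r₁ * lin l₁ * C r₂ * lin l₂ * hl' - C p₁ * lin m₁ * C p₃ * lin m₃ * hm'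

/-- Four of the linear forms in the equation are independent, hence the other two are combinations of
them. After a choice of scalars the equation is in one of the four normal forms, and genericity
excludes all but one of them. -/
theorem IsGeneric.exists_isNormal [IsAlgClosed K] {F : MvPolynomial (Fin 4) K}
    (hF : IsSmoothCubic F) (hG : IsGeneric F) {l₁ l₂ l₃ m₁ m₂ m₃ : Fin 4 → K} {κ : K}
    (hκ : κ ≠ 0) (h : F = C κ * (lin l₁ * lin l₂ * lin l₃ - lin m₁ * lin m₂ * lin m₃)) :
    ∃ r₁ r₂ r₃ p₁ p₂ p₃ u v w z : K, IsNormal l₁ l₂ l₃ m₁ m₂ m₃ r₁ r₂ r₃ p₁ p₂ p₃ u v w z := by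
  have no_zero : ∀ a b c d e f : Fin 4 → K, lin a * lin b * lin c = lin l₁ * lin l₂ * lin l₃ →
      lin d * lin e * lin f = lin m₁ * lin m₂ * lin m₃ → ∀ x, x ≠ 0 → a ⬝ᵥ x = 0 → b ⬝ᵥ x = 0 →
      d ⬝ᵥ x = 0 → e ⬝ᵥ x = 0 → False := by
    intro a b c d e f h1 h2 x hx ha hb hd he
    rw [← eval_lin] at ha hb hd he
    exact hF.false_of_common_zero (by rw [h, ← h1, ← h2]) hx ha hb hd he
  have hbasis := no_zero l₁ l₂ l₃ m₁ m₃ m₂ rfl (by ring)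
  obtain ⟨α, β, γ, δ, hm⟩ := exists_eq_sum_of_no_common_zero hbasis m₂
  obtain ⟨u, v, w, z, hl⟩ := exists_eq_sum_of_no_common_zero hbasis l₃
  have hγ : γ ≠ 0 := by
    rintro rfl
    obtain ⟨x, hx, h1, h2, h3⟩ := exists_common_zero_three l₁ l₂ m₃
    refine no_zero l₁ l₂ l₃ m₃ m₂ m₁ rfl (by ring) x hx h1 h2 h3 ?_
    simp [hm, add_dotProduct, smul_dotProduct, h1, h2, h3]
  have hδ : δ ≠ 0 := by
    rintro rfl
    obtain ⟨x, hx, h1, h2, h3⟩ := exists_common_zero_three l₁ l₂ m₁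
    refine no_zero l₁ l₂ l₃ m₁ m₂ m₃ rfl rfl x hx h1 h2 h3 ?_
    simp [hm, add_dotProduct, smul_dotProduct, h1, h2, h3]
  have hu : u ≠ 0 := by
    rintro rfl
    obtain ⟨x, hx, h1, h2, h3⟩ := exists_common_zero_three l₂ m₁ m₃
    refine no_zero l₂ l₃ l₁ m₁ m₃ m₂ (by ring) (by ring) x hx h1 ?_ h2 h3
    simp [hl, add_dotProduct, smul_dotProduct, h1, h2, h3]
  have hv : v ≠ 0 := by
    rintro rfl
    obtain ⟨x, hx, h1, h2, h3⟩ := exists_common_zero_three l₁ m₁ m₃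
    refine no_zero l₁ l₃ l₂ m₁ m₃ m₂ (by ring) (by ring) x hx h1 ?_ h2 h3
    simp [hl, add_dotProduct, smul_dotProduct, h1, h2, h3]
  obtain ⟨t, ht⟩ := IsAlgClosed.exists_pow_nat_eq (κ / (γ * δ)) (n := 3) (by norm_num)
  have ht0 : t ≠ 0 := by
    rintro rfl
    rw [zero_pow three_ne_zero] at ht
    exact div_ne_zero hκ (mul_ne_zero hγ hδ) ht.symm
  have hp : t * γ * t * (t * δ) = κ := by
    rw [eq_div_iff (mul_ne_zero hγ hδ)] at ht
    linear_combination ht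
  -- The equation after scaling the linear forms, with `a` and `b` scaled by `r₁` and `r₂`.
  have key : ∀ r₁ r₂ a b : K, r₁ ≠ 0 → r₂ ≠ 0 → t * α = a * r₁ → t * β = b * r₂ →
      ∃ w' z' : K, F = normalForm a b (fun q => ![r₁ • l₁, r₂ • l₂, (t * γ) • m₁, (t * δ) • m₃,
        ![κ * u / (r₁ ^ 2 * r₂), κ * v / (r₁ * r₂ ^ 2), w', z']] q.1 q.2) ∧
        t • m₂ = a • r₁ • l₁ + b • r₂ • l₂ + (t * γ) • m₁ + (t * δ) • m₃ ∧
        (κ / (r₁ * r₂)) • l₃ = (κ * u / (r₁ ^ 2 * r₂)) • r₁ • l₁ +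
          (κ * v / (r₁ * r₂ ^ 2)) • r₂ • l₂ + w' • (t * γ) • m₁ + z' • (t * δ) • m₃ := by
    intro r₁ r₂ a b hr₁ hr₂ ha hb
    refine ⟨κ * w / (r₁ * r₂ * (t * γ)), κ * z / (r₁ * r₂ * (t * δ)), ?_⟩
    have e1 : t • m₂ = a • r₁ • l₁ + b • r₂ • l₂ + (t * γ) • m₁ + (t * δ) • m₃ := by
      rw [smul_smul, smul_smul, ← ha, ← hb, hm]
      module
    have e2 : (κ / (r₁ * r₂)) • l₃ = (κ * u / (r₁ ^ 2 * r₂)) • r₁ • l₁ +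
          (κ * v / (r₁ * r₂ ^ 2)) • r₂ • l₂ + (κ * w / (r₁ * r₂ * (t * γ))) • (t * γ) • m₁ +
          (κ * z / (r₁ * r₂ * (t * δ))) • (t * δ) • m₃ := by
      rw [hl]
      simp only [smul_add, smul_smul]
      congr 1
      · congr 1
        · congr 1
          · congr 1; field_simp
          · congr 1; field_simp
        · congr 1; field_simp
      · congr 1; field_simp
    exact ⟨eq_normalForm h (by field_simp) hp e1 e2, e1, e2⟩
  have hα : α ≠ 0 ∧ β ≠ 0 := by
    by_cases hα : α = 0
    · exfalso
      by_cases hβ : β = 0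
      · obtain ⟨w', z', e, -⟩ := key (κ * v) 1 0 0 (mul_ne_zero hκ hv) one_ne_zero (by simp [hα])
          (by simp [hβ])
        refine hG.zero_zero _ e ?_
        change κ * v / (κ * v * 1 ^ 2) = 1
        field_simp
      · obtain ⟨w', z', e, -⟩ := key (κ * v / (t * β) ^ 2) (t * β) 0 1
          (div_ne_zero (mul_ne_zero hκ hv) (pow_ne_zero _ (mul_ne_zero ht0 hβ)))
          (mul_ne_zero ht0 hβ) (by simp [hα]) (by ring)
        refine hG.zero_one _ e ?_
        change κ * v / (κ * v / (t * β) ^ 2 * (t * β) ^ 2) = 1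
        field_simp
    · refine ⟨hα, fun hβ => ?_⟩
      obtain ⟨w', z', e, -⟩ := key (t * α) (κ * u / (t * α) ^ 2) 1 0 (mul_ne_zero ht0 hα)
        (div_ne_zero (mul_ne_zero hκ hu) (pow_ne_zero _ (mul_ne_zero ht0 hα))) (by ring)
        (by simp [hβ])
      refine hG.one_zero _ e ?_
      change κ * u / ((t * α) ^ 2 * (κ * u / (t * α) ^ 2)) = 1
      field_simp
  obtain ⟨hα, hβ⟩ := hα
  obtain ⟨w', z', e, e1, e2⟩ := key (t * α) (t * β) 1 1 (mul_ne_zero ht0 hα) (mul_ne_zero ht0 hβ)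
    (by ring) (by ring)
  refine ⟨_, _, _, _, _, _, _, _, _, _, mul_ne_zero ht0 hα, mul_ne_zero ht0 hβ,
    div_ne_zero hκ (mul_ne_zero (mul_ne_zero ht0 hα) (mul_ne_zero ht0 hβ)), mul_ne_zero ht0 hγ, ht0,
    mul_ne_zero ht0 hδ, ?_, ?_, e2, hG.one_one _ e⟩
  · rw [hp, mul_div_cancel₀ _ (mul_ne_zero (mul_ne_zero ht0 hα) (mul_ne_zero ht0 hβ))]
  · rw [e1, one_smul, one_smul]

end Generic

/-! ### Polynomial solutions of the equation in normal form -/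

section TorusCurve

variable {K : Type*} [Field K]

theorem IsNormal.swap {V : Type*} [AddCommGroup V] [Module K V] {l₁ l₂ l₃ m₁ m₂ m₃ : V}
    {r₁ r₂ r₃ p₁ p₂ p₃ u v w z : K}
    (h : IsNormal l₁ l₂ l₃ m₁ m₂ m₃ r₁ r₂ r₃ p₁ p₂ p₃ u v w z) :
    IsNormal l₂ l₁ l₃ m₃ m₂ m₁ r₂ r₁ r₃ p₃ p₂ p₁ v u z w :=
  { r₁_ne_zero := h.r₂_ne_zero
    r₂_ne_zero := h.r₁_ne_zero
    r₃_ne_zero := h.r₃_ne_zero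
    p₁_ne_zero := h.p₃_ne_zero
    p₂_ne_zero := h.p₂_ne_zero
    p₃_ne_zero := h.p₁_ne_zero
    prod_eq := by linear_combination h.prod_eq
    m₂_eq := by rw [h.m₂_eq]; abel
    l₃_eq := by rw [h.l₃_eq]; abel
    discr_ne_zero := by
      rw [show discr v u z w = -discr u v w z by simp only [discr]; ring]
      exact neg_ne_zero.2 h.discr_ne_zero }

/-- The six linear forms of the equation `l₁ l₂ l₃ = m₁ m₂ m₃`, restricted to a curve which is
parametrized by polynomials of degree at most `d`. Its points at the parameters `0` and `∞` are
seen by the coefficients of degree `0` and `d`. -/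
structure IsConfiguration (d : ℕ) (l₁ l₂ l₃ : Polynomial K) (m : Fin 3 → Polynomial K) :
    Prop where
  natDegree_l₃ : l₃.natDegree ≤ d
  natDegree_m : ∀ i, (m i).natDegree ≤ d
  m_ne_zero : ∀ i, m i ≠ 0
  prod_eq : ∀ i j k, i ≠ j → i ≠ k → j ≠ k → l₁ * l₂ * l₃ = m i * m j * m k
  ne_at : ∀ n, n = 0 ∨ n = d → ∀ i k, i ≠ k → l₁.coeff n = 0 → l₂.coeff n = 0 →
    (m i).coeff n = 0 → (m k).coeff n = 0 → False
  exists_isNormal : ∀ i j k, i ≠ j → i ≠ k → j ≠ k → ∃ r₁ r₂ r₃ p₁ p₂ p₃ u v w z : K,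
    IsNormal l₁ l₂ l₃ (m i) (m j) (m k) r₁ r₂ r₃ p₁ p₂ p₃ u v w z

variable {d : ℕ} {l₁ l₂ l₃ : Polynomial K} {m : Fin 3 → Polynomial K}

theorem IsConfiguration.swap (h : IsConfiguration d l₁ l₂ l₃ m) : IsConfiguration d l₂ l₁ l₃ m :=
  { h with
    prod_eq := fun i j k hij hik hjk => by rw [mul_comm l₂, h.prod_eq i j k hij hik hjk]
    ne_at := fun n hn i k hik h1 h2 => h.ne_at n hn i k hik h2 h1
    exists_isNormal := fun i j k hij hik hjk => by
      obtain ⟨r₁, r₂, r₃, p₁, p₂, p₃, u, v, w, z, hN⟩ :=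
        h.exists_isNormal k j i hjk.symm hik.symm hij.symm
      exact ⟨_, _, _, _, _, _, _, _, _, _, hN.swap⟩ }

theorem IsConfiguration.l_ne_zero (h : IsConfiguration d l₁ l₂ l₃ m) : l₁ * l₂ * l₃ ≠ 0 := by
  rw [h.prod_eq 0 1 2 (by decide) (by decide) (by decide)]
  exact mul_ne_zero (mul_ne_zero (h.m_ne_zero 0) (h.m_ne_zero 1)) (h.m_ne_zero 2)

theorem discr_ne_zero_iff {u v w z : K} : discr u v w z ≠ 0 ↔ u ≠ 0 ∧ v ≠ 0 ∧ u ≠ v ∧ w ≠ z ∧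
    w - u ≠ z - v ∧ w - u ≠ -(z - v) ∧ w + z - u - v - w * z + u * v ≠ 0 := by
  simp only [discr, mul_ne_zero_iff, sub_ne_zero, ne_eq, eq_neg_iff_add_eq_zero]
  tauto

theorem IsNormal.coeff_m₂ {m₁ m₂ m₃ : Polynomial K} {r₁ r₂ r₃ p₁ p₂ p₃ u v w z : K}
    (h : IsNormal l₁ l₂ l₃ m₁ m₂ m₃ r₁ r₂ r₃ p₁ p₂ p₃ u v w z) (n : ℕ) : p₂ * m₂.coeff n =
    r₁ * l₁.coeff n + r₂ * l₂.coeff n + p₁ * m₁.coeff n + p₃ * m₃.coeff n := by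
  simpa using congrArg (Polynomial.coeff · n) h.m₂_eq

theorem IsNormal.coeff_l₃ {m₁ m₂ m₃ : Polynomial K} {r₁ r₂ r₃ p₁ p₂ p₃ u v w z : K}
    (h : IsNormal l₁ l₂ l₃ m₁ m₂ m₃ r₁ r₂ r₃ p₁ p₂ p₃ u v w z) (n : ℕ) : r₃ * l₃.coeff n =
    u * (r₁ * l₁.coeff n) + v * (r₂ * l₂.coeff n) + w * (p₁ * m₁.coeff n) +
      z * (p₃ * m₃.coeff n) := by
  simpa using congrArg (Polynomial.coeff · n) h.l₃_eq

/-- If the product of two of the `m i` is proportional to `l₁ l₂`, then `l₃` is proportional to the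
remaining one. -/
theorem IsNormal.exists_coeff_l₃_eq {m₁ m₂ m₃ : Polynomial K} {r₁ r₂ r₃ p₁ p₂ p₃ u v w z : K}
    (h : IsNormal l₁ l₂ l₃ m₁ m₂ m₃ r₁ r₂ r₃ p₁ p₂ p₃ u v w z) {c₁ c₂ : K} {Q : Polynomial K}
    (hprod : l₁ * l₂ * l₃ = m₁ * m₂ * m₃) (hQ : Q ≠ 0) (hc₁ : c₁ ≠ 0)
    (hl : l₁ * l₂ = Polynomial.C c₁ * Q) (hm : m₁ * m₃ = Polynomial.C c₂ * Q) :
    ∃ t : K, ∀ n, u * (r₁ * l₁.coeff n) + v * (r₂ * l₂.coeff n) + w * (p₁ * m₁.coeff n) +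
      z * (p₃ * m₃.coeff n) =
      t * (r₁ * l₁.coeff n + r₂ * l₂.coeff n + p₁ * m₁.coeff n + p₃ * m₃.coeff n) := by
  have h1 : Polynomial.C c₁ * l₃ = Polynomial.C c₂ * m₂ := by
    apply mul_left_cancel₀ hQ
    linear_combination hprod - l₃ * hl + m₂ * hm
  refine ⟨r₃ * c₂ / (c₁ * p₂), fun n => ?_⟩
  have h2 : c₁ * l₃.coeff n = c₂ * m₂.coeff n := by
    simpa using congrArg (Polynomial.coeff · n) h1
  rw [← h.coeff_l₃, ← h.coeff_m₂]
  have := h.p₂_ne_zero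
  field_simp
  linear_combination r₃ * h2

theorem eq_C_mul_X_pow_of_le {p : Polynomial K} (h : p.natDegree ≤ p.natTrailingDegree) :
    p = Polynomial.C p.leadingCoeff * Polynomial.X ^ p.natDegree := by
  ext n
  rw [Polynomial.coeff_C_mul_X_pow]
  split_ifs with hn
  · rw [hn]; rfl
  · rcases lt_or_gt_of_ne hn with hn | hn
    · exact Polynomial.coeff_eq_zero_of_lt_natTrailingDegree (hn.trans_le h)
    · exact Polynomial.coeff_eq_zero_of_natDegree_lt hn

theorem natTrailingDegree_eq_zero_of_coeff {p : Polynomial K} (h : p.coeff 0 ≠ 0) :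
    p.natTrailingDegree = 0 :=
  Nat.le_zero.1 (Polynomial.natTrailingDegree_le_of_ne_zero h)

theorem natTrailingDegree_pos_of_coeff {p : Polynomial K} (hp : p ≠ 0) (h : p.coeff 0 = 0) :
    0 < p.natTrailingDegree := by
  by_contra h0
  obtain h0 := Nat.eq_zero_of_not_pos h0
  have := Polynomial.trailingCoeff_nonzero_iff_nonzero.2 hp
  rw [Polynomial.trailingCoeff, h0] at this
  exact this h

theorem natDegree_eq_of_coeff {p : Polynomial K} {d : ℕ} (hp : p.natDegree ≤ d)
    (h : p.coeff d ≠ 0) : p.natDegree = d :=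
  hp.antisymm (Polynomial.le_natDegree_of_ne_zero h)

theorem natDegree_lt_of_coeff {p : Polynomial K} {d : ℕ} (hp0 : p ≠ 0) (hp : p.natDegree ≤ d)
    (h : p.coeff d = 0) : p.natDegree < d := by
  refine lt_of_le_of_ne hp fun h0 => ?_
  rw [← h0] at h
  exact hp0 (Polynomial.leadingCoeff_eq_zero.1 h)

theorem natTrailingDegree_mul_three {p q r : Polynomial K} (h : p * q * r ≠ 0) :
    (p * q * r).natTrailingDegree =
      p.natTrailingDegree + q.natTrailingDegree + r.natTrailingDegree := by
  have h1 := left_ne_zero_of_mul h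
  rw [Polynomial.natTrailingDegree_mul h1 (right_ne_zero_of_mul h),
    Polynomial.natTrailingDegree_mul (left_ne_zero_of_mul h1) (right_ne_zero_of_mul h1)]

theorem natDegree_mul_three {p q r : Polynomial K} (h : p * q * r ≠ 0) :
    (p * q * r).natDegree = p.natDegree + q.natDegree + r.natDegree := by
  have h1 := left_ne_zero_of_mul h
  rw [Polynomial.natDegree_mul h1 (right_ne_zero_of_mul h),
    Polynomial.natDegree_mul (left_ne_zero_of_mul h1) (right_ne_zero_of_mul h1)]

/-- The main case of the comparison of coefficients. On the curve, two of the linear forms are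
`a = A X ^ d` and `b = B`, which vanish only at `0` and only at `∞`, respectively. The others are
`c` and `e = a + b + c + f`, which vanish at `0`, `f`, which vanishes at `∞` together with `e`, and
`g = u a + v b + w c + z f`, which vanishes at neither. Comparison of the extreme coefficients in
`a b g = c e f` gives one of the excluded relations between `u`, `v`, `w`, `z`. -/
theorem false_of_discr_ne_zero {A B u v w z : K} {c e f g : Polynomial K} (hd : 0 < d)
    (hD : discr u v w z ≠ 0) (hA : A ≠ 0) (hB : B ≠ 0)
    (he : ∀ n, e.coeff n =
      (if n = d then A else 0) + (if n = 0 then B else 0) + c.coeff n + f.coeff n)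
    (hg : ∀ n, g.coeff n = u * (if n = d then A else 0) + v * (if n = 0 then B else 0) +
      w * c.coeff n + z * f.coeff n)
    (hprod : Polynomial.C (A * B) * Polynomial.X ^ d * g = c * e * f)
    (he0 : e ≠ 0) (hf0 : f ≠ 0)
    (hcd : c.natDegree ≤ d) (hed : e.natDegree ≤ d) (hgd : g.natDegree ≤ d) (hfd : f.natDegree ≤ d)
    (hc : c.coeff 0 = 0) (hez : e.coeff 0 = 0) (hei : e.coeff d = 0) (hf : f.coeff d = 0)
    (hgz : g.coeff 0 ≠ 0) (hgi : g.coeff d ≠ 0) : False := by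
  obtain ⟨-, -, -, -, hPQ, hPQ', hR⟩ := discr_ne_zero_iff.1 hD
  have hAB : A * B ≠ 0 := mul_ne_zero hA hB
  have hcA : c.coeff d = -A := by
    have := he d
    rw [hei, if_pos rfl, if_neg hd.ne', hf] at this
    linear_combination -this
  have hfB : f.coeff 0 = -B := by
    have := he 0
    rw [hez, if_pos rfl, if_neg hd.ne, hc] at this
    linear_combination -this
  have hg0' : g.coeff 0 = (v - z) * B := by
    rw [hg, if_pos rfl, if_neg hd.ne, hc, hfB]; ring
  have hgd' : g.coeff d = (u - w) * A := by
    rw [hg, if_pos rfl, if_neg hd.ne', hf, hcA]; ring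
  have hc0 : c ≠ 0 := by
    rintro rfl
    simp at hcA
    exact hA hcA
  have hrhs : c * e * f ≠ 0 := mul_ne_zero (mul_ne_zero hc0 he0) hf0
  have hlhs : Polynomial.C (A * B) * Polynomial.X ^ d * g ≠ 0 := hprod ▸ hrhs
  have hcdeg := natDegree_eq_of_coeff hcd (by rw [hcA]; exact neg_ne_zero.2 hA)
  have hgdeg := natDegree_eq_of_coeff hgd hgi
  have hford := natTrailingDegree_eq_zero_of_coeff (p := f) (by rw [hfB]; exact neg_ne_zero.2 hB)
  have hgord := natTrailingDegree_eq_zero_of_coeff hgz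
  have hcpos := natTrailingDegree_pos_of_coeff hc0 hc
  have hepos := natTrailingDegree_pos_of_coeff he0 hez
  have helt := natDegree_lt_of_coeff he0 hed hei
  have hflt := natDegree_lt_of_coeff hf0 hfd hf
  have hele := Polynomial.natTrailingDegree_le_natDegree e
  have hord := natTrailingDegree_mul_three hrhs
  have hdeg := natDegree_mul_three hrhs
  rw [← hprod, natTrailingDegree_mul_three hlhs, Polynomial.natTrailingDegree_C,
    Polynomial.natTrailingDegree_X_pow, hford, hgord] at hord
  rw [← hprod, natDegree_mul_three hlhs, Polynomial.natDegree_C,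
    Polynomial.natDegree_X_pow, hgdeg, hcdeg] at hdeg
  have hbot : c.coeff c.natTrailingDegree * e.coeff e.natTrailingDegree = A * B * (z - v) := by
    have h1 : (c * e * f).trailingCoeff = (Polynomial.C (A * B) * Polynomial.X ^ d * g).trailingCoeff :=
      by rw [hprod]
    simp only [Polynomial.trailingCoeff_mul] at h1
    simp only [Polynomial.trailingCoeff, Polynomial.natTrailingDegree_C, hford, hgord, hfB, hg0',
      Polynomial.natTrailingDegree_X_pow, Polynomial.coeff_C_zero, Polynomial.coeff_X_pow_self]
      at h1
    apply mul_right_cancel₀ hB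
    linear_combination -h1
  have htop : f.coeff f.natDegree * e.coeff e.natDegree = A * B * (w - u) := by
    have h1 : (c * e * f).leadingCoeff = (Polynomial.C (A * B) * Polynomial.X ^ d * g).leadingCoeff :=
      by rw [hprod]
    simp only [Polynomial.leadingCoeff_mul] at h1
    simp only [Polynomial.leadingCoeff, Polynomial.natDegree_C, hcdeg, hgdeg, hcA, hgd',
      Polynomial.natDegree_X_pow, Polynomial.coeff_C_zero, Polynomial.coeff_X_pow_self]
      at h1
    apply mul_right_cancel₀ hA
    linear_combination -h1
  have hemid : ∀ n, 0 < n → n < d → e.coeff n = c.coeff n + f.coeff n := by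
    intro n h0 h1
    rw [he, if_neg h1.ne, if_neg h0.ne']; ring
  have hclow : ∀ n, n < c.natTrailingDegree → c.coeff n = 0 := fun n hn =>
    Polynomial.coeff_eq_zero_of_lt_natTrailingDegree hn
  have hfhigh : ∀ n, f.natDegree < n → f.coeff n = 0 := fun n hn =>
    Polynomial.coeff_eq_zero_of_natDegree_lt hn
  have hctr : c.coeff c.natTrailingDegree ≠ 0 := Polynomial.trailingCoeff_nonzero_iff_nonzero.2 hc0
  have hflead : f.coeff f.natDegree ≠ 0 := Polynomial.leadingCoeff_ne_zero.2 hf0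
  -- `c` and `f` overlap in at most one monomial.
  have hab : f.natDegree ≤ c.natTrailingDegree := by omega
  rcases hab.lt_or_eq with hab | hab
  · have e1 := hemid c.natTrailingDegree hcpos (by omega)
    have e2 := hemid f.natDegree (by omega) (by omega)
    rw [hfhigh _ hab, add_zero] at e1
    rw [hclow _ hab, zero_add] at e2
    have i1 := Polynomial.le_natDegree_of_ne_zero (p := e) (n := c.natTrailingDegree)
      (by rwa [e1])
    have i2 := Polynomial.natTrailingDegree_le_of_ne_zero (p := e) (n := f.natDegree)
      (by rwa [e2])
    have i3 : e.natDegree = c.natTrailingDegree := by omega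
    have i4 : e.natTrailingDegree = f.natDegree := by omega
    rw [i4, e2] at hbot
    rw [i3, e1] at htop
    apply hPQ
    apply mul_left_cancel₀ hAB
    linear_combination hbot - htop
  · have i1 : e.natDegree = e.natTrailingDegree := by omega
    have e1 := hemid c.natTrailingDegree hcpos (by omega)
    by_cases ha : e.natTrailingDegree = c.natTrailingDegree
    · have hch : ∀ n, n < d → n ≠ c.natTrailingDegree → c.coeff n = 0 := by
        intro n hn hne
        rcases lt_or_gt_of_ne hne with hlt | hgt
        · exact hclow n hlt
        · have := hemid n (by omega) hn
          rw [hfhigh n (by omega), add_zero, Polynomial.coeff_eq_zero_of_natDegree_lt (by omega)]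
            at this
          exact this.symm
      have hfl : ∀ n, 0 < n → n ≠ c.natTrailingDegree → f.coeff n = 0 := by
        intro n hn hne
        rcases lt_or_gt_of_ne hne with hlt | hgt
        · have := hemid n hn (by omega)
          rw [hclow n (by omega), zero_add,
            Polynomial.coeff_eq_zero_of_lt_natTrailingDegree (by omega)] at this
          exact this.symm
        · exact hfhigh n (by omega)
      set a := c.natTrailingDegree with ha'
      set y := c.coeff a with hy
      set k := f.coeff a with hk
      rw [hab, ← hk] at htop
      rw [ha] at hbot i1
      rw [i1] at htop
      rw [e1] at hbot htop
      -- Up to constants, the six forms are now explicit.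
      have ed : d = 2 * a := by omega
      have ce : c = Polynomial.C (-A) * Polynomial.X ^ (2 * a) + Polynomial.C y * Polynomial.X ^ a := by
        ext n
        simp only [Polynomial.coeff_add, Polynomial.coeff_C_mul_X_pow]
        by_cases h1 : n = a
        · rw [if_neg (by omega), if_pos h1, h1, zero_add]
        · by_cases h2 : n = 2 * a
          · rw [if_pos h2, if_neg h1, h2, ← ed, hcA, add_zero]
          · rw [if_neg h2, if_neg h1, add_zero]
            by_cases h3 : n < d
            · exact hch n h3 h1
            · exact Polynomial.coeff_eq_zero_of_natDegree_lt (by omega)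
      have fe : f = Polynomial.C (-B) + Polynomial.C k * Polynomial.X ^ a := by
        ext n
        simp only [Polynomial.coeff_add, Polynomial.coeff_C_mul_X_pow, Polynomial.coeff_C]
        by_cases h1 : n = a
        · rw [if_neg (by omega), if_pos h1, h1, zero_add]
        · by_cases h2 : n = 0
          · rw [if_pos h2, if_neg h1, h2, hfB, add_zero]
          · rw [if_neg h2, if_neg h1, add_zero]
            exact hfl n (Nat.pos_of_ne_zero h2) h1
      have ee : e = Polynomial.C (y + k) * Polynomial.X ^ a := by
        rw [eq_C_mul_X_pow_of_le (p := e) (by omega), i1, Polynomial.leadingCoeff, i1, e1]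
      have h3 : A * B * (w * y + z * k) = (y + k) * (A * B + y * k) := by
        have h4 := congrArg (Polynomial.coeff · (d + a)) hprod
        rw [mul_assoc, mul_comm (Polynomial.X ^ d), Polynomial.coeff_C_mul, add_comm d a,
          Polynomial.coeff_mul_X_pow] at h4
        rw [hg a, if_neg (by omega), if_neg (by omega), ← hy, ← hk] at h4
        have h5 : c * e * f = (Polynomial.C (-(A * k)) * Polynomial.X ^ (2 * a) +
            Polynomial.C (A * B + y * k) * Polynomial.X ^ a + Polynomial.C (-(y * B))) *
            Polynomial.C (y + k) * Polynomial.X ^ (2 * a) := by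
          rw [ce, ee, fe, two_mul, pow_add]
          simp only [map_add, map_neg, map_mul]
          ring
        rw [h5, ed, Polynomial.coeff_mul_X_pow, Polynomial.coeff_mul_C] at h4
        simp only [Polynomial.coeff_add, Polynomial.coeff_C_mul_X_pow, Polynomial.coeff_C] at h4
        rw [if_neg (by omega), if_pos trivial, if_neg (by omega)] at h4
        linear_combination h4
      apply hR
      have hABA : A * B * (A * B) ≠ 0 := mul_ne_zero hAB hAB
      apply mul_left_cancel₀ hABA
      linear_combination -(y + k) * h3 + (A * B * w - A * B - k * (y + k)) * hbot +
        (A * B * z - A * B - A * B * (z - v)) * htop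
    · have e2 : e.coeff c.natTrailingDegree = 0 := by
        rcases lt_or_gt_of_ne ha with h1 | h1
        · exact Polynomial.coeff_eq_zero_of_natDegree_lt (by omega)
        · exact Polynomial.coeff_eq_zero_of_lt_natTrailingDegree h1
      rw [e2] at e1
      rw [i1, hab] at htop
      apply hPQ'
      apply mul_left_cancel₀ hAB
      linear_combination -htop - hbot - e.coeff e.natTrailingDegree * e1

theorem forall_or_exists_unique_of_fin_three {Z : Fin 3 → Prop} (h : ∃ i, Z i) (h' : ¬ ∀ i, Z i) :
    (∃ k, ¬ Z k ∧ ∀ i, i ≠ k → Z i) ∨ ∃ i, Z i ∧ ∀ k, k ≠ i → ¬ Z k := by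
  classical
  have key : ∀ Y : Fin 3 → Bool, (∃ i, Y i = true) → (¬ ∀ i, Y i = true) →
      (∃ k, ¬ Y k = true ∧ ∀ i, i ≠ k → Y i = true) ∨
        ∃ i, Y i = true ∧ ∀ k, k ≠ i → ¬ Y k = true := by decide
  have := key fun i => decide (Z i)
  simp only [decide_eq_true_eq] at this
  exact this h h'

theorem exists_others (i : Fin 3) : ∃ j k : Fin 3, j ≠ i ∧ k ≠ i ∧ j ≠ k := by
  revert i; decide

theorem exists_third {i j : Fin 3} (h : i ≠ j) : ∃ k : Fin 3, k ≠ i ∧ k ≠ j := by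
  revert i j; decide

theorem IsConfiguration.coeff_l₃_ne_zero (h : IsConfiguration d l₁ l₂ l₃ m) {n : ℕ}
    (h₁ : l₁.coeff n = 0) (h₂ : l₂.coeff n ≠ 0) {i k : Fin 3} (hik : i ≠ k)
    (hi : (m i).coeff n = 0) (hk : (m k).coeff n = 0) : l₃.coeff n ≠ 0 := by
  obtain ⟨j, hji, hjk⟩ := exists_third hik
  obtain ⟨r₁, r₂, r₃, p₁, p₂, p₃, u, v, w, z, hN⟩ := h.exists_isNormal i j k hji.symm hik hjk
  intro h0
  have h1 := hN.coeff_l₃ n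
  rw [h₁, hi, hk, h0] at h1
  have h2 : v * (r₂ * l₂.coeff n) = 0 := by linear_combination -h1
  exact mul_ne_zero (discr_ne_zero_iff.1 hN.discr_ne_zero).2.1
    (mul_ne_zero hN.r₂_ne_zero h₂) h2

theorem IsConfiguration.not_forall_coeff_m (h : IsConfiguration d l₁ l₂ l₃ m) {n : ℕ}
    (h₁ : l₁.coeff n = 0) (h₂ : l₂.coeff n ≠ 0) : ¬ ∀ i, (m i).coeff n = 0 := by
  intro h0
  obtain ⟨r₁, r₂, r₃, p₁, p₂, p₃, u, v, w, z, hN⟩ :=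
    h.exists_isNormal 0 1 2 (by decide) (by decide) (by decide)
  have h1 := hN.coeff_m₂ n
  rw [h₁, h0, h0, h0] at h1
  exact mul_ne_zero hN.r₂_ne_zero h₂ (by linear_combination -h1)

theorem IsConfiguration.natTrailingDegree_eq (h : IsConfiguration d l₁ l₂ l₃ m) {i j k : Fin 3}
    (hij : i ≠ j) (hik : i ≠ k) (hjk : j ≠ k) :
    l₁.natTrailingDegree + l₂.natTrailingDegree + l₃.natTrailingDegree =
      (m i).natTrailingDegree + (m j).natTrailingDegree + (m k).natTrailingDegree := by
  have h0 := h.l_ne_zero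
  have h1 := h.prod_eq i j k hij hik hjk
  rw [← natTrailingDegree_mul_three h0, h1, natTrailingDegree_mul_three (h1 ▸ h0)]

theorem IsConfiguration.natDegree_eq (h : IsConfiguration d l₁ l₂ l₃ m) {i j k : Fin 3}
    (hij : i ≠ j) (hik : i ≠ k) (hjk : j ≠ k) :
    l₁.natDegree + l₂.natDegree + l₃.natDegree =
      (m i).natDegree + (m j).natDegree + (m k).natDegree := by
  have h0 := h.l_ne_zero
  have h1 := h.prod_eq i j k hij hik hjk
  rw [← natDegree_mul_three h0, h1, natDegree_mul_three (h1 ▸ h0)]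

theorem IsConfiguration.exists_coeff_zero (h : IsConfiguration d l₁ l₂ l₃ m)
    (h₁ : l₁.coeff 0 = 0) : ∃ i, (m i).coeff 0 = 0 := by
  have h1 := congrArg (Polynomial.coeff · 0)
    (h.prod_eq 0 1 2 (by decide) (by decide) (by decide))
  simp only [Polynomial.mul_coeff_zero, h₁, zero_mul] at h1
  rcases mul_eq_zero.1 h1.symm with h1 | h1
  · rcases mul_eq_zero.1 h1 with h1 | h1
    exacts [⟨_, h1⟩, ⟨_, h1⟩]
  · exact ⟨_, h1⟩

theorem IsConfiguration.exists_coeff_top (h : IsConfiguration d l₁ l₂ l₃ m)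
    (hlt : l₁.natDegree + l₂.natDegree < 2 * d) : ∃ i, (m i).coeff d = 0 := by
  by_contra! h0
  have h1 := h.natDegree_eq (i := 0) (j := 1) (k := 2) (by decide) (by decide) (by decide)
  have h2 := fun i => natDegree_eq_of_coeff (h.natDegree_m i) (h0 i)
  have h3 := h.natDegree_l₃
  rw [h2, h2, h2] at h1
  omega

variable {c₁ c₂ : K}

/-- If `l₁` and `l₂` have zeros only at `0` and only at `∞`, respectively, then one of the `m i` is
proportional to one of them. -/
theorem IsConfiguration.exists_eq_C_mul_of_opposite (h : IsConfiguration d l₁ l₂ l₃ m) (hd : 0 < d)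
    (hl₁ : l₁ = Polynomial.C c₁ * Polynomial.X ^ d) (hl₂ : l₂ = Polynomial.C c₂) :
    ∃ i c, m i = Polynomial.C c * l₁ ∨ m i = Polynomial.C c * l₂ := by
  have hl := h.l_ne_zero
  have hc₁ : c₁ ≠ 0 := by
    rintro rfl
    simp [hl₁] at hl
  have hc₂ : c₂ ≠ 0 := by
    rintro rfl
    simp [hl₂] at hl
  have hl₁n : ∀ n, l₁.coeff n = if n = d then c₁ else 0 := fun n => by
    rw [hl₁, Polynomial.coeff_C_mul_X_pow]
  have hl₂n : ∀ n, l₂.coeff n = if n = 0 then c₂ else 0 := fun n => by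
    rw [hl₂, Polynomial.coeff_C]
  have hl₁0 : l₁.coeff 0 = 0 := by rw [hl₁n, if_neg hd.ne]
  have hl₁d : l₁.coeff d ≠ 0 := by rwa [hl₁n, if_pos rfl]
  have hl₂0 : l₂.coeff 0 ≠ 0 := by rwa [hl₂n, if_pos rfl]
  have hl₂d : l₂.coeff d = 0 := by rw [hl₂n, if_neg hd.ne']
  have hdeg₁ : l₁.natDegree = d := by rw [hl₁, Polynomial.natDegree_C_mul_X_pow _ _ hc₁]
  have hdeg₂ : l₂.natDegree = 0 := by rw [hl₂, Polynomial.natDegree_C]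
  have hord₁ : l₁.natTrailingDegree = d := by
    rw [hl₁, Polynomial.C_mul_X_pow_eq_monomial, Polynomial.natTrailingDegree_monomial hc₁]
  have hord₂ : l₂.natTrailingDegree = 0 := by rw [hl₂, Polynomial.natTrailingDegree_C]
  have hdeg₃ := h.natDegree_l₃
  rcases forall_or_exists_unique_of_fin_three (h.exists_coeff_zero hl₁0)
    (h.not_forall_coeff_m hl₁0 hl₂0) with ⟨k, hk, hk'⟩ | ⟨i, hi, hi'⟩
  swap
  · -- The only linear form of the second triangle which vanishes at `0` does so to order `d`.
    obtain ⟨j, k, hj, hk, hjk⟩ := exists_others i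
    have h1 := h.natTrailingDegree_eq hj.symm hk.symm hjk
    rw [natTrailingDegree_eq_zero_of_coeff (hi' j hj),
      natTrailingDegree_eq_zero_of_coeff (hi' k hk), hord₁, hord₂] at h1
    have h2 := h.natDegree_m i
    have h3 := Polynomial.natTrailingDegree_le_natDegree (m i)
    refine ⟨i, (m i).leadingCoeff / c₁, Or.inl ?_⟩
    rw [hl₁, ← mul_assoc, ← Polynomial.C_mul, div_mul_cancel₀ _ hc₁,
      show d = (m i).natDegree by omega]
    exact eq_C_mul_X_pow_of_le (by omega)
  rcases forall_or_exists_unique_of_fin_three (h.exists_coeff_top (by omega))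
    (h.swap.not_forall_coeff_m hl₂d hl₁d) with ⟨k', hk₁, hk₁'⟩ | ⟨i, hi, hi'⟩
  swap
  · obtain ⟨j, k, hj, hk, hjk⟩ := exists_others i
    have h1 := h.natDegree_eq hj.symm hk.symm hjk
    rw [natDegree_eq_of_coeff (h.natDegree_m j) (hi' j hj),
      natDegree_eq_of_coeff (h.natDegree_m k) (hi' k hk), hdeg₁, hdeg₂] at h1
    refine ⟨i, (m i).coeff 0 / c₂, Or.inr ?_⟩
    rw [hl₂, ← Polynomial.C_mul, div_mul_cancel₀ _ hc₂]
    exact Polynomial.eq_C_of_natDegree_eq_zero (by omega)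
  exfalso
  by_cases hkk : k = k'
  · subst hkk
    obtain ⟨i, j, hi, hj, hij⟩ := exists_others k
    have ho := h.natTrailingDegree_eq hij hi hj
    have he := h.natDegree_eq hij hi hj
    rw [natTrailingDegree_eq_zero_of_coeff hk, hord₁, hord₂, natTrailingDegree_eq_zero_of_coeff
      (h.coeff_l₃_ne_zero hl₁0 hl₂0 hij (hk' i hi) (hk' j hj))] at ho
    rw [natDegree_eq_of_coeff (h.natDegree_m k) hk₁, hdeg₁, hdeg₂, natDegree_eq_of_coeff hdeg₃
      (h.swap.coeff_l₃_ne_zero hl₂d hl₁d hij (hk₁' i hi) (hk₁' j hj))] at he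
    have hi2 := Polynomial.natTrailingDegree_le_natDegree (m i)
    have hj2 := Polynomial.natTrailingDegree_le_natDegree (m j)
    obtain ⟨r₁, r₂, r₃, p₁, p₂, p₃, u, v, w, z, hN⟩ :=
      h.exists_isNormal i k j hi hij hj.symm
    obtain ⟨t, ht⟩ := hN.exists_coeff_l₃_eq (c₁ := c₁ * c₂)
      (c₂ := (m i).leadingCoeff * (m j).leadingCoeff) (Q := Polynomial.X ^ d)
      (h.prod_eq i k j hi hij hj.symm) (pow_ne_zero _ Polynomial.X_ne_zero) (mul_ne_zero hc₁ hc₂)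
      (by rw [hl₁, hl₂, Polynomial.C_mul]; ring) (by
        rw [eq_C_mul_X_pow_of_le (p := m i) (by omega), eq_C_mul_X_pow_of_le (p := m j) (by omega),
          show d = (m i).natDegree + (m j).natDegree by omega, pow_add, Polynomial.C_mul]
        simp only [Polynomial.leadingCoeff_C_mul_X_pow]
        ring)
    have h0 := ht 0
    have h1 := ht d
    rw [hk' i hi, hk' j hj, hl₁0] at h0
    rw [hk₁' i hi, hk₁' j hj, hl₂d] at h1
    have hv : v = t := by
      apply mul_right_cancel₀ (mul_ne_zero hN.r₂_ne_zero hl₂0)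
      linear_combination h0
    have hu : u = t := by
      apply mul_right_cancel₀ (mul_ne_zero hN.r₁_ne_zero hl₁d)
      linear_combination h1
    exact (discr_ne_zero_iff.1 hN.discr_ne_zero).2.2.1 (hu.trans hv.symm)
  · obtain ⟨j, hjk, hjk'⟩ := exists_third hkk
    obtain ⟨r₁, r₂, r₃, p₁, p₂, p₃, u, v, w, z, hN⟩ :=
      h.exists_isNormal k' j k hjk'.symm (Ne.symm hkk) hjk
    have hle : ∀ (c : K) {p : Polynomial K}, p.natDegree ≤ d →
        (Polynomial.C c * p).natDegree ≤ d := fun c p hp =>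
      (Polynomial.natDegree_C_mul_le c p).trans hp
    refine false_of_discr_ne_zero (A := r₁ * c₁) (B := r₂ * c₂) (c := Polynomial.C p₁ * m k')
      (e := Polynomial.C p₂ * m j) (f := Polynomial.C p₃ * m k) (g := Polynomial.C r₃ * l₃)
      hd hN.discr_ne_zero (mul_ne_zero hN.r₁_ne_zero hc₁) (mul_ne_zero hN.r₂_ne_zero hc₂)
      (fun n => ?_) (fun n => ?_) ?_
      (mul_ne_zero (Polynomial.C_ne_zero.2 hN.p₂_ne_zero) (h.m_ne_zero j))
      (mul_ne_zero (Polynomial.C_ne_zero.2 hN.p₃_ne_zero) (h.m_ne_zero k))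
      (hle _ (h.natDegree_m _)) (hle _ (h.natDegree_m _)) (hle _ hdeg₃) (hle _ (h.natDegree_m _))
      ?_ ?_ ?_ ?_ ?_ ?_
    · simp only [Polynomial.coeff_C_mul, hN.coeff_m₂, hl₁n, hl₂n, mul_ite, mul_zero]
    · simp only [Polynomial.coeff_C_mul, hN.coeff_l₃, hl₁n, hl₂n, mul_ite, mul_zero]
    · have h1 := h.prod_eq k' j k hjk'.symm (Ne.symm hkk) hjk
      have h2 := congrArg Polynomial.C hN.prod_eq
      rw [hl₁, hl₂] at h1
      simp only [map_mul] at h2 ⊢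
      linear_combination (Polynomial.C r₁ * Polynomial.C r₂ * Polynomial.C r₃) * h1 +
        (m k' * m j * m k) * h2
    · rw [Polynomial.coeff_C_mul, hk' k' (Ne.symm hkk), mul_zero]
    · rw [Polynomial.coeff_C_mul, hk' j hjk, mul_zero]
    · rw [Polynomial.coeff_C_mul, hk₁' j hjk', mul_zero]
    · rw [Polynomial.coeff_C_mul, hk₁' k hkk, mul_zero]
    · rw [Polynomial.coeff_C_mul]
      exact mul_ne_zero hN.r₃_ne_zero (h.coeff_l₃_ne_zero hl₁0 hl₂0 hjk' (hk' j hjk)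
        (hk' k' (Ne.symm hkk)))
    · rw [Polynomial.coeff_C_mul]
      exact mul_ne_zero hN.r₃_ne_zero (h.swap.coeff_l₃_ne_zero hl₂d hl₁d hjk (hk₁' j hjk')
        (hk₁' k hkk))

/-- If `l₁` and `l₂` have zeros only at `0` and `∞`, then one of the `m i` is proportional to one of
them. At each of the two parameters at most four of the six forms vanish; counting orders of
vanishing shows that the zeros of `l₁` and `l₂` are opposite, unless the moduli are special. -/
theorem IsConfiguration.exists_eq_C_mul (h : IsConfiguration d l₁ l₂ l₃ m) (hd : 0 < d) {p q : ℕ}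
    (hp : p ≤ d) (hq : q ≤ d) (hl₁ : l₁ = Polynomial.C c₁ * Polynomial.X ^ p)
    (hl₂ : l₂ = Polynomial.C c₂ * Polynomial.X ^ q) :
    ∃ i c, m i = Polynomial.C c * l₁ ∨ m i = Polynomial.C c * l₂ := by
  have hl := h.l_ne_zero
  have hc₁ : c₁ ≠ 0 := by
    rintro rfl
    simp [hl₁] at hl
  have hc₂ : c₂ ≠ 0 := by
    rintro rfl
    simp [hl₂] at hl
  have hl₁n : ∀ n, n ≠ p → l₁.coeff n = 0 := fun n hn => by
    rw [hl₁, Polynomial.coeff_C_mul_X_pow, if_neg hn]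
  have hl₂n : ∀ n, n ≠ q → l₂.coeff n = 0 := fun n hn => by
    rw [hl₂, Polynomial.coeff_C_mul_X_pow, if_neg hn]
  have hdeg₁ : l₁.natDegree = p := by rw [hl₁, Polynomial.natDegree_C_mul_X_pow _ _ hc₁]
  have hdeg₂ : l₂.natDegree = q := by rw [hl₂, Polynomial.natDegree_C_mul_X_pow _ _ hc₂]
  have hord₁ : l₁.natTrailingDegree = p := by
    rw [hl₁, Polynomial.C_mul_X_pow_eq_monomial, Polynomial.natTrailingDegree_monomial hc₁]
  have hord₂ : l₂.natTrailingDegree = q := by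
    rw [hl₂, Polynomial.C_mul_X_pow_eq_monomial, Polynomial.natTrailingDegree_monomial hc₂]
  have hdeg₃ := h.natDegree_l₃
  have hinf : p < d → q < d →
      ∃ j, p + q + l₃.natDegree = (m j).natDegree + 2 * d := by
    intro hpd hqd
    obtain ⟨j, hj⟩ := h.exists_coeff_top (by omega)
    have hj' : ∀ k, k ≠ j → (m k).coeff d ≠ 0 := fun k hk h0 =>
      h.ne_at d (Or.inr rfl) k j hk (hl₁n d hpd.ne') (hl₂n d hqd.ne') h0 hj
    obtain ⟨k, i, hk, hi, hki⟩ := exists_others j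
    have h1 := h.natDegree_eq hk.symm hi.symm hki
    rw [natDegree_eq_of_coeff (h.natDegree_m k) (hj' k hk),
      natDegree_eq_of_coeff (h.natDegree_m i) (hj' i hi), hdeg₁, hdeg₂] at h1
    exact ⟨j, by omega⟩
  by_cases hpq : p = 0 ∨ q = 0
  · by_cases hpd : p < d
    · by_cases hqd : q < d
      · obtain ⟨j, hj⟩ := hinf hpd hqd
        omega
      · obtain ⟨i, c, hi⟩ := h.swap.exists_eq_C_mul_of_opposite hd (c₁ := c₂) (c₂ := c₁)
          (by rw [hl₂, show q = d by omega]) (by rw [hl₁, show p = 0 by omega]; simp)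
        exact ⟨i, c, hi.symm⟩
    · exact h.exists_eq_C_mul_of_opposite hd (c₁ := c₁) (c₂ := c₂)
        (by rw [hl₁, show p = d by omega]) (by rw [hl₂, show q = 0 by omega]; simp)
  · exfalso
    obtain ⟨i, hi⟩ := h.exists_coeff_zero (hl₁n 0 (by omega))
    have hi' : ∀ k, k ≠ i → (m k).coeff 0 ≠ 0 := fun k hk h0 =>
      h.ne_at 0 (Or.inl rfl) k i hk (hl₁n 0 (by omega)) (hl₂n 0 (by omega)) h0 hi
    obtain ⟨j, k, hj, hk, hjk⟩ := exists_others i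
    have h1 := h.natTrailingDegree_eq hj.symm hk.symm hjk
    rw [natTrailingDegree_eq_zero_of_coeff (hi' j hj),
      natTrailingDegree_eq_zero_of_coeff (hi' k hk), hord₁, hord₂] at h1
    have h2 := h.natDegree_m i
    have h3 := Polynomial.natTrailingDegree_le_natDegree (m i)
    obtain ⟨j, hj⟩ := hinf (by omega) (by omega)
    have hij : i ≠ j := by
      rintro rfl
      omega
    obtain ⟨k, hki, hkj⟩ := exists_third hij
    obtain ⟨r₁, r₂, r₃, p₁, p₂, p₃, u, v, w, z, hN⟩ :=
      h.exists_isNormal i k j hki.symm hij hkj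
    have ei : m i = Polynomial.C (m i).leadingCoeff * Polynomial.X ^ d := by
      rw [show d = (m i).natDegree by omega]
      exact eq_C_mul_X_pow_of_le (by omega)
    have ej : m j = Polynomial.C ((m j).coeff 0) :=
      Polynomial.eq_C_of_natDegree_eq_zero (by omega)
    obtain ⟨t, ht⟩ := hN.exists_coeff_l₃_eq (c₁ := c₁ * c₂)
      (c₂ := (m i).leadingCoeff * (m j).coeff 0) (Q := Polynomial.X ^ d)
      (h.prod_eq i k j hki.symm hij hkj) (pow_ne_zero _ Polynomial.X_ne_zero) (mul_ne_zero hc₁ hc₂)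
      (by rw [hl₁, hl₂, Polynomial.C_mul, show d = p + q by omega, pow_add]; ring)
      (by conv_lhs => rw [ei, ej]
          rw [Polynomial.C_mul]; ring)
    have h4 := ht 0
    have h5 := ht d
    rw [hi, hl₁n 0 (by omega), hl₂n 0 (by omega)] at h4
    rw [hl₁n d (by omega), hl₂n d (by omega),
      Polynomial.coeff_eq_zero_of_natDegree_lt (p := m j) (by omega)] at h5
    have hz : z = t := by
      apply mul_right_cancel₀ (mul_ne_zero hN.p₃_ne_zero (hi' j hij.symm))
      linear_combination h4
    have hw : w = t := by
      have : (m i).coeff d ≠ 0 := by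
        rw [show d = (m i).natDegree by omega]
        exact Polynomial.leadingCoeff_ne_zero.2 (h.m_ne_zero i)
      apply mul_right_cancel₀ (mul_ne_zero hN.p₁_ne_zero this)
      linear_combination h5
    exact (discr_ne_zero_iff.1 hN.discr_ne_zero).2.2.2.1 (hw.trans hz.symm)

end TorusCurve

/-! ### Rational plane curves contained in a conic -/

section PlaneCurves

variable {K : Type*} [Field K]

theorem exists_eq_smul_cross {a b x : Fin 3 → K} (hab : LinearIndependent K ![a, b])
    (ha : a ⬝ᵥ x = 0) (hb : b ⬝ᵥ x = 0) : ∃ c : K, x = c • crossProduct a b := by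
  have h1 : crossProduct (crossProduct a b) x = 0 := by
    rw [cross_cross_eq_smul_sub_smul, ha, hb, zero_smul, zero_smul, sub_zero]
  have h2 : crossProduct a b ≠ 0 := crossProduct_ne_zero_iff_linearIndependent.2 hab
  have h3 := crossProduct_ne_zero_iff_linearIndependent.not_right.1 h1
  rw [LinearIndependent.pair_iff' h2] at h3
  push Not at h3
  exact h3.imp fun _ h => h.symm

/-- A point of a line in the plane is cut out on the line by a linear form. -/
theorem exists_dotProduct_eq_zero_imp {a y : Fin 3 → K} (ha : a ≠ 0) (hy : y ≠ 0)
    (hay : a ⬝ᵥ y = 0) : ∃ b : Fin 3 → K, b ⬝ᵥ y = 0 ∧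
      ∀ x, a ⬝ᵥ x = 0 → b ⬝ᵥ x = 0 → ∃ c : K, x = c • y := by
  obtain ⟨b, hb, hab⟩ : ∃ b : Fin 3 → K, b ⬝ᵥ y = 0 ∧ LinearIndependent K ![a, b] := by
    obtain ⟨b₁, b₂, hb, hb₁, hb₂⟩ := exists_pair_dotProduct_eq_zero le_rfl y
    by_contra! h
    have h1 := h b₁ (by rw [dotProduct_comm, hb₁])
    have h2 := h b₂ (by rw [dotProduct_comm, hb₂])
    rw [LinearIndependent.pair_iff' ha] at h1 h2
    push Not at h1 h2
    obtain ⟨s, rfl⟩ := h1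
    obtain ⟨t, rfl⟩ := h2
    have h3 := LinearIndependent.pair_iff.1 hb t (-s) (by module)
    rw [neg_eq_zero] at h3
    exact hb.ne_zero 0 (by simp [h3.2])
  refine ⟨b, hb, fun x hax hbx => ?_⟩
  obtain ⟨c, rfl⟩ := exists_eq_smul_cross hab hax hbx
  obtain ⟨c', hc'⟩ := exists_eq_smul_cross hab hay hb
  have h0 : c' ≠ 0 := by
    rintro rfl
    exact hy (by rw [hc', zero_smul])
  exact ⟨c / c', by rw [hc', smul_smul, div_mul_cancel₀ _ h0]⟩

theorem exists_two_mul_eval_eq {n : ℕ} {q : MvPolynomial (Fin n) K} (hq : q.IsHomogeneous 2) :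
    ∃ B : Matrix (Fin n) (Fin n) K, ∀ x, 2 * eval x q = x ⬝ᵥ B.mulVec x := by
  choose b hb using fun i => exists_eq_lin (hq.pderiv (i := i))
  refine ⟨Matrix.of b, fun x => ?_⟩
  have h1 := congrArg (eval x) hq.sum_X_mul_pderiv
  simp only [map_sum, map_mul, eval_X, nsmul_eq_mul, map_natCast, hb, eval_lin] at h1
  rw [← Nat.cast_two, ← h1]
  rfl

theorem IsGivenBy.exists_eq_of_degree_eq_zero {m : ℕ} {g : PSpace K 1 → PSpace K m}
    {γ : Fin (m + 1) → MvPolynomial (Fin 2) K} (hg : IsGivenBy Set.univ g 0 γ) :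
    ∃ p, ∀ t, g t = p := by
  have h1 : ∀ v w, evalForms γ v = evalForms γ w := by
    intro v w
    ext i
    have h2 := (totalDegree_zero_iff_isHomogeneous _).2 (hg.homog i)
    rw [totalDegree_eq_zero_iff_eq_C] at h2
    rw [evalForms_apply, evalForms_apply, h2, eval_C, eval_C]
  have hv : (![1, 0] : Fin 2 → K) ≠ 0 := fun h => by simpa using congrFun h 0
  refine ⟨Projectivization.mk K _ (hg.ne_zero _ hv trivial), fun t => ?_⟩
  induction t using Projectivization.ind with | h w hw => ?_
  rw [hg.eq_mk w hw trivial (hg.ne_zero w hw trivial)]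
  exact mk_eq_mk_of_smul _ _ 1 (by rw [one_smul]; exact h1 _ _)

/-- The composition of a regular map with a regular map on a locus is regular. -/
theorem IsGivenBy.isRegularOn_comp {d m k : ℕ} {f : PSpace K 1 → PSpace K m}
    {φ : Fin (m + 1) → MvPolynomial (Fin 2) K} (hf : IsGivenBy Set.univ f d φ)
    {Z : Set (PSpace K m)} (hZ : ∀ t, f t ∈ Z) {π : PSpace K m → PSpace K k}
    (hπ : IsRegularOn Z π) : IsRegularOn Set.univ fun t => π (f t) := by
  intro p _
  have key : ∀ t : PSpace K 1, ∃ h : evalForms φ t.rep ≠ 0, f t = Projectivization.mk K _ h := by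
    intro t
    have h := hf.ne_zero t.rep t.rep_nonzero trivial
    refine ⟨h, ?_⟩
    rw [← hf.eq_mk t.rep t.rep_nonzero trivial h, Projectivization.mk_rep]
  obtain ⟨h0, hp⟩ := key p
  obtain ⟨e, ψ, hψ, hψ0, hψe⟩ := hπ.exists_local _ h0 (hp ▸ hZ p)
  have hval : ∀ q : PSpace K 1, evalForms (fun i => bind₁ φ (ψ i)) q.rep =
      evalForms ψ (evalForms φ q.rep) := fun q => funext fun i => eval_bind₁ φ (ψ i) q.rep
  refine ⟨d * e, fun i => bind₁ φ (ψ i), fun i => isHomogeneous_bind₁ hf.homog (hψ i), ?_, ?_⟩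
  · change evalForms (fun i => bind₁ φ (ψ i)) p.rep ≠ 0
    rw [hval]
    exact hψ0
  · intro q _ (hq : evalForms (fun i => bind₁ φ (ψ i)) q.rep ≠ 0)
    change π (f q) = Projectivization.mk K (evalForms (fun i => bind₁ φ (ψ i)) q.rep) hq
    obtain ⟨h1, hq1⟩ := key q
    have h2 : evalForms ψ (evalForms φ q.rep) ≠ 0 := by rwa [← hval]
    rw [hq1, hψe _ h1 (hq1 ▸ hZ q) h2]
    exact mk_eq_mk_of_smul _ _ 1 (by rw [one_smul, hval])

variable [IsAlgClosed K]

/-- An irreducible conic contains no line. -/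
theorem false_of_line_subset_conic {q : MvPolynomial (Fin 3) K} (hq : q.IsHomogeneous 2)
    (hirr : Irreducible q) {x y : Fin 3 → K} (hxy : LinearIndependent K ![x, y])
    (h : ∀ s t : K, eval (s • x + t • y) q = 0) : False := by
  have ha : lin (crossProduct x y) ≠ 0 :=
    lin_eq_zero.not.2 (crossProduct_ne_zero_iff_linearIndependent.2 hxy)
  have h1 := irreducible_of_isHomogeneous_one (isHomogeneous_lin _) ha
  have h2 : lin (crossProduct x y) ∣ q := by
    refine dvd_of_forall_eval_eq_zero h1 fun v hv => ?_
    rw [eval_lin] at hv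
    obtain ⟨s, t, rfl⟩ := exists_eq_add_of_cross_dotProduct hxy hv
    exact h s t
  obtain ⟨u, hu⟩ := h1.associated_of_dvd hirr h2
  have h3 := (isHomogeneous_lin (crossProduct x y)).totalDegree ha
  have h4 := hq.totalDegree hirr.ne_zero
  have h5 := (isUnit_iff_totalDegree_of_isReduced.1 u.isUnit).2
  rw [← hu, totalDegree_mul_of_isDomain ha u.ne_zero] at h4
  omega

/-- A point of an irreducible conic is cut out on it by a linear form, the equation of the tangent
line. -/
theorem exists_tangent [CharZero K] {q : MvPolynomial (Fin 3) K} (hq : q.IsHomogeneous 2)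
    (hirr : Irreducible q) {y : Fin 3 → K} (hy : y ≠ 0) (hqy : eval y q = 0) :
    ∃ b : Fin 3 → K, ∀ x, eval x q = 0 → b ⬝ᵥ x = 0 → ∃ c : K, x = c • y := by
  obtain ⟨B, hB⟩ := exists_two_mul_eval_eq hq
  have h2 : (2 : K) ≠ 0 := two_ne_zero
  refine ⟨B.mulVec y + Matrix.vecMul y B, fun x hqx hbx => ?_⟩
  by_contra! hx
  refine false_of_line_subset_conic hq hirr (x := y) (y := x)
    ((LinearIndependent.pair_iff' hy).2 fun c hc => hx c hc.symm) fun s t => ?_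
  have hyx : y ⬝ᵥ B.mulVec x + x ⬝ᵥ B.mulVec y = 0 := by
    rw [add_dotProduct, ← Matrix.dotProduct_mulVec, dotProduct_comm] at hbx
    rw [add_comm, hbx]
  apply mul_left_cancel₀ h2
  have e1 := hB y
  have e2 := hB x
  rw [hqy] at e1
  rw [hqx] at e2
  rw [hB, Matrix.mulVec_add, Matrix.mulVec_smul, Matrix.mulVec_smul]
  simp only [add_dotProduct, dotProduct_add, smul_dotProduct, dotProduct_smul, smul_eq_mul]
  linear_combination s * t * hyx - s ^ 2 * e1 - t ^ 2 * e2

theorem IsGivenBy.exists_eval_eq_zero {m n k : ℕ} {g : PSpace K 1 → PSpace K m}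
    {γ : Fin (m + 1) → MvPolynomial (Fin 2) K} (hg : IsGivenBy Set.univ g n γ) (hn : n ≠ 0)
    {q : MvPolynomial (Fin (m + 1)) K} (hq : q.IsHomogeneous k) (hk : k ≠ 0) :
    ∃ v, v ≠ 0 ∧ eval (evalForms γ v) q = 0 := by
  obtain ⟨a, b, hab, h⟩ := exists_zero_on_line (isHomogeneous_bind₁ hg.homog hq)
    (mul_ne_zero hn hk) ![1, 0] ![0, 1]
  refine ⟨_, fun h0 => ?_, by rwa [eval_bind₁] at h⟩
  have h1 := congrFun h0 0
  have h2 := congrFun h0 1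
  simp at h1 h2
  tauto

theorem IsGivenBy.range_eq_zeroLocus {n k : ℕ} {g : PSpace K 1 → PSpace K 2}
    {γ : Fin 3 → MvPolynomial (Fin 2) K} (hg : IsGivenBy Set.univ g n γ) (hn : n ≠ 0)
    {q : MvPolynomial (Fin 3) K} (hq : q.IsHomogeneous k) (h0 : bind₁ γ q = 0)
    (h : ∀ y, y ≠ 0 → eval y q = 0 →
      ∃ b : Fin 3 → K, ∀ x, eval x q = 0 → b ⬝ᵥ x = 0 → ∃ c : K, x = c • y) :
    Set.range g = zeroLocus q := by
  have hv : ∀ v, eval (evalForms γ v) q = 0 := fun v => by rw [← eval_bind₁, h0, map_zero]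
  ext p
  induction p using Projectivization.ind with | h y hy => ?_
  constructor
  · rintro ⟨t, ht⟩
    induction t using Projectivization.ind with | h v hv0 => ?_
    rw [← ht, hg.eq_mk v hv0 trivial (hg.ne_zero v hv0 trivial)]
    exact (vanishesAt_mk hq _).2 (hv v)
  · intro hyq
    obtain ⟨b, hb⟩ := h y hy ((vanishesAt_mk hq hy).1 hyq)
    obtain ⟨v, hv0, hbv⟩ := hg.exists_eval_eq_zero hn (isHomogeneous_lin b) one_ne_zero
    rw [eval_lin] at hbv
    obtain ⟨c, hc⟩ := hb _ (hv v) hbv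
    refine ⟨Projectivization.mk K v hv0, ?_⟩
    rw [hg.eq_mk v hv0 trivial (hg.ne_zero v hv0 trivial)]
    exact mk_eq_mk_of_smul _ _ c hc

theorem IsGivenBy.isPlaneCurve_one {n : ℕ} {g : PSpace K 1 → PSpace K 2}
    {γ : Fin 3 → MvPolynomial (Fin 2) K} (hg : IsGivenBy Set.univ g n γ) (hn : n ≠ 0)
    {q : MvPolynomial (Fin 3) K} (hq : q.IsHomogeneous 1) (hq0 : q ≠ 0) (h0 : bind₁ γ q = 0) :
    IsPlaneCurveOfDegree (Set.range g) 1 := by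
  refine ⟨q, hq, irreducible_of_isHomogeneous_one hq hq0,
    hg.range_eq_zeroLocus hn hq h0 fun y hy hqy => ?_⟩
  obtain ⟨a, rfl⟩ := exists_eq_lin hq
  simp only [eval_lin] at hqy ⊢
  obtain ⟨b, -, hb⟩ := exists_dotProduct_eq_zero_imp (lin_eq_zero.not.1 hq0) hy hqy
  exact ⟨b, hb⟩

/-- A nonconstant rational curve which satisfies a quadratic equation is a line or a conic. -/
theorem IsGivenBy.exists_isPlaneCurve [CharZero K] {n : ℕ} {g : PSpace K 1 → PSpace K 2}
    {γ : Fin 3 → MvPolynomial (Fin 2) K} (hg : IsGivenBy Set.univ g n γ) (hn : n ≠ 0)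
    {q : MvPolynomial (Fin 3) K} (hq : q.IsHomogeneous 2) (hq0 : q ≠ 0) (h0 : bind₁ γ q = 0) :
    ∃ d ≤ 2, IsPlaneCurveOfDegree (Set.range g) d := by
  by_cases hirr : Irreducible q
  · exact ⟨2, le_rfl, q, hq, hirr, hg.range_eq_zeroLocus hn hq h0 fun y hy hqy =>
      exists_tangent hq hirr hy hqy⟩
  refine ⟨1, one_le_two, ?_⟩
  have hu : ¬ IsUnit q := by
    intro hu
    have h1 := (isUnit_iff_totalDegree_of_isReduced.1 hu).2
    rw [hq.totalDegree hq0] at h1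
    omega
  obtain ⟨a, ha, b, hb, hab⟩ : ∃ a, ¬ IsUnit a ∧ ∃ b, ¬ IsUnit b ∧ q = a * b := by
    rw [irreducible_iff] at hirr
    push Not at hirr
    obtain ⟨a, b, h1, h2, h3⟩ := hirr hu
    exact ⟨a, h2, b, h3, h1⟩
  subst hab
  have ha0 := left_ne_zero_of_mul hq0
  have hb0 := right_ne_zero_of_mul hq0
  obtain ⟨k, hk⟩ := isHomogeneous_of_mul hq hq0
  obtain ⟨l, hl⟩ := isHomogeneous_of_dvd hq hq0 (Dvd.intro_left a rfl)
  have hkl : k + l = 2 := (hk.mul hl).inj_right hq hq0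
  have hk0 : k ≠ 0 := by
    rintro rfl
    exact ha (isUnit_of_isHomogeneous_zero hk ha0)
  have hl0 : l ≠ 0 := by
    rintro rfl
    exact hb (isUnit_of_isHomogeneous_zero hl hb0)
  obtain rfl : k = 1 := by omega
  obtain rfl : l = 1 := by omega
  rw [map_mul, mul_eq_zero] at h0
  rcases h0 with h0 | h0
  · exact hg.isPlaneCurve_one hn hk ha0 h0
  · exact hg.isPlaneCurve_one hn hl hb0 h0

/-- A nonconstant rational plane curve meets a finite set in finitely many points, hence a form
which vanishes on the rest of the parameter line vanishes. -/
theorem IsGivenBy.exists_eq_or_eq_zero {n : ℕ} {g : PSpace K 1 → PSpace K 2}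
    {γ : Fin 3 → MvPolynomial (Fin 2) K} (hg : IsGivenBy Set.univ g n γ) {ι : Type*} [Fintype ι]
    (P : ι → PSpace K 2) :
    (∃ p, ∀ t, g t = p) ∨ ∀ R : MvPolynomial (Fin 2) K,
      (∀ v (hv : v ≠ 0), g (Projectivization.mk K v hv) ∉ Set.range P → eval v R = 0) → R = 0 := by
  have : Infinite K := IsAlgClosed.instInfinite
  by_cases hP : ∀ i, ∃ a, a ⬝ᵥ (P i).rep = 0 ∧ bind₁ γ (lin a) ≠ 0
  · choose a ha ha0 using hP
    refine Or.inr fun R hR => ?_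
    have hR0 : X 0 * (R * ∏ i, bind₁ γ (lin (a i))) = 0 := by
      refine MvPolynomial.funext fun v => ?_
      by_cases hv : v = 0
      · simp [hv]
      by_cases hvP : g (Projectivization.mk K v hv) ∈ Set.range P
      · obtain ⟨i, hi⟩ := hvP
        have h0 := hg.ne_zero v hv trivial
        have h1 := hg.eq_mk v hv trivial h0
        rw [← hi] at h1
        obtain ⟨c, hc, hr⟩ := exists_rep_mk_eq_smul (K := K) h0
        have h2 := ha i
        rw [h1, hr, dotProduct_smul, smul_eq_mul, mul_eq_zero_iff_left hc] at h2
        rw [map_mul, map_mul, map_prod, Finset.prod_eq_zero (Finset.mem_univ i)]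
        · simp
        · rw [eval_bind₁, eval_lin, h2]
      · simp [hR v hv hvP]
    rcases mul_eq_zero.1 hR0 with h1 | h1
    · exact absurd h1 (X_ne_zero _)
    exact (mul_eq_zero.1 h1).resolve_right (Finset.prod_ne_zero_iff.2 fun i _ => ha0 i)
  · left
    push Not at hP
    obtain ⟨i, hi⟩ := hP
    refine ⟨P i, fun t => ?_⟩
    obtain ⟨a, b, hab, ha, hb⟩ := exists_pair_dotProduct_eq_zero le_rfl (P i).rep
    rw [dotProduct_comm] at ha hb
    induction t using Projectivization.ind with | h v hv => ?_
    have h0 := hg.ne_zero v hv trivial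
    have hz : ∀ a, a ⬝ᵥ (P i).rep = 0 → a ⬝ᵥ evalForms γ v = 0 := fun a ha => by
      rw [← eval_lin, ← eval_bind₁, hi a ha, map_zero]
    obtain ⟨c, hc⟩ := exists_eq_smul_cross hab ha hb
    obtain ⟨c', hc'⟩ := exists_eq_smul_cross hab (hz a ha) (hz b hb)
    have hc0 : c ≠ 0 := by
      rintro rfl
      exact (P i).rep_nonzero (by rw [hc, zero_smul])
    rw [hg.eq_mk v hv trivial h0, ← Projectivization.mk_rep (P i)]
    exact mk_eq_mk_of_smul _ _ (c' / c) (by rw [hc, hc', smul_smul, div_mul_cancel₀ _ hc0])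

end PlaneCurves

/-! ### The restriction of linear forms to a rational curve -/

section AlongCurve

variable {K : Type*} [Field K]

theorem natDegree_le_and_coeff_restrictLine_monomial {σ : Type*} (x y : σ → K) (s : σ →₀ ℕ) :
    (restrictLine x y (monomial s 1)).natDegree ≤ s.degree ∧
      (restrictLine x y (monomial s 1)).coeff s.degree = eval y (monomial s 1) := by
  induction s using Finsupp.induction_linear with
  | zero => simp [restrictLine]
  | add s t hs ht =>
    rw [show monomial (s + t) (1 : K) = monomial s 1 * monomial t 1 by
      rw [monomial_mul, one_mul], map_mul, map_mul, map_add]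
    exact ⟨Polynomial.natDegree_mul_le_of_le hs.1 ht.1,
      by rw [Polynomial.coeff_mul_add_eq_of_natDegree_le hs.1 ht.1, hs.2, ht.2]⟩
  | single i k =>
    have h1 : (Polynomial.C (x i) + Polynomial.X * Polynomial.C (y i)).natDegree ≤ 1 := by
      compute_degree
    rw [← X_pow_eq_monomial, map_pow, map_pow, eval_X, Finsupp.degree_single]
    have h2 : restrictLine x y (X i) = Polynomial.C (x i) + Polynomial.X * Polynomial.C (y i) := by
      simp [restrictLine]
    rw [h2]
    have h3 := Polynomial.coeff_pow_of_natDegree_le (m := k) h1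
    have h4 := Polynomial.natDegree_pow_le_of_le k h1
    rw [mul_one] at h3 h4
    exact ⟨h4, by rw [h3]; simp⟩

theorem natDegree_le_and_coeff_restrictLine {σ : Type*} (x y : σ → K) {p : MvPolynomial σ K}
    {n : ℕ} (hp : p.IsHomogeneous n) :
    (restrictLine x y p).natDegree ≤ n ∧ (restrictLine x y p).coeff n = eval y p := by
  have hterm : ∀ s ∈ p.support, (restrictLine x y (monomial s (p.coeff s))).natDegree ≤ n ∧
      (restrictLine x y (monomial s (p.coeff s))).coeff n = eval y (monomial s (p.coeff s)) := by
    intro s hs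
    obtain rfl : s.degree = n := by
      by_contra hne
      exact mem_support_iff.1 hs (hp.coeff_eq_zero hne)
    have h := natDegree_le_and_coeff_restrictLine_monomial x y s
    have h1 : monomial s (p.coeff s) = C (p.coeff s) * monomial s 1 := by
      rw [C_mul_monomial, mul_one]
    have h2 : restrictLine x y (C (p.coeff s)) = Polynomial.C (p.coeff s) := by
      simp [restrictLine]
    rw [h1, map_mul, map_mul, h2, eval_C, Polynomial.coeff_C_mul, h.2]
    exact ⟨(Polynomial.natDegree_C_mul_le _ _).trans h.1, rfl⟩
  rw [p.as_sum, map_sum, map_sum, Polynomial.finsetSum_coeff]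
  exact ⟨Polynomial.natDegree_sum_le_of_forall_le _ _ fun s hs => (hterm s hs).1,
    Finset.sum_congr rfl fun s hs => (hterm s hs).2⟩

theorem exists_eq_add_of_linearIndependent {x y : Fin 2 → K} (h : LinearIndependent K ![x, y])
    (v : Fin 2 → K) : ∃ a b : K, v = a • x + b • y := by
  have h1 := h.span_eq_top_of_card_eq_finrank (by simp)
  have h2 : v ∈ Submodule.span K (Set.range ![x, y]) := h1 ▸ Submodule.mem_top
  rw [Matrix.range_cons, Matrix.range_cons, Matrix.range_empty, Set.union_empty,
    Set.singleton_union, Submodule.mem_span_pair] at h2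
  obtain ⟨a, b, hab⟩ := h2
  exact ⟨a, b, hab.symm⟩

theorem eq_zero_of_restrictLine_eq_zero [Infinite K] {x y : Fin 2 → K}
    (hxy : LinearIndependent K ![x, y]) {p : MvPolynomial (Fin 2) K} {n : ℕ}
    (hp : p.IsHomogeneous n) (h : restrictLine x y p = 0) : p = 0 := by
  refine MvPolynomial.funext fun v => ?_
  rw [map_zero]
  obtain ⟨a, b, rfl⟩ := exists_eq_add_of_linearIndependent hxy v
  by_cases ha : a = 0
  · have h1 := (natDegree_le_and_coeff_restrictLine x y hp).2
    rw [h, Polynomial.coeff_zero] at h1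
    rw [ha, zero_smul, zero_add, eval_smul_of_isHomogeneous hp, ← h1, mul_zero]
  · have h1 := eval_restrictLine x y p (b / a)
    rw [h, Polynomial.eval_zero] at h1
    rw [show a • x + b • y = a • (x + (b / a) • y) by
      rw [smul_add, smul_smul, mul_div_cancel₀ _ ha], eval_smul_of_isHomogeneous hp, ← h1, mul_zero]

/-- The linear forms on projective space, restricted to the curve with parametrization
`t ↦ φ (x + t y)`. -/
noncomputable def alongCurve {n : ℕ} (φ : Fin n → MvPolynomial (Fin 2) K) (x y : Fin 2 → K) :
    (Fin n → K) →ₗ[K] Polynomial K where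
  toFun a := restrictLine x y (bind₁ φ (lin a))
  map_add' a b := by rw [lin_add, map_add, map_add]
  map_smul' c a := by
    rw [lin_smul, ← smul_eq_C_mul, map_smul, map_smul, RingHom.id_apply]

variable {n d : ℕ} {φ : Fin n → MvPolynomial (Fin 2) K} {x y : Fin 2 → K}

theorem eval_alongCurve (a : Fin n → K) (t : K) :
    (alongCurve φ x y a).eval t = a ⬝ᵥ evalForms φ (x + t • y) := by
  change (restrictLine x y (bind₁ φ (lin a))).eval t = _
  rw [eval_restrictLine, eval_bind₁, eval_lin]

theorem coeff_zero_alongCurve (a : Fin n → K) :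
    (alongCurve φ x y a).coeff 0 = a ⬝ᵥ evalForms φ x := by
  rw [Polynomial.coeff_zero_eq_eval_zero, eval_alongCurve, zero_smul, add_zero]

theorem natDegree_alongCurve (hφ : ∀ i, (φ i).IsHomogeneous d) (a : Fin n → K) :
    (alongCurve φ x y a).natDegree ≤ d := by
  have h := isHomogeneous_bind₁ hφ (isHomogeneous_lin a)
  rw [mul_one] at h
  exact (natDegree_le_and_coeff_restrictLine x y h).1

theorem coeff_alongCurve (hφ : ∀ i, (φ i).IsHomogeneous d) (a : Fin n → K) :
    (alongCurve φ x y a).coeff d = a ⬝ᵥ evalForms φ y := by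
  have h := isHomogeneous_bind₁ hφ (isHomogeneous_lin a)
  rw [mul_one] at h
  rw [← eval_lin, ← eval_bind₁]
  exact (natDegree_le_and_coeff_restrictLine x y h).2

theorem bind₁_eq_zero_of_alongCurve [Infinite K] (hφ : ∀ i, (φ i).IsHomogeneous d)
    (hxy : LinearIndependent K ![x, y]) {a : Fin n → K} (h : alongCurve φ x y a = 0) :
    bind₁ φ (lin a) = 0 :=
  eq_zero_of_restrictLine_eq_zero hxy (isHomogeneous_bind₁ hφ (isHomogeneous_lin a)) h

theorem exists_eq_C_mul_X_pow [IsAlgClosed K] {p : Polynomial K}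
    (h : ∀ t, p.eval t = 0 → t = 0) :
    ∃ c, p = Polynomial.C c * Polynomial.X ^ p.natDegree := by
  have hp : p ≠ 0 := by
    rintro rfl
    exact one_ne_zero (h 1 Polynomial.eval_zero)
  obtain ⟨q, hq, hqd⟩ := Polynomial.exists_eq_pow_rootMultiplicity_mul_and_not_dvd p hp 0
  rw [Polynomial.C_0, sub_zero] at hq hqd
  have hdeg : q.degree = 0 := by
    by_contra hd
    obtain ⟨t, ht⟩ := IsAlgClosed.exists_root q hd
    have ht : q.eval t = 0 := ht
    obtain rfl := h t (by rw [hq, Polynomial.eval_mul, ht, mul_zero])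
    exact hqd (by rwa [Polynomial.X_dvd_iff, Polynomial.coeff_zero_eq_eval_zero])
  refine ⟨p.leadingCoeff, eq_C_mul_X_pow_of_le ?_⟩
  rw [Polynomial.eq_C_of_degree_eq_zero hdeg] at hq
  have hq0 : q.coeff 0 ≠ 0 := by
    intro h0
    rw [h0, Polynomial.C_0, mul_zero] at hq
    exact hp hq
  rw [hq, mul_comm, Polynomial.natDegree_C_mul_X_pow _ _ hq0, Polynomial.C_mul_X_pow_eq_monomial,
    Polynomial.natTrailingDegree_monomial hq0]

end AlongCurve

/-! ### Curves meeting the boundary in at most two points -/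

section Main

variable {K : Type*} [Field K]

theorem mul_mul_eq_of_ne {R : Type*} [CommRing R] (f : Fin 3 → R) (i j k : Fin 3) (hij : i ≠ j)
    (hik : i ≠ k) (hjk : j ≠ k) : f i * f j * f k = f 0 * f 1 * f 2 := by
  fin_cases i <;> fin_cases j <;> fin_cases k <;> simp at hij hik hjk <;> simp <;> ring

variable {F : MvPolynomial (Fin 4) K} {P : Fin 6 → PSpace K 2}
  {π : PSpace K 3 → PSpace K 2} {σ : Fin 4 → MvPolynomial (Fin 3) K} {L M : Fin 3 → Fin 4 → K}
  {κ : K}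

theorem IsCayleySalmon.eq_of_ne (h : IsCayleySalmon F P σ L M κ) {i j k : Fin 3} (hij : i ≠ j)
    (hik : i ≠ k) (hjk : j ≠ k) :
    F = C κ * (lin (L 0) * lin (L 1) * lin (L 2) - lin (M i) * lin (M j) * lin (M k)) := by
  rw [mul_mul_eq_of_ne (fun i => lin (M i)) i j k hij hik hjk]
  exact h.eq

/-- Two lines through one of the points meet only there. -/
theorem mk_mem_range_of_eval_lineForm (hP : InGeneralPosition P) {i j k : Fin 6} (hij : i ≠ j)
    (hik : i ≠ k) (hjk : j ≠ k) {y : Fin 3 → K} (hy : y ≠ 0) (h₁ : eval y (lineForm P i j) = 0)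
    (h₂ : eval y (lineForm P i k) = 0) : Projectivization.mk K y hy ∈ Set.range P := by
  obtain ⟨a, b, rfl⟩ := exists_eq_add_of_eval_lineForm hP.injective hij h₁
  have h3 := eval_lineForm_left (P := P) i k
  have h4 : eval (P j).rep (lineForm P i k) ≠ 0 := hP.eval_lineForm_ne_zero hik hij hjk.symm
  rw [lineForm, eval_lin] at h₂ h3 h4
  rw [dotProduct_add, dotProduct_smul, dotProduct_smul, h3, smul_zero, zero_add, smul_eq_mul] at h₂
  have hb := (mul_eq_zero.1 h₂).resolve_right h4
  refine ⟨i, ?_⟩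
  refine (Projectivization.mk_rep (P i)).symm.trans (mk_eq_mk_of_smul _ _ a ?_).symm
  rw [hb, zero_smul, add_zero]

/-- Along a line of the surface in a plane `M i = 0` and in the plane `L 2 = 0`, the image in the
plane of the blow-up satisfies a linear equation. -/
theorem IsCayleySalmon.exists_linear (hP : InGeneralPosition P) (h : IsCayleySalmon F P σ L M κ)
    (i : Fin 3) : ∃ q : MvPolynomial (Fin 3) K, q.IsHomogeneous 1 ∧ q ≠ 0 ∧
      ∀ y (hy : y ≠ 0), Projectivization.mk K y hy ∉ Set.range P →
        eval y (bind₁ σ (lin (M i))) = 0 → eval y (bind₁ σ (lin (L 2))) = 0 → eval y q = 0 := by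
  have sw : ∀ (a b : Fin 6) {y : Fin 3 → K}, eval y (lineForm P b a) = 0 →
      eval y (lineForm P a b) = 0 := fun a b y h0 => by rw [lineForm_comm, map_neg, h0, neg_zero]
  fin_cases i
  · refine ⟨lineForm P 2 5, isHomogeneous_lineForm _ _, hP.lineForm_ne_zero (by decide),
      fun y hy hyP (h1 : eval y (bind₁ σ (lin (M 0))) = 0) h2 => ?_⟩
    rw [h.M_zero, map_mul, map_mul] at h1
    rw [h.L_two, map_mul, map_mul] at h2
    by_contra h0
    have meet := fun {a b c : Fin 6} (hab : a ≠ b) (hac : a ≠ c) (hbc : b ≠ c) h₁ h₂ =>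
      hyP (mk_mem_range_of_eval_lineForm hP hab hac hbc hy h₁ h₂)
    rw [mul_eq_zero_iff_right h0, mul_eq_zero] at h1
    rw [mul_assoc, mul_eq_zero_iff_left h0, mul_eq_zero] at h2
    rcases h1 with h1 | h1 <;> rcases h2 with h2 | h2
    · exact meet (a := 1) (by decide) (by decide) (by decide) (sw _ _ h1) (sw _ _ h2)
    · exact meet (a := 0) (by decide) (by decide) (by decide) h1 h2
    · exact meet (a := 4) (by decide) (by decide) (by decide) (sw _ _ h1) h2
    · exact meet (a := 3) (by decide) (by decide) (by decide) h1 (sw _ _ h2)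
  · refine ⟨lineForm P 4 1, isHomogeneous_lineForm _ _, hP.lineForm_ne_zero (by decide),
      fun y hy hyP (h1 : eval y (bind₁ σ (lin (M 1))) = 0) h2 => ?_⟩
    rw [h.M_one, map_mul, map_mul] at h1
    rw [h.L_two, map_mul, map_mul] at h2
    by_contra h0
    have meet := fun {a b c : Fin 6} (hab : a ≠ b) (hac : a ≠ c) (hbc : b ≠ c) h₁ h₂ =>
      hyP (mk_mem_range_of_eval_lineForm hP hab hac hbc hy h₁ h₂)
    rw [mul_eq_zero_iff_right h0, mul_eq_zero] at h1
    rw [mul_right_comm, mul_eq_zero_iff_right h0, mul_eq_zero] at h2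
    rcases h1 with h1 | h1 <;> rcases h2 with h2 | h2
    · exact meet (a := 2) (by decide) (by decide) (by decide) h1 h2
    · exact meet (a := 3) (by decide) (by decide) (by decide) (sw _ _ h1) (sw _ _ h2)
    · exact meet (a := 5) (by decide) (by decide) (by decide) h1 (sw _ _ h2)
    · exact meet (a := 0) (by decide) (by decide) (by decide) (sw _ _ h1) h2
  · refine ⟨lineForm P 0 3, isHomogeneous_lineForm _ _, hP.lineForm_ne_zero (by decide),
      fun y hy hyP (h1 : eval y (bind₁ σ (lin (M 2))) = 0) h2 => ?_⟩
    rw [h.M_two, map_mul, map_mul] at h1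
    rw [h.L_two, map_mul, map_mul] at h2
    by_contra h0
    have meet := fun {a b c : Fin 6} (hab : a ≠ b) (hac : a ≠ c) (hbc : b ≠ c) h₁ h₂ =>
      hyP (mk_mem_range_of_eval_lineForm hP hab hac hbc hy h₁ h₂)
    rw [mul_eq_zero_iff_right h0, mul_eq_zero] at h1
    rw [mul_eq_zero_iff_right h0, mul_eq_zero] at h2
    rcases h1 with h1 | h1 <;> rcases h2 with h2 | h2
    · exact meet (a := 5) (by decide) (by decide) (by decide) (sw _ _ h1) (sw _ _ h2)
    · exact meet (a := 4) (by decide) (by decide) (by decide) h1 h2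
    · exact meet (a := 2) (by decide) (by decide) (by decide) (sw _ _ h1) h2
    · exact meet (a := 1) (by decide) (by decide) (by decide) h1 (sw _ _ h2)

variable {f : PSpace K 1 → PSpace K 3} {d : ℕ}
  {φ : Fin 4 → MvPolynomial (Fin 2) K}

/-- The boundary contains the zero loci of `L 0` and `L 1`, hence these forms restrict to monomials
on a curve which meets the boundary only at the parameters `x` and `y`. -/
theorem IsCayleySalmon.eq_zero_of_eval_alongCurve [CharZero K] (hF : IsSmoothCubic F)
    (hP : InGeneralPosition P) (hσ : IsInverseForms F P π σ) (h : IsCayleySalmon F P σ L M κ)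
    (hf : IsGivenBy Set.univ f d φ) (hfF : ∀ v, eval (evalForms φ v) F = 0) {x y : Fin 2 → K}
    (hxy : LinearIndependent K ![x, y])
    (hbd : ∀ v (hv : v ≠ 0), f (Projectivization.mk K v hv) ∈ boundary (zeroLocus F) π P →
      (∃ c : K, v = c • x) ∨ ∃ c : K, v = c • y)
    {b : Fin 3} (hb : b ≠ 2) (t : K) (ht : (alongCurve φ x y (L b)).eval t = 0) : t = 0 := by
  rw [eval_alongCurve] at ht
  have hv : x + t • y ≠ 0 := by
    have := add_smul_ne_zero_of_pair hxy (a := 1) (b := t) (Or.inl one_ne_zero)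
    rwa [one_smul] at this
  have h0 := hf.ne_zero _ hv trivial
  have h1 := h.mem_boundary hF hP hσ h0 (hfF _) hb ht
  rw [← hf.eq_mk _ hv trivial h0] at h1
  rw [LinearIndependent.pair_iff] at hxy
  rcases hbd _ hv h1 with ⟨c, hc⟩ | ⟨c, hc⟩
  · exact (hxy (1 - c) t (by rw [sub_smul, one_smul, ← hc]; abel)).2
  · exact absurd (hxy 1 (t - c) (by rw [sub_smul, one_smul, ← hc]; abel)).1 one_ne_zero

/-- A curve which meets the boundary in at most two points lies in a plane through one of the lines
of the hexagons, or in two planes whose intersection is a line on the surface. -/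
theorem IsCayleySalmon.exists_bind₁_eq_zero [IsAlgClosed K] [CharZero K] (hF : IsSmoothCubic F)
    (hG : IsGeneric F) (hP : InGeneralPosition P) (hσ : IsInverseForms F P π σ)
    (h : IsCayleySalmon F P σ L M κ) (hf : IsGivenBy Set.univ f d φ) (hd : 0 < d)
    (hfF : ∀ v, eval (evalForms φ v) F = 0) {x y : Fin 2 → K}
    (hxy : LinearIndependent K ![x, y])
    (hbd : ∀ v (hv : v ≠ 0), f (Projectivization.mk K v hv) ∈ boundary (zeroLocus F) π P →
      (∃ c : K, v = c • x) ∨ ∃ c : K, v = c • y) :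
    (∃ i, bind₁ φ (lin (M i)) = 0 ∧ bind₁ φ (lin (L 2)) = 0) ∨
      ∃ i b, b ≠ 2 ∧ ∃ c : K, bind₁ φ (lin (M i - c • L b)) = 0 := by
  have : Infinite K := IsAlgClosed.instInfinite
  have hroot := fun {b} hb => h.eq_zero_of_eval_alongCurve hF hP hσ hf hfF hxy hbd (b := b) hb
  have hzero : ∀ {a}, alongCurve φ x y a = 0 → bind₁ φ (lin a) = 0 :=
    bind₁_eq_zero_of_alongCurve hf.homog hxy
  set ρ := alongCurve φ x y with hρ
  have hρ0 : ∀ b, b ≠ 2 → ρ (L b) ≠ 0 := fun b hb h0 =>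
    one_ne_zero (hroot hb 1 (by rw [h0, Polynomial.eval_zero]))
  have hprod : ρ (L 0) * ρ (L 1) * ρ (L 2) = ρ (M 0) * ρ (M 1) * ρ (M 2) := by
    refine Polynomial.funext fun t => ?_
    have h1 := hfF (x + t • y)
    rw [h.eq, map_mul, eval_C, mul_eq_zero_iff_left h.ne_zero] at h1
    simp only [map_mul, map_sub, eval_lin] at h1
    simp only [Polynomial.eval_mul, hρ, eval_alongCurve]
    exact sub_eq_zero.1 h1
  by_cases hM : ∃ i, ρ (M i) = 0
  · obtain ⟨i, hi⟩ := hM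
    refine Or.inl ⟨i, hzero hi, hzero ?_⟩
    have h1 : ρ (M 0) * ρ (M 1) * ρ (M 2) = 0 := by
      obtain ⟨j, k, hj, hk, hjk⟩ := exists_others i
      rw [← mul_mul_eq_of_ne (fun i => ρ (M i)) i j k hj.symm hk.symm hjk, hi, zero_mul, zero_mul]
    rw [← hprod] at h1
    exact (mul_eq_zero.1 h1).resolve_left
      (mul_ne_zero (hρ0 0 (by decide)) (hρ0 1 (by decide)))
  push Not at hM
  have hx0 : x ≠ 0 := hxy.ne_zero 0
  have hy0 : y ≠ 0 := hxy.ne_zero 1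
  have no_zero : ∀ v (hv : v ≠ 0) (i k : Fin 3), i ≠ k → L 0 ⬝ᵥ evalForms φ v = 0 →
      L 1 ⬝ᵥ evalForms φ v = 0 → M i ⬝ᵥ evalForms φ v = 0 → M k ⬝ᵥ evalForms φ v = 0 → False := by
    intro v hv i k hik h1 h2 h3 h4
    obtain ⟨j, hji, hjk⟩ := exists_third hik
    rw [← eval_lin] at h1 h2 h3 h4
    exact hF.false_of_common_zero (h.eq_of_ne hik hji.symm hjk.symm) (hf.ne_zero v hv trivial)
      h1 h2 h3 h4
  have hconf : IsConfiguration d (ρ (L 0)) (ρ (L 1)) (ρ (L 2)) fun i => ρ (M i) :=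
    { natDegree_l₃ := natDegree_alongCurve hf.homog _
      natDegree_m := fun i => natDegree_alongCurve hf.homog _
      m_ne_zero := hM
      prod_eq := fun i j k hij hik hjk => by
        rw [hprod, mul_mul_eq_of_ne (fun i => ρ (M i)) i j k hij hik hjk]
      ne_at := by
        rintro n (rfl | rfl) i k hik
        · simp only [hρ, coeff_zero_alongCurve]
          exact no_zero x hx0 i k hik
        · simp only [hρ, coeff_alongCurve hf.homog]
          exact no_zero y hy0 i k hik
      exists_isNormal := fun i j k hij hik hjk => by
        obtain ⟨r₁, r₂, r₃, p₁, p₂, p₃, u, v, w, z, hN⟩ :=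
          hG.exists_isNormal hF h.ne_zero (h.eq_of_ne hij hik hjk)
        exact ⟨_, _, _, _, _, _, _, _, _, _, hN.map ρ⟩ }
  obtain ⟨c₁, h₁⟩ := exists_eq_C_mul_X_pow (hroot (b := 0) (by decide))
  obtain ⟨c₂, h₂⟩ := exists_eq_C_mul_X_pow (hroot (b := 1) (by decide))
  obtain ⟨i, c, hi⟩ := hconf.exists_eq_C_mul hd (natDegree_alongCurve hf.homog _)
    (natDegree_alongCurve hf.homog _) h₁ h₂
  have hfin : ∀ b, ρ (M i) = Polynomial.C c * ρ (L b) → bind₁ φ (lin (M i - c • L b)) = 0 := by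
    intro b hb
    apply hzero
    rw [map_sub, map_smul, ← Polynomial.C_mul', hb, sub_self]
  rcases hi with hi | hi
  · exact Or.inr ⟨i, 0, by decide, c, hfin 0 hi⟩
  · exact Or.inr ⟨i, 1, by decide, c, hfin 1 hi⟩

/-- The image in the plane of a rational curve on a generic cubic surface which meets the boundary
in at most two points is a point, a line or a conic. -/
theorem IsGeneric.exists_eq_or_exists_isPlaneCurve [IsAlgClosed K] [CharZero K]
    (hF : IsSmoothCubic F) (hgen : IsGeneric F) (hP : InGeneralPosition P)
    (hB : IsBlowUpAt (zeroLocus F) π P) (hf : IsRegularOn Set.univ f)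
    (hfF : ∀ t, f t ∈ zeroLocus F) (hbd : (f ⁻¹' boundary (zeroLocus F) π P).encard ≤ 2) :
    (∃ p, ∀ t, π (f t) = p) ∨ ∃ d ≤ 2, IsPlaneCurveOfDegree (Set.range fun t => π (f t)) d := by
  obtain ⟨σ, hσ⟩ := hB.exists_isInverseForms hF
  obtain ⟨L, M, κ, hCS⟩ := hσ.exists_isCayleySalmon hF hP hB
  obtain ⟨d, φ, hφ⟩ := hf.exists_isGivenBy (by norm_num) (by simp)
  obtain ⟨n, γ, hγ⟩ := (hφ.isRegularOn_comp hfF hB.regular).exists_isGivenBy (by norm_num) (by simp)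
  rcases Nat.eq_zero_or_pos d with rfl | hd
  · obtain ⟨p, hp⟩ := hφ.exists_eq_of_degree_eq_zero
    exact Or.inl ⟨π p, fun t => by rw [hp]⟩
  rcases Nat.eq_zero_or_pos n with rfl | hn
  · exact Or.inl hγ.exists_eq_of_degree_eq_zero
  refine (hγ.exists_eq_or_eq_zero P).imp_right fun hoff => ?_
  have hφF : ∀ v, eval (evalForms φ v) F = 0 := by
    intro v
    by_cases hv : v = 0
    · have h0 : evalForms φ v = 0 := by
        rw [hv, show (0 : Fin 2 → K) = (0 : K) • 0 by simp, evalForms_smul hφ.homog,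
          zero_pow hd.ne', zero_smul]
      rw [h0, show (0 : Fin 4 → K) = (0 : K) • 0 by simp,
        eval_smul_of_isHomogeneous hF.isHomogeneous]
      simp
    · have h0 := hφ.ne_zero v hv trivial
      rw [← mk_mem_zeroLocus hF.isHomogeneous h0, ← hφ.eq_mk v hv trivial h0]
      exact hfF _
  -- A linear relation between the forms `φ` gives a cubic relation between the forms `γ`.
  have pull : ∀ v (hv : v ≠ 0), π (f (Projectivization.mk K v hv)) ∉ Set.range P →
      ∀ a, bind₁ φ (lin a) = 0 → eval (evalForms γ v) (bind₁ σ (lin a)) = 0 := by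
    intro v hv hvP a ha
    have h0 := hφ.ne_zero v hv trivial
    have h1 := hγ.ne_zero v hv trivial
    have h2 := hγ.eq_mk v hv trivial h1
    rw [h2] at hvP
    rw [hφ.eq_mk v hv trivial h0] at h2
    obtain ⟨c, hc, hcx⟩ := hσ.left_inv _ h0 (hφF v) _ h1 h2 hvP
    have h3 : a ⬝ᵥ evalForms φ v = 0 := by rw [← eval_lin, ← eval_bind₁, ha, map_zero]
    rw [hcx, dotProduct_smul, smul_eq_mul, mul_eq_zero_iff_left hc] at h3
    rw [eval_bind₁, eval_lin, h3]
  -- The curve meets the boundary only at two parameters `t₀` and `t₁`.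
  obtain ⟨t₀, t₁, ht, hsub⟩ : ∃ t₀ t₁, t₀ ≠ t₁ ∧
      f ⁻¹' boundary (zeroLocus F) π P ⊆ {t₀, t₁} := by
    have h2 : (2 : ℕ∞) ≤ (Set.univ : Set (PSpace K 1)).encard := by
      have e0 : (![1, 0] : Fin 2 → K) ≠ 0 := fun h => by simpa using congrFun h 0
      have e1 : (![0, 1] : Fin 2 → K) ≠ 0 := fun h => by simpa using congrFun h 1
      rw [← Set.encard_pair (x := Projectivization.mk K _ e0) (y := Projectivization.mk K _ e1)]
      · exact Set.encard_le_encard (Set.subset_univ _)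
      · intro h
        obtain ⟨c, hc, h⟩ := exists_smul_of_mk_eq_mk h
        simpa using congrFun h 0
    obtain ⟨r, hr, -, hr2⟩ := Set.exists_superset_subset_encard_eq (Set.subset_univ _) hbd h2
    obtain ⟨t₀, t₁, ht, rfl⟩ := Set.encard_eq_two.1 hr2
    exact ⟨t₀, t₁, ht, hr⟩
  have hrep : ∀ v (hv : v ≠ 0) (t : PSpace K 1), Projectivization.mk K v hv = t →
      ∃ c : K, v = c • t.rep := by
    intro v hv t h
    rw [← Projectivization.mk_rep t] at h
    obtain ⟨c, -, hc⟩ := exists_smul_of_mk_eq_mk h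
    exact ⟨c, hc⟩
  rcases hCS.exists_bind₁_eq_zero hF hgen hP hσ hφ hd hφF
    (Projectivization.linearIndependent_pair_iff_ne.2 ht) (fun v hv hvb =>
      (hsub hvb).imp (hrep v hv _) (hrep v hv _)) with ⟨i, h1, h2⟩ | ⟨i, b, hb, c, h1⟩
  · obtain ⟨q, hq, hq0, h3⟩ := hCS.exists_linear hP i
    refine ⟨1, one_le_two, hγ.isPlaneCurve_one hn.ne' hq hq0 (hoff _ fun v hv hvP => ?_)⟩
    rw [eval_bind₁]
    refine h3 _ (hγ.ne_zero v hv trivial) ?_ (pull v hv hvP _ h1) (pull v hv hvP _ h2)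
    rwa [← hγ.eq_mk v hv trivial]
  · obtain ⟨q₁, q₂, hq₁, hq₁0, hq₂, hq₂0, hqq⟩ := hCS.exists_factor hP i b hb c
    have h2 : bind₁ γ (q₁ * q₂) = 0 := hoff _ fun v hv hvP => by
      rw [eval_bind₁, ← hqq]
      exact pull v hv hvP _ h1
    rw [map_mul, mul_eq_zero] at h2
    rcases h2 with h2 | h2
    · exact ⟨1, one_le_two, hγ.isPlaneCurve_one hn.ne' hq₁ hq₁0 h2⟩
    · exact hγ.exists_isPlaneCurve hn.ne' hq₂ hq₂0 h2

end Main

end CubicSurface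

theorem proposition4p1 (K : Type*) [Field K] [IsAlgClosed K] [CharZero K] :
    CubicSurface.HoldsForGenericSmoothCubic K fun F =>
      ∀ (P : Fin 6 → CubicSurface.PSpace K 2)
        (π : CubicSurface.PSpace K 3 → CubicSurface.PSpace K 2),
        CubicSurface.InGeneralPosition P →
        CubicSurface.IsBlowUpAt (CubicSurface.zeroLocus F) π P →
        ∀ f : CubicSurface.PSpace K 1 → CubicSurface.PSpace K 3,
          CubicSurface.IsRegularOn Set.univ f →
          (∀ t, f t ∈ CubicSurface.zeroLocus F) →
          (f ⁻¹' CubicSurface.boundary (CubicSurface.zeroLocus F) π P).encard ≤ 2 →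
          (∃ p : CubicSurface.PSpace K 2, ∀ t, π (f t) = p) ∨
          ∃ d ≤ 2, CubicSurface.IsPlaneCurveOfDegree (Set.range fun t => π (f t)) d := by
  obtain ⟨G, hG0, hG⟩ := CubicSurface.exists_isGeneric K
  exact ⟨G, hG0, fun F hF hFG P π hP hB f hf hfF hbd =>
    (hG F hFG).exists_eq_or_exists_isPlaneCurve hF hP hB hf hfF hbd⟩
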